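/- **Theorem (Universal Pestov identity).** Let $(M,g)$ be a smooth closed oriented Riemannian manifold of dimension $n\ge 2$, and let $\pi:FM\to M$ be the principal $\mathrm{SO}(n)$-bundle of its oriented orthonormal frames, i.e. of the orientation-preserving linear isometries $w:\mathbb R^n\to T_xM$, $x=\pi(w)\in M$. Let $(\mathbf e_i)$ be the canonical basis of $\mathbb R^n$, let $\Lambda^2\mathbb R^n$ carry the inner product for which $(\mathbf e_i\wedge\mathbf e_j)_{i<j}$ is orthonormal, and identify $\Lambda^2\mathbb R^n$ with the skew-symmetric endomorphisms of $\mathbb R^n$ by $\xi\mapsto(\theta\mapsto\iota_\theta\xi)$, so that $(\mathbf e_i\wedge\mathbf e_j)\theta=\theta_i\mathbf e_j-\theta_j\mathbf e_i$. For $\xi\in\Lambda^2\mathbb R^n$ and $\theta\in\mathbb R^n$ let $Y_\xi(w)=\frac{d}{dt}\big|_{t=0}(w\circ e^{t\xi})$, and let $B_\theta(w)$ be the horizontal lift to $w$, for the Levi-Civita connection $\nabla$ of $g$, of $w(\theta)\in T_{\pi(w)}M$. Let $\mathbf X=B_{\mathbf e_1}$ be the generator of the frame flow, acting also componentwise on $\Lambda^2\mathbb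 R^n$-valued functions, and let $\nabla_{\mathbb V}f=\sum_{i<j}(Y_{\mathbf e_i\wedge\mathbf e_j}f)\,\mathbf e_i\wedge\mathbf e_j$ be the vertical gradient. Let $\mathcal R(X,Y)=\nabla_X\nabla_Y-\nabla_Y\nabla_X-\nabla_{[X,Y]}$ be the Riemann tensor, viewed as an endomorphism of $\Lambda^2TM$ by $\langle\mathcal R(X\wedge Y),W\wedge Z\rangle=\langle\mathcal R(X,Y)W,Z\rangle$, and define the endomorphism $R_{FM}(w)$ of $\Lambda^2\mathbb R^n$ by $$\langle R_{FM}(w)\xi,\xi'\rangle=\big\langle \xi,\,w^{-1}\mathcal R_{\pi(w)}\big(w(\xi'\mathbf e_1)\wedge w(\mathbf e_1)\big)\big\rangle .$$ Let the Liouville measure $\mu$ be the Riemannian volume measure of the metric on $FM$ for which the vector fields $B_{\mathbf e_i}$ ($1\le i\le n$) and $Y_{\mathbf e_i\wedge\mathbf e_j}$ ($i<j$) are orthonormal; all $L^2$-norms and $L^2$-inner products are taken with respect to $\mu$. Then for every (real- or complex-valued) $u\in C^\infty(FM)$ the functions $\nabla_{\mathbb V}\mathbf Xu$, $\mathbf X\nabla_{\mathbb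 V}u$, $\mathbf Xu$, $\nabla_{\mathbb V}u$ and $R_{FM}\nabla_{\mathbb V}u$ are in $L^2$, and $$\|\nabla_{\mathbb V}\mathbf Xu\|^2_{L^2}-\|\mathbf X\nabla_{\mathbb V}u\|^2_{L^2}=(n-1)\|\mathbf Xu\|^2_{L^2}-\langle R_{FM}\nabla_{\mathbb V}u,\nabla_{\mathbb V}u\rangle_{L^2}.$$ -/

import Mathlib

open scoped Manifold ContDiff Bundle
open MeasureTheory

noncomputable section

namespace Pestov

/-- Euclidean space `ℝⁿ`. -/
abbrev Eu (n : ℕ) := EuclideanSpace ℝ (Fin n)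

/-- The canonical basis `𝐞₁, …, 𝐞ₙ` of `ℝⁿ` (indexed by `0, …, n - 1`). -/
def e {n : ℕ} (i : Fin n) : Eu n := EuclideanSpace.single i 1

/-! ### Two-forms on `ℝⁿ` -/

/-- The index set `{(i, j) : i < j}`. -/
abbrev Pairs (n : ℕ) := {p : Fin n × Fin n // p.1 < p.2}

/-- `Λ²ℝⁿ ⊗ 𝕜`, in coordinates with respect to the basis `𝐞ᵢ ∧ 𝐞ⱼ`, `i < j`, which is declared
orthonormal. -/
abbrev Lam2 (𝕜 : Type*) (n : ℕ) := EuclideanSpace 𝕜 (Pairs n)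

/-- The orthonormal basis `ω_p = 𝐞ᵢ ∧ 𝐞ⱼ`, `p = (i, j)`, `i < j`, of `Λ²ℝⁿ`. -/
def omega {n : ℕ} (p : Pairs n) : Lam2 ℝ n := EuclideanSpace.single p 1

/-- The identification of `Λ²ℝⁿ` with the skew-symmetric endomorphisms of `ℝⁿ` by contraction,
`ξ ↦ (θ ↦ ι_θ ξ)`; thus `𝐞ᵢ ∧ 𝐞ⱼ` is the endomorphism `θ ↦ θᵢ 𝐞ⱼ - θⱼ 𝐞ᵢ`. -/
def toEnd {n : ℕ} (ξ : Lam2 ℝ n) : Eu n →L[ℝ] Eu n :=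
  ∑ p : Pairs n, ξ p • ((EuclideanSpace.proj p.1.1 : Eu n →L[ℝ] ℝ).smulRight (e p.1.2)
    - (EuclideanSpace.proj p.1.2 : Eu n →L[ℝ] ℝ).smulRight (e p.1.1))

/-- The `𝕜`-linear extension to `Λ²ℝⁿ ⊗ 𝕜` of an endomorphism of `Λ²ℝⁿ`. -/
def extendScalars {𝕜 : Type*} [RCLike 𝕜] {n : ℕ} (T : Lam2 ℝ n →L[ℝ] Lam2 ℝ n) (F : Lam2 𝕜 n) :
    Lam2 𝕜 n :=
  WithLp.toLp 2 fun p => ∑ q : Pairs n, ((T (omega q) p : ℝ) : 𝕜) * F q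

/-! ### The Levi-Civita connection and the Riemann tensor in charts -/

section Manifold

variable {n : ℕ} {M : Type*} [TopologicalSpace M] [ChartedSpace (Eu n) M]
  [IsManifold (𝓡 n) ∞ M]

variable (n M) in
/-- Smooth Riemannian metrics on the `n`-manifold `M`. -/
abbrev RMetric :=
  Bundle.ContMDiffRiemannianMetric (𝓡 n) ∞ (Eu n) (fun x : M => TangentSpace (𝓡 n) x)

/-- The coordinate vector field `∂ᵢ` of the chart at `x`, at the point with coordinates `y`. -/
def coordField (x : M) (y : Eu n) (i : Fin n) :
    TangentSpace (𝓡 n) ((extChartAt (𝓡 n) x).symm y) :=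
  mfderiv 𝓘(ℝ, Eu n) (𝓡 n) (extChartAt (𝓡 n) x).symm y (e i)

/-- The matrix `g_{ij} = g(∂ᵢ, ∂ⱼ)` of the metric in the chart at `x`, as a function of the
coordinates `y`. -/
def gram (g : RMetric n M) (x : M) (y : Eu n) : Matrix (Fin n) (Fin n) ℝ :=
  Matrix.of fun i j =>
    g.inner ((extChartAt (𝓡 n) x).symm y) (coordField x y i) (coordField x y j)

/-- The partial derivative `∂ᵢ f`. -/
def partialD (i : Fin n) (f : Eu n → ℝ) (y : Eu n) : ℝ := fderiv ℝ f y (e i)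

/-- The Christoffel symbol `Γᵏᵢⱼ` of the Levi-Civita connection in the chart at `x`,
at the point with coordinates `y`; so `∇_{∂ᵢ} ∂ⱼ = ∑ₖ Γᵏᵢⱼ ∂ₖ`. -/
def christoffel (g : RMetric n M) (x : M) (i j k : Fin n) (y : Eu n) : ℝ :=
  (1 / 2) * ∑ l, (gram g x y)⁻¹ k l *
    (partialD i (fun z => gram g x z j l) y + partialD j (fun z => gram g x z i l) y
      - partialD l (fun z => gram g x z i j) y)

/-- The coefficient `Rˡᵢⱼₖ` of the Riemann tensor `R(X, Y) = ∇_X ∇_Y - ∇_Y ∇_X - ∇_{[X, Y]}` in the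
chart at `x`: `R(∂ᵢ, ∂ⱼ) ∂ₖ = ∑ₗ Rˡᵢⱼₖ ∂ₗ`. -/
def riemannCoeff (g : RMetric n M) (x : M) (i j k l : Fin n) (y : Eu n) : ℝ :=
  partialD i (christoffel g x j k l) y - partialD j (christoffel g x i k l) y
    + ∑ m, (christoffel g x i m l y * christoffel g x j k m y
      - christoffel g x j m l y * christoffel g x i k m y)

/- Mathlib's `TangentSpace (𝓡 n) x` is `ℝⁿ` by means of the basis `∂ᵢ` of the chart at `x`, so the
components of tangent vectors at `x` below are those with respect to that chart. -/

/-- The bilinear map `Γ_x(a, b) = ∑ Γᵏᵢⱼ aᵢ bⱼ ∂ₖ` of the chart at `x`, at the point `x`. -/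
def christoffelMap (g : RMetric n M) (x : M) : Eu n →L[ℝ] Eu n →L[ℝ] Eu n :=
  ∑ i, ∑ j, ∑ k, (EuclideanSpace.proj i : Eu n →L[ℝ] ℝ).smulRight
    ((EuclideanSpace.proj j : Eu n →L[ℝ] ℝ).smulRight
      (christoffel g x i j k (extChartAt (𝓡 n) x x) • e k))

/-- The Riemann tensor `R_x(a, b) c` on `T_x M`. -/
def riemann (g : RMetric n M) (x : M) (a b c : Eu n) : TangentSpace (𝓡 n) x :=
  (∑ i, ∑ j, ∑ k, ∑ l,
    (riemannCoeff g x i j k l (extChartAt (𝓡 n) x x) * a i * b j * c k) • e l : Eu n)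

/-! ### The bundle of oriented orthonormal frames -/

variable (n M) in
/-- An orientation of `M`, given by a continuous nowhere vanishing `n`-form. Only its sign on frames
is used. -/
structure OrientationForm where
  form (x : M) : TangentSpace (𝓡 n) x [⋀^Fin n]→ₗ[ℝ] ℝ
  ne_zero (x : M) : form x ≠ 0
  continuousOn (x : M) : ContinuousOn
    (fun y => form ((extChartAt (𝓡 n) x).symm y) (coordField x y)) (extChartAt (𝓡 n) x).target

variable (n M) in
/-- The total space of the vector bundle `Hom(ℝⁿ, TM)` over `M`: a smooth manifold, whose points are
the pairs of a point `x` and a linear map `w : ℝⁿ → T_x M`. -/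
abbrev HomBundle :=
  Bundle.TotalSpace (Eu n →L[ℝ] Eu n)
    (fun x : M => Bundle.Trivial M (Eu n) x →L[ℝ] TangentSpace (𝓡 n) x)

variable (n) in
/-- The model with corners of the manifold `Hom(ℝⁿ, TM)`. -/
abbrev IHom := (𝓡 n).prod 𝓘(ℝ, Eu n →L[ℝ] Eu n)

instance : MeasurableSpace (HomBundle n M) := borel _

instance : BorelSpace (HomBundle n M) := ⟨rfl⟩

/-- The vector `w(θ)`, for a linear map `w : ℝⁿ → T_x M` and `θ` in `ℝⁿ`. -/
def ev (w : HomBundle n M) (θ : Eu n) : TangentSpace (𝓡 n) w.proj := w.snd θ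

/-- The oriented orthonormal frame bundle `FM`, as a closed embedded submanifold of `Hom(ℝⁿ, TM)`:
the orientation-preserving linear isometries `w : ℝⁿ → T_x M`. -/
def FM (g : RMetric n M) (o : OrientationForm n M) : Set (HomBundle n M) :=
  {w | (∀ a b : Eu n, g.inner w.proj (ev w a) (ev w b) = inner ℝ a b) ∧
    0 < o.form w.proj (fun i => ev w (e i))}

/-! Tangent vectors to `Hom(ℝⁿ, TM)` at `w`, `x = π(w)`, are pairs `(a, A)` with `a` in `ℝⁿ` and `A`
an endomorphism of `ℝⁿ`: the velocity of a curve `t ↦ (x(t), w(t))` is `(x'(0), w'(0))`, read in the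
chart at `x` and in the trivialization of `TM` which this chart induces. -/

/-- The tangent vector `(a, A)` to `Hom(ℝⁿ, TM)` at `w`. -/
def mkTangent (w : HomBundle n M) (a : Eu n) (A : Eu n →L[ℝ] Eu n) :
    TangentSpace (IHom n) w :=
  ((a, A) : Eu n × (Eu n →L[ℝ] Eu n))

/-- The differential `dπ(ζ)` of the projection `π` to `M`. -/
def dproj (w : HomBundle n M) (ζ : TangentSpace (IHom n) w) : TangentSpace (𝓡 n) w.proj :=
  (show Eu n × (Eu n →L[ℝ] Eu n) from ζ).1

/-- The connection map: the covariant derivative `Dw/dt(0)`, a linear map `ℝⁿ → T_x M`, of a curve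
of linear maps `t ↦ w(t) : ℝⁿ → T_{x(t)} M` with velocity `ζ` at `t = 0`. The horizontal
space of the Levi-Civita connection at `w` is its kernel. -/
def connMap (g : RMetric n M) (w : HomBundle n M) (ζ : TangentSpace (IHom n) w) :
    Eu n →L[ℝ] TangentSpace (𝓡 n) w.proj :=
  (show Eu n × (Eu n →L[ℝ] Eu n) from ζ).2
    + (christoffelMap g w.proj (dproj w ζ)).comp w.snd

/-- The vertical vector `ξ^𝕍`, the velocity at `t = 0` of `w ∘ exp(t ξ)`. -/
def Y (ξ : Lam2 ℝ n) (w : HomBundle n M) : TangentSpace (IHom n) w :=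
  mkTangent w 0 (w.snd.comp (toEnd ξ))

/-- The horizontal lift of `Z` in `T_x M` to `w`: the vector with `dπ = Z` in the kernel of the
connection map. -/
def horizontalLift (g : RMetric n M) (w : HomBundle n M) (Z : TangentSpace (𝓡 n) w.proj) :
    TangentSpace (IHom n) w :=
  mkTangent w Z (-(christoffelMap g w.proj Z).comp w.snd)

/-- The standard horizontal vector field `B_θ(w) = w(θ)^ℍ`. -/
def B (g : RMetric n M) (θ : Eu n) (w : HomBundle n M) : TangentSpace (IHom n) w :=
  horizontalLift g w (ev w θ)

/-- The generator `𝐗 = B_{𝐞₁}` of the frame flow. -/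
def X [NeZero n] (g : RMetric n M) (w : HomBundle n M) : TangentSpace (IHom n) w := B g (e 0) w

/-! ### Differential operators on `FM` -/

/-- The derivative `Z f` of a function `f` on `FM` with values in a normed space, in the direction
of a vector field `Z` tangent to `FM`. It only depends on the values of `f` on `FM`. -/
def der {V : Type*} [NormedAddCommGroup V] [NormedSpace ℝ V]
    (g : RMetric n M) (o : OrientationForm n M)
    (Z : (w : HomBundle n M) → TangentSpace (IHom n) w) (f : HomBundle n M → V)
    (w : HomBundle n M) : V :=
  mfderivWithin (IHom n) 𝓘(ℝ, V) f (FM g o) w (Z w)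

/-- The vertical gradient `∇_𝕍 f = ∑_{i < j} (Y_{𝐞ᵢ ∧ 𝐞ⱼ} f) 𝐞ᵢ ∧ 𝐞ⱼ`. -/
def gradV {𝕜 : Type*} [RCLike 𝕜] (g : RMetric n M) (o : OrientationForm n M)
    (f : HomBundle n M → 𝕜) (w : HomBundle n M) : Lam2 𝕜 n :=
  WithLp.toLp 2 fun p => der g o (Y (omega p)) f w

/-- The two-form `w⁻¹ 𝓡_x (w(a) ∧ w(b))` in `Λ²ℝⁿ`, where
`⟨𝓡(X ∧ Y), W ∧ Z⟩ = ⟨R(X, Y) W, Z⟩`. -/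
def curvTwoForm (g : RMetric n M) (w : HomBundle n M) (a b : Eu n) : Lam2 ℝ n :=
  WithLp.toLp 2 fun p =>
    g.inner w.proj (riemann g w.proj (ev w a) (ev w b) (ev w (e p.1.1))) (ev w (e p.1.2))

/-- The endomorphism `R_{FM}(w)` of `Λ²ℝⁿ`:
`⟨R_{FM}(w) ξ, ξ'⟩ = ⟨ξ, w⁻¹ 𝓡_x (w(ξ' 𝐞₁) ∧ w(𝐞₁))⟩`. -/
def RFM [NeZero n] (g : RMetric n M) (w : HomBundle n M) : Lam2 ℝ n →L[ℝ] Lam2 ℝ n :=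
  ∑ p : Pairs n,
    (innerSL ℝ (curvTwoForm g w (toEnd (omega p) (e 0)) (e 0))).smulRight (omega p)

/-! ### The Liouville measure -/

/-- The Riemannian metric `G_{FM}` on `FM`, for which the `B_{𝐞ᵢ}` and the `Y_{𝐞ᵢ ∧ 𝐞ⱼ}`, `i < j`,
form an orthonormal basis at each point: `g(dπ ζ, w 𝐞ᵢ)` is the component of `ζ` along `B_{𝐞ᵢ}`,
and `g(K ζ 𝐞ᵢ, w 𝐞ⱼ)`, `K` the connection map, the one along `Y_{𝐞ᵢ ∧ 𝐞ⱼ}`. -/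
def GFM (g : RMetric n M) (w : HomBundle n M) (ζ ζ' : TangentSpace (IHom n) w) : ℝ :=
  (∑ i : Fin n, g.inner w.proj (dproj w ζ) (ev w (e i)) * g.inner w.proj (dproj w ζ') (ev w (e i)))
  + ∑ p : Pairs n, g.inner w.proj (connMap g w ζ (e p.1.1)) (ev w (e p.1.2))
      * g.inner w.proj (connMap g w ζ' (e p.1.1)) (ev w (e p.1.2))

/-- The coordinate space `ℝᴺ`, `N = n + n (n - 1) / 2 = dim FM`, of local parametrizations. -/
abbrev ParamSpace (n : ℕ) := EuclideanSpace ℝ (Fin n ⊕ Pairs n)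

/-- A smooth local parametrization of the manifold `FM`. -/
structure LocalParam (g : RMetric n M) (o : OrientationForm n M) where
  toFun : ParamSpace n → HomBundle n M
  domain : Set (ParamSpace n)
  isOpen_domain : IsOpen domain
  contMDiffOn : ContMDiffOn 𝓘(ℝ, ParamSpace n) (IHom n) ∞ toFun domain
  injOn : Set.InjOn toFun domain
  immersion : ∀ y ∈ domain,
    Function.Injective (mfderiv 𝓘(ℝ, ParamSpace n) (IHom n) toFun y)
  mapsTo : Set.MapsTo toFun domain (FM g o)

/-- The Riemannian volume density `√det G_{FM}(∂ₐψ, ∂_bψ)` in a local parametrization `ψ`. -/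
def LocalParam.density {g : RMetric n M} {o : OrientationForm n M} (ψ : LocalParam g o)
    (y : ParamSpace n) : ℝ :=
  √(Matrix.of fun a b : Fin n ⊕ Pairs n =>
    GFM g (ψ.toFun y)
      (mfderiv 𝓘(ℝ, ParamSpace n) (IHom n) ψ.toFun y (EuclideanSpace.single a 1))
      (mfderiv 𝓘(ℝ, ParamSpace n) (IHom n) ψ.toFun y (EuclideanSpace.single b 1))).det

/-- The Liouville measure: the Riemannian volume measure of `(FM, G_{FM})`, as a Borel measure on
`Hom(ℝⁿ, TM)` carried by `FM`. It is the least measure which is on the image of each local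
parametrization `ψ` at least the image under `ψ` of `√det(G_{FM}(∂ₐψ, ∂_bψ)) dy`; as those image
measures agree on overlaps, it equals the latter there. -/
def liouville (g : RMetric n M) (o : OrientationForm n M) : Measure (HomBundle n M) :=
  ⨆ ψ : LocalParam g o,
    ((volume.restrict ψ.domain).withDensity fun y => ENNReal.ofReal (ψ.density y)).map ψ.toFun

end Manifold

end Pestov

end

open Pestov

set_option linter.unusedSectionVars false

noncomputable section

namespace Pestov

open Set Filter Topology

/-! The fields $B_{\mathbf e_i}$, $Y_p = Y_{\omega_p}$ form a global frame of $FM$. Two facts about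
it give the identity: its brackets, and the vanishing of its divergence with respect to the
Liouville measure.

The brackets are $[Y_\xi,Y_\eta]=Y_{[\xi,\eta]}$, $[Y_\xi,B_\theta]=B_{\xi\theta}$ and
$[B_\theta,B_{\theta'}]=-Y_{\Omega(\theta,\theta')}$, with $\Omega$ the curvature two-form read in
the frame. For one $p$ put $b=B_{\omega_p\mathbf e_1}u$, so that $Y_p\mathbf Xu=\mathbf XY_pu+b$.
Then $\|Y_p\mathbf Xu\|^2-\|\mathbf XY_pu\|^2=\langle Y_p\mathbf Xu,b\rangle+\langle b,\mathbf
XY_pu\rangle=-\langle\mathbf Xu,Y_pb\rangle-\langle\mathbf Xb,Y_pu\rangle$ by parts. Commuting once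
more, $Y_pb=B_{\omega_p\mathbf e_1}Y_pu+B_{\omega_p^2\mathbf e_1}u$. Moving $B_{\omega_p\mathbf
e_1}$ back to the other factor leaves $\langle[B_{\omega_p\mathbf e_1},\mathbf
X]u,Y_pu\rangle-\langle\mathbf Xu,B_{\omega_p^2\mathbf e_1}u\rangle$ (`pestov_component`). Summed
over $p$, the second term is $(n-1)\|\mathbf Xu\|^2$ because $\sum_p\omega_p^2\mathbf
e_1=-(n-1)\mathbf e_1$ (`sum_toEnd_omega_toEnd_omega`). The first is the curvature term, by the
bracket of two horizontal fields (`extendScalars_RFM_apply`).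

The brackets are computed in the charts of $\mathrm{Hom}(\mathbb R^n,TM)$, where the fields have
explicit formulas in terms of the Christoffel map $\Gamma$. The formulas agree in all charts by the
transformation law of $\Gamma$; torsion-freeness makes $[B,B]$ vertical, and metric compatibility
makes $B$ tangent to $FM$ and the curvature skew. Frame charts, which are slices of adapted
coordinates (`exists_frameChart`), carry the brackets to $FM$ (`der_comm`).

For the divergence, the Liouville density in a frame chart is the inverse of the absolute value of
the determinant of the frame. By Jacobi's formula its logarithmic derivative along a frame field is
governed by the trace of the structure functions, which is zero (`sum_structCoeff`). Compactness of
$FM$ and cutoffs then globalize $\int Zf\,d\mu=0$ (`integral_der_eq_zero`), which is integration by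
parts. -/

/-- The model vector space `ℝⁿ × End(ℝⁿ)` of `Hom(ℝⁿ, TM)`. -/
abbrev HomModel (n : ℕ) := Eu n × (Eu n →L[ℝ] Eu n)

/-! ### Charts of $\mathrm{Hom}(\mathbb R^n,TM)$ induced by charts of $M$. -/

section Charts

variable {n : ℕ} {M : Type*} [TopologicalSpace M] [ChartedSpace (Eu n) M]
  [IsManifold (𝓡 n) ∞ M]

/-- The differential at `p` of the chart at `x`. -/
def dchart (x p : M) : Eu n →L[ℝ] Eu n :=
  mfderiv (𝓡 n) 𝓘(ℝ, Eu n) (extChartAt (𝓡 n) x) p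

/-- The differential at `y` of the inverse of the chart at `x`. -/
def dchartSymm (x : M) (y : Eu n) : Eu n →L[ℝ] Eu n :=
  mfderiv 𝓘(ℝ, Eu n) (𝓡 n) (extChartAt (𝓡 n) x).symm y

theorem isManifold_one : IsManifold (𝓡 n) 1 M :=
  IsManifold.of_le (n := ∞) (by exact_mod_cast le_top)

theorem dchart_comp_dchartSymm {x : M} {y : Eu n} (hy : y ∈ (extChartAt (𝓡 n) x).target) :
    (dchart x ((extChartAt (𝓡 n) x).symm y)).comp (dchartSymm x y) = .id ℝ _ := by
  have := isManifold_one (n := n) (M := M)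
  have h := mfderiv_extChartAt_comp_mfderivWithin_extChartAt_symm (I := 𝓡 n) hy
  rw [ModelWithCorners.range_eq_univ, mfderivWithin_univ] at h
  exact h

theorem dchartSymm_comp_dchart {x : M} {y : Eu n} (hy : y ∈ (extChartAt (𝓡 n) x).target) :
    (dchartSymm x y).comp (dchart x ((extChartAt (𝓡 n) x).symm y)) = .id ℝ _ := by
  have := isManifold_one (n := n) (M := M)
  have h := mfderivWithin_extChartAt_symm_comp_mfderiv_extChartAt (I := 𝓡 n) hy
  rw [ModelWithCorners.range_eq_univ, mfderivWithin_univ] at h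
  exact h

/-- The tangent space at `x` is identified with `ℝⁿ` through the chart at `x` itself, so in that
chart nothing changes. This allows intrinsic definitions at `x` to be compared with coordinate
formulas. -/
theorem dchart_self (x : M) : dchart x x = .id ℝ (Eu n) := by
  have := isManifold_one (n := n) (M := M)
  have h := mfderiv_chartAt_eq_tangentCoordChange (I := 𝓡 n) (x := x) (y := x)
    (mem_chart_source _ x)
  ext1 v
  have h2 := tangentCoordChange_self (I := 𝓡 n) (x := x) (z := x) (v := v) (mem_extChartAt_source x)
  exact (congrArg (fun L => L v) h).trans h2

/-- The chart of `Hom(ℝⁿ, TM)` induced by the chart of `M` at `x`. -/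
def homChart (x : M) : PartialEquiv (HomBundle n M) (HomModel n) :=
  (trivializationAt (Eu n →L[ℝ] Eu n)
    (fun x : M => Bundle.Trivial M (Eu n) x →L[ℝ] TangentSpace (𝓡 n) x) x).toPartialEquiv ≫
        (extChartAt (𝓡 n) x).prod (PartialEquiv.refl _)

theorem extChartAt_eq_homChart (w : HomBundle n M) :
    extChartAt (IHom n) w = homChart w.proj :=
  FiberBundle.extChartAt w

theorem extChartAt_mk_eq_homChart (x : M) :
    extChartAt (IHom n) (⟨x, 0⟩ : HomBundle n M) = homChart x :=
  FiberBundle.extChartAt _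

theorem homChart_source (x : M) :
    (homChart x).source = {w : HomBundle n M | w.proj ∈ (extChartAt (𝓡 n) x).source} := by
  ext w
  simp only [homChart, PartialEquiv.trans_source, mem_inter_iff, mem_preimage,
    PartialEquiv.prod_source, mem_prod, PartialEquiv.refl_source, mem_univ, and_true, mem_ofPred_eq]
  have h : w ∈ (trivializationAt (Eu n →L[ℝ] Eu n)
      (fun x : M => Bundle.Trivial M (Eu n) x →L[ℝ] TangentSpace (𝓡 n) x) x).source ↔
      w.proj ∈ (extChartAt (𝓡 n) x).source := by
    rw [Bundle.Trivialization.mem_source, hom_trivializationAt_baseSet]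
    simp
  exact ⟨fun hw => h.1 hw.1, fun hw => ⟨h.2 hw, hw⟩⟩

theorem homChart_target (x : M) :
    (homChart x).target = (extChartAt (𝓡 n) x).target ×ˢ (univ : Set (Eu n →L[ℝ] Eu n)) := by
  rw [← extChartAt_mk_eq_homChart, FiberBundle.extChartAt_target]
  congr 1
  ext y
  simp only [hom_trivializationAt_baseSet, mem_inter_iff, mem_preimage, and_iff_left_iff_imp]
  intro hy
  refine ⟨?_, ?_⟩
  · simp
  · simpa using (extChartAt (𝓡 n) x).map_target hy

theorem isOpen_homChart_source (x : M) : IsOpen (homChart (n := n) x).source := by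
  rw [← extChartAt_mk_eq_homChart]; exact isOpen_extChartAt_source _

theorem isOpen_homChart_target (x : M) : IsOpen (homChart (n := n) x).target := by
  rw [← extChartAt_mk_eq_homChart]; exact isOpen_extChartAt_target _

theorem mem_homChart_source (w : HomBundle n M) : w ∈ (homChart w.proj).source := by
  rw [← extChartAt_eq_homChart]; exact mem_extChartAt_source _

theorem homChart_apply {x : M} {w : HomBundle n M} (hw : w ∈ (homChart x).source) :
    homChart x w = (extChartAt (𝓡 n) x w.proj, (dchart x w.proj).comp w.snd) := by
  have := isManifold_one (n := n) (M := M)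
  rw [homChart_source] at hw
  have h := TangentBundle.continuousLinearMapAt_trivializationAt (I := 𝓡 n) (x₀ := x) (x := w.proj)
    (by simpa using hw)
  simp only [homChart, PartialEquiv.coe_trans, Function.comp_apply]
  change ((extChartAt (𝓡 n) x).prod (PartialEquiv.refl (Eu n →L[ℝ] Eu n))) (trivializationAt (Eu n →L[ℝ] Eu n)
    (fun x : M => Bundle.Trivial M (Eu n) x →L[ℝ] TangentSpace (𝓡 n) x) x w) = _
  rw [hom_trivializationAt_apply, ContinuousLinearMap.inCoordinates, h]
  ext1
  · simp
  · ext1 v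
    simp [dchart]
    rfl

theorem homChart_symm_proj {x : M} {z : HomModel n} (hz : z ∈ (homChart x).target) :
    ((homChart x).symm z).proj = (extChartAt (𝓡 n) x).symm z.1 := by
  have h1 := (homChart x).right_inv hz
  have h2 := (homChart x).map_target hz
  rw [homChart_apply h2] at h1
  rw [homChart_source] at h2
  rw [← congrArg Prod.fst h1]
  exact ((extChartAt (𝓡 n) x).left_inv h2).symm

theorem contMDiffOn_homChart (x : M) :
    ContMDiffOn (IHom n) 𝓘(ℝ, HomModel n) ∞ (homChart (n := n) x) (homChart x).source := by
  rw [← extChartAt_mk_eq_homChart, extChartAt_source]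
  exact contMDiffOn_extChartAt

theorem contMDiffOn_homChart_symm (x : M) :
    ContMDiffOn 𝓘(ℝ, HomModel n) (IHom n) ∞ (homChart (n := n) x).symm (homChart x).target := by
  rw [← extChartAt_mk_eq_homChart]
  exact contMDiffOn_extChartAt_symm _

end Charts

/-! ### Coordinate changes and the metric in a chart. -/

section Charts

variable {n : ℕ} {M : Type*} [TopologicalSpace M] [ChartedSpace (Eu n) M]
  [IsManifold (𝓡 n) ∞ M]

/-- The change of coordinates from the chart at `x` to the chart at `x'`. -/
def transition (x x' : M) (y : Eu n) : Eu n :=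
  extChartAt (𝓡 n) x' ((extChartAt (𝓡 n) x).symm y)

/-- The domain of the change of coordinates from the chart at `x` to the chart at `x'`. -/
def overlap (x x' : M) : Set (Eu n) :=
  ((extChartAt (𝓡 n) x).symm ≫ extChartAt (𝓡 n) x').source

theorem mem_overlap {x x' : M} {y : Eu n} : y ∈ overlap x x' ↔
    y ∈ (extChartAt (𝓡 n) x).target ∧
      (extChartAt (𝓡 n) x).symm y ∈ (extChartAt (𝓡 n) x').source := by
  simp [overlap, PartialEquiv.trans_source]

theorem isOpen_overlap (x x' : M) : IsOpen (overlap (n := n) x x') := by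
  have : overlap (n := n) x x' = (extChartAt (𝓡 n) x).target ∩
      (extChartAt (𝓡 n) x).symm ⁻¹' (extChartAt (𝓡 n) x').source := by
    ext y; exact mem_overlap
  rw [this]
  exact (continuousOn_extChartAt_symm x).isOpen_inter_preimage (isOpen_extChartAt_target x)
    (isOpen_extChartAt_source x')

theorem contDiffOn_transition (x x' : M) :
    ContDiffOn ℝ ∞ (transition (n := n) x x') (overlap x x') :=
  contDiffOn_ext_coord_change x' x

theorem transition_mem_target {x x' : M} {y : Eu n} (hy : y ∈ overlap x x') :
    transition x x' y ∈ (extChartAt (𝓡 n) x').target :=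
  (extChartAt (𝓡 n) x').map_source (mem_overlap.1 hy).2

theorem symm_transition {x x' : M} {y : Eu n} (hy : y ∈ overlap x x') :
    (extChartAt (𝓡 n) x').symm (transition x x' y) = (extChartAt (𝓡 n) x).symm y :=
  (extChartAt (𝓡 n) x').left_inv (mem_overlap.1 hy).2

theorem fderiv_transition {x x' : M} {y : Eu n} (hy : y ∈ overlap x x') :
    fderiv ℝ (transition x x') y =
      (dchart x' ((extChartAt (𝓡 n) x).symm y)).comp (dchartSymm x y) := by
  have := isManifold_one (n := n) (M := M)
  obtain ⟨h1, h2⟩ := mem_overlap.1 hy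
  rw [← mfderiv_eq_fderiv]
  refine mfderiv_comp (I' := 𝓡 n) y (g := extChartAt (𝓡 n) x') (f := (extChartAt (𝓡 n) x).symm) ?_ ?_
  · exact mdifferentiableAt_extChartAt (by simpa using h2)
  · exact ((contMDiffOn_extChartAt_symm (n := 1) x).contMDiffAt
      ((isOpen_extChartAt_target x).mem_nhds h1)).mdifferentiableAt one_ne_zero

/-- The metric in the chart at `x`, as a bilinear form on `ℝⁿ` depending on the coordinates. -/
def metricChart (g : RMetric n M) (x : M) (y : Eu n) : Eu n →L[ℝ] Eu n →L[ℝ] ℝ :=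
  ContinuousLinearMap.bilinearComp
    (show Eu n →L[ℝ] Eu n →L[ℝ] ℝ from g.inner ((extChartAt (𝓡 n) x).symm y))
    (dchartSymm x y) (dchartSymm x y)

theorem metricChart_apply (g : RMetric n M) (x : M) (y a b : Eu n) :
    metricChart g x y a b =
      g.inner ((extChartAt (𝓡 n) x).symm y) (dchartSymm x y a) (dchartSymm x y b) := rfl

theorem gram_eq (g : RMetric n M) (x : M) (y : Eu n) (i j : Fin n) :
    gram g x y i j = metricChart g x y (e i) (e j) := rfl

theorem metricChart_symm (g : RMetric n M) (x : M) (y a b : Eu n) :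
    metricChart g x y a b = metricChart g x y b a :=
  g.symm _ _ _

theorem metricChart_pos (g : RMetric n M) {x : M} {y : Eu n}
    (hy : y ∈ (extChartAt (𝓡 n) x).target) {a : Eu n} (ha : a ≠ 0) :
    0 < metricChart g x y a a := by
  refine g.pos _ _ fun h => ha ?_
  have h2 := congrArg (fun L => L a) (dchart_comp_dchartSymm hy)
  simp only [ContinuousLinearMap.comp_apply, ContinuousLinearMap.id_apply] at h2
  rw [← h2]
  exact (congrArg _ h).trans (map_zero (dchart x ((extChartAt (𝓡 n) x).symm y)))

/-- Invariance of the metric under coordinate changes: both sides evaluate `g` at the same point on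
the same tangent vectors, since pushing by the transition and then by the second inverse chart is
pushing by the first. -/
theorem metricChart_transition (g : RMetric n M) {x x' : M} {y : Eu n} (hy : y ∈ overlap x x')
    (a b : Eu n) : metricChart g x y a b = metricChart g x' (transition x x' y)
      (fderiv ℝ (transition x x') y a) (fderiv ℝ (transition x x') y b) := by
  have key : ∀ a, dchartSymm x' (transition x x' y) (fderiv ℝ (transition x x') y a)
      = dchartSymm x y a := fun a => by
    have h := congrArg (fun L => L (dchartSymm x y a))
      (dchartSymm_comp_dchart (transition_mem_target hy))
    rw [symm_transition hy] at h
    rw [fderiv_transition hy]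
    exact h
  rw [metricChart_apply, metricChart_apply, key, key, symm_transition hy]

theorem inner_eq_metricChart (g : RMetric n M) {x : M} {w : HomBundle n M}
    (hw : w ∈ (homChart x).source) (a b : Eu n) :
    g.inner w.proj (ev w a) (ev w b) =
      metricChart g x (homChart x w).1 ((homChart x w).2 a) ((homChart x w).2 b) := by
  have hp : w.proj ∈ (extChartAt (𝓡 n) x).source := by rwa [homChart_source] at hw
  have key : ∀ a, dchartSymm x (homChart x w).1 ((homChart x w).2 a) = w.snd a := fun a => by
    have h := congrArg (fun L => L (w.snd a))
      (dchartSymm_comp_dchart ((extChartAt (𝓡 n) x).map_source hp))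
    rw [(extChartAt (𝓡 n) x).left_inv hp] at h
    rw [homChart_apply hw]
    exact h
  rw [metricChart_apply, key, key]
  have : (extChartAt (𝓡 n) x).symm (homChart x w).1 = w.proj := by
    rw [homChart_apply hw]; exact (extChartAt (𝓡 n) x).left_inv hp
  rw [this]
  rfl

/-- A coordinate field with constant coefficients is the tangent map of the smooth inverse chart
applied to a constant section. It is the test section that extracts the smoothness of the metric
coefficients. -/
theorem contMDiffOn_dchartSymm (x : M) (a : Eu n) :
    ContMDiffOn 𝓘(ℝ, Eu n) ((𝓡 n).prod 𝓘(ℝ, Eu n)) ∞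
      (fun y => (⟨(extChartAt (𝓡 n) x).symm y, dchartSymm x y a⟩ : TangentBundle (𝓡 n) M))
      (extChartAt (𝓡 n) x).target := by
  have h := (contMDiffOn_extChartAt_symm (I := 𝓡 n) (n := ∞) x).contMDiffOn_tangentMapWithin
    (m := ∞) (by simp) (isOpen_extChartAt_target x).uniqueMDiffOn
  have h2 : ContMDiffOn 𝓘(ℝ, Eu n) 𝓘(ℝ, Eu n).tangent ∞
    (fun y => (⟨y, a⟩ : TangentBundle 𝓘(ℝ, Eu n) (Eu n))) (extChartAt (𝓡 n) x).target :=
    (contMDiffOn_vectorSpace_iff_contDiffOn (𝕜 := ℝ) (E := Eu n) (V := fun _ => a)).2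
      contDiffOn_const
  refine (h.comp h2 (fun y hy => hy)).congr fun y hy => ?_
  simp only [Function.comp_apply, tangentMapWithin]
  rw [mfderivWithin_of_isOpen (isOpen_extChartAt_target x) hy]
  rfl

theorem contDiffOn_metricChart (g : RMetric n M) (x : M) :
    ContDiffOn ℝ ∞ (metricChart g x) (extChartAt (𝓡 n) x).target := by
  rw [contDiffOn_clm_apply]
  intro a
  rw [contDiffOn_clm_apply]
  intro b
  have h1 := (g.contMDiff.comp_contMDiffOn (contMDiffOn_extChartAt_symm (I := 𝓡 n) (n := ∞) x))
  have h := ContMDiffOn.clm_bundle_apply₂ (E₁ := fun x : M => TangentSpace (𝓡 n) x)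
    (E₂ := fun x : M => TangentSpace (𝓡 n) x) (E₃ := Bundle.Trivial M ℝ)
    h1 (contMDiffOn_dchartSymm x a) (contMDiffOn_dchartSymm x b)
  intro y hy
  have h2 := (Bundle.contMDiffWithinAt_totalSpace.1 (h y hy)).2
  exact h2.contDiffWithinAt

end Charts

/-! ### Christoffel symbols and the Riemann tensor in a chart. -/

section Charts

variable {n : ℕ} {M : Type*} [TopologicalSpace M] [ChartedSpace (Eu n) M]
  [IsManifold (𝓡 n) ∞ M]

theorem fderiv_bilin_const {E F V : Type*} [NormedAddCommGroup E] [NormedSpace ℝ E]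
    [NormedAddCommGroup F] [NormedSpace ℝ F] [NormedAddCommGroup V] [NormedSpace ℝ V]
    {G : E → F →L[ℝ] F →L[ℝ] V} {y : E} (hG : DifferentiableAt ℝ G y) (b c : F) (v : E) :
    fderiv ℝ (fun z => G z b c) y v = fderiv ℝ G y v b c := by
  have h := (hG.hasFDerivAt.clm_apply (hasFDerivAt_const b y)).clm_apply (hasFDerivAt_const c y)
  rw [h.fderiv]
  simp

instance instNormedAddCommGroupBilin {F V : Type*} [NormedAddCommGroup F] [NormedSpace ℝ F]
    [NormedAddCommGroup V] [NormedSpace ℝ V] : NormedAddCommGroup (F →L[ℝ] F →L[ℝ] V) :=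
  ContinuousLinearMap.toNormedAddCommGroup

instance instNormedSpaceBilin {F V : Type*} [NormedAddCommGroup F] [NormedSpace ℝ F]
    [NormedAddCommGroup V] [NormedSpace ℝ V] : NormedSpace ℝ (F →L[ℝ] F →L[ℝ] V) :=
  ContinuousLinearMap.toNormedSpace

theorem hasFDerivAt_bilin {E E' F V : Type*} [NormedAddCommGroup E] [NormedSpace ℝ E]
    [NormedAddCommGroup E'] [NormedSpace ℝ E']
    [NormedAddCommGroup F] [NormedSpace ℝ F] [NormedAddCommGroup V] [NormedSpace ℝ V]
    {G : E' → F →L[ℝ] F →L[ℝ] V} {φ : E → E'} {b c : E → F} {y : E} {φ' : E →L[ℝ] E'}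
    {b' c' : E →L[ℝ] F}
    (hG : DifferentiableAt ℝ G (φ y)) (hφ : HasFDerivAt φ φ' y)
    (hb : HasFDerivAt b b' y) (hc : HasFDerivAt c c' y) :
    HasFDerivAt (fun z => G (φ z) (b z) (c z))
      ((((fderiv ℝ G (φ y)).comp φ').flip (b y)).flip (c y)
        + ((G (φ y)).flip (c y)).comp b' + (G (φ y) (b y)).comp c') y := by
  have h := ((hG.hasFDerivAt.comp y hφ : HasFDerivAt (fun z => G (φ z))
    ((fderiv ℝ G (φ y)).comp φ') y).clm_apply hb).clm_apply hc
  refine h.congr_fderiv ?_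
  ext v
  simp
  abel

theorem sum_smul_e (a : Eu n) : ∑ i, a i • (e i : Eu n) = a := by
  ext j
  simp [e, Finset.sum_apply, Pi.single_apply]

theorem eq_of_eq_on_basis {V : Type*} [AddCommGroup V] [Module ℝ V] {S T : Eu n → V}
    (hS : IsLinearMap ℝ S) (hT : IsLinearMap ℝ T) (h : ∀ i, S (e i) = T (e i)) (a : Eu n) :
    S a = T a := by
  have key : ∀ {R : Eu n → V}, IsLinearMap ℝ R → R a = ∑ i, a i • R (e i) := fun {R} hR => by
    conv_lhs => rw [← sum_smul_e a]
    change hR.mk' R _ = _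
    simp
  rw [key hS, key hT]
  simp [h]

/-- The bilinear map `Γ(a, b) = ∑ Γᵏᵢⱼ aᵢ bⱼ ∂ₖ` in the chart at `x`, as a function of the
coordinates. -/
def christoffelChart (g : RMetric n M) (x : M) (y : Eu n) : Eu n →L[ℝ] Eu n →L[ℝ] Eu n :=
  ∑ i, ∑ j, ∑ k, (EuclideanSpace.proj i : Eu n →L[ℝ] ℝ).smulRight
    ((EuclideanSpace.proj j : Eu n →L[ℝ] ℝ).smulRight (christoffel g x i j k y • e k))

theorem christoffelChart_basis (g : RMetric n M) (x : M) (y : Eu n) (i j : Fin n) :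
    christoffelChart g x y (e i) (e j) = ∑ k, christoffel g x i j k y • e k := by
  simp only [christoffelChart, sum_apply, ContinuousLinearMap.smulRight_apply,
    EuclideanSpace.coe_proj, e, PiLp.single_apply, smul_apply]
  simp

theorem differentiableAt_metricChart (g : RMetric n M) {x : M} {y : Eu n}
    (hy : y ∈ (extChartAt (𝓡 n) x).target) : DifferentiableAt ℝ (metricChart g x) y :=
  ((contDiffOn_metricChart g x).contDiffAt
    ((isOpen_extChartAt_target x).mem_nhds hy)).differentiableAt (by simp)

theorem partialD_gram (g : RMetric n M) {x : M} {y : Eu n}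
    (hy : y ∈ (extChartAt (𝓡 n) x).target) (i j k : Fin n) :
    partialD i (fun z => gram g x z j k) y = fderiv ℝ (metricChart g x) y (e i) (e j) (e k) := by
  exact fderiv_bilin_const (differentiableAt_metricChart g hy) (e j) (e k) (e i)

theorem fderiv_metricChart_symm (g : RMetric n M) {x : M} {y : Eu n}
    (hy : y ∈ (extChartAt (𝓡 n) x).target) (v a b : Eu n) :
    fderiv ℝ (metricChart g x) y v a b = fderiv ℝ (metricChart g x) y v b a := by
  rw [← fderiv_bilin_const (differentiableAt_metricChart g hy),
    ← fderiv_bilin_const (differentiableAt_metricChart g hy)]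
  simp only [metricChart_symm g x _ a b]

theorem metricChart_sub_left (g : RMetric n M) (x : M) (y a b c : Eu n) :
    metricChart g x y (a - b) c = metricChart g x y a c - metricChart g x y b c := by simp

/-- A kernel vector `v` of the Gram matrix would be orthogonal to the whole basis, hence to itself,
against positivity. -/
theorem isUnit_det_gram (g : RMetric n M) {x : M} {y : Eu n}
    (hy : y ∈ (extChartAt (𝓡 n) x).target) : IsUnit (gram g x y).det := by
  rw [isUnit_iff_ne_zero]
  intro h
  obtain ⟨v, hv, hv2⟩ := Matrix.exists_mulVec_eq_zero_iff.2 h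
  have hv' : (WithLp.toLp 2 v : Eu n) ≠ 0 := fun h0 => hv (by simpa using h0)
  have hpos := metricChart_pos g hy hv'
  have h1 : ∀ a : Eu n, metricChart g x y a (WithLp.toLp 2 v) = 0 := by
    intro a
    refine eq_of_eq_on_basis (S := fun a => metricChart g x y a (WithLp.toLp 2 v)) (T := fun _ => 0)
      ⟨by simp, by simp⟩ ⟨by simp, by simp⟩ (fun i => ?_) a
    have := congrFun hv2 i
    simp only [Matrix.mulVec, dotProduct, gram_eq, Pi.zero_apply] at this
    rw [← this]
    conv_lhs => rw [← sum_smul_e (WithLp.toLp 2 v : Eu n)]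
    simp [mul_comm]
  exact hpos.ne' (h1 _)

/-- The Koszul formula for coordinate fields, whose brackets vanish. Both sides are trilinear, and
on basis vectors the sum against the Gram matrix undoes the inverse Gram matrix in the definition of
the Christoffel symbols. Torsion-freeness, metric compatibility and the transformation law are all
deduced from it. -/
theorem koszul (g : RMetric n M) {x : M} {y : Eu n}
    (hy : y ∈ (extChartAt (𝓡 n) x).target) (a b c : Eu n) :
    2 * metricChart g x y (christoffelChart g x y a b) c =
      fderiv ℝ (metricChart g x) y a b c + fderiv ℝ (metricChart g x) y b a c
        - fderiv ℝ (metricChart g x) y c a b := by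
  refine eq_of_eq_on_basis (S := fun a => 2 * metricChart g x y (christoffelChart g x y a b) c)
    (T := fun a => fderiv ℝ (metricChart g x) y a b c + fderiv ℝ (metricChart g x) y b a c
        - fderiv ℝ (metricChart g x) y c a b)
    ⟨by simp [mul_add], by intros; simp; ring⟩
    ⟨by intros; simp; ring, by intros; simp; ring⟩ (fun i => ?_) a
  refine eq_of_eq_on_basis
    (S := fun b => 2 * metricChart g x y (christoffelChart g x y (e i) b) c)
    (T := fun b => fderiv ℝ (metricChart g x) y (e i) b c + fderiv ℝ (metricChart g x) y b (e i) c
        - fderiv ℝ (metricChart g x) y c (e i) b)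
    ⟨by simp [mul_add], by intros; simp; ring⟩
    ⟨by intros; simp; ring, by intros; simp; ring⟩ (fun j => ?_) b
  refine eq_of_eq_on_basis
    (S := fun c => 2 * metricChart g x y (christoffelChart g x y (e i) (e j)) c)
    (T := fun c => fderiv ℝ (metricChart g x) y (e i) (e j) c
      + fderiv ℝ (metricChart g x) y (e j) (e i) c
        - fderiv ℝ (metricChart g x) y c (e i) (e j))
    ⟨by simp [mul_add], by intros; simp; ring⟩
    ⟨by intros; simp; ring, by intros; simp; ring⟩ (fun l => ?_) c
  simp only [christoffelChart_basis, ← partialD_gram g hy]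
  have hinv := Matrix.mul_nonsing_inv _ (isUnit_det_gram g hy)
  have hs : ∀ k, metricChart g x y (e k) (e l) = gram g x y l k := fun k => by
    rw [metricChart_symm, gram_eq]
  simp only [map_sum, map_smul, sum_apply, smul_apply,
    smul_eq_mul, hs, christoffel]
  set S : Fin n → ℝ := fun m => partialD i (fun z => gram g x z j m) y +
    partialD j (fun z => gram g x z i m) y - partialD m (fun z => gram g x z i j) y with hS
  have h1 : ∀ k, 1 / 2 * ∑ m, (gram g x y)⁻¹ k m * S m * 1 = 1/2 * ((gram g x y)⁻¹.mulVec S) k :=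
    fun k => by simp [Matrix.mulVec, dotProduct]
  have h2 : (gram g x y).mulVec ((gram g x y)⁻¹.mulVec S) l = S l := by
    rw [Matrix.mulVec_mulVec, hinv, Matrix.one_mulVec]
  change 2 * ∑ k, 1 / 2 * (∑ m, (gram g x y)⁻¹ k m * S m) * gram g x y l k = S l
  rw [← h2, Finset.mul_sum]
  simp only [Matrix.mulVec, dotProduct]
  refine Finset.sum_congr rfl fun k _ => ?_
  ring

/-- The right side of `koszul` is symmetric in `a` and `b`; hence the difference of the two sides
here is orthogonal to itself. -/
theorem christoffelChart_symm (g : RMetric n M) {x : M} {y : Eu n}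
    (hy : y ∈ (extChartAt (𝓡 n) x).target) (a b : Eu n) :
    christoffelChart g x y a b = christoffelChart g x y b a := by
  by_contra h
  have hpos := metricChart_pos g hy (sub_ne_zero.2 h)
  have h1 := koszul g hy a b (christoffelChart g x y a b - christoffelChart g x y b a)
  have h2 := koszul g hy b a (christoffelChart g x y a b - christoffelChart g x y b a)
  have hs := fderiv_metricChart_symm g hy
  have h3 := hs (christoffelChart g x y a b - christoffelChart g x y b a) a b
  rw [metricChart_sub_left] at hpos
  linarith

/-- Compatibility of the Levi-Civita connection with the metric. -/
theorem metric_compatible (g : RMetric n M) {x : M} {y : Eu n}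
    (hy : y ∈ (extChartAt (𝓡 n) x).target) (a b c : Eu n) :
    fderiv ℝ (metricChart g x) y a b c = metricChart g x y (christoffelChart g x y a b) c
      + metricChart g x y b (christoffelChart g x y a c) := by
  have hs := fderiv_metricChart_symm g hy
  have h1 := koszul g hy a b c
  have h2 := koszul g hy a c b
  rw [metricChart_symm g x y b]
  have h3 := hs a b c
  have h4 := hs b a c
  have h5 := hs c a b
  linarith

theorem eq_of_metricChart_eq (g : RMetric n M) {x : M} {y : Eu n}
    (hy : y ∈ (extChartAt (𝓡 n) x).target) {a b : Eu n}
    (h : ∀ c, metricChart g x y a c = metricChart g x y b c) : a = b := by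
  by_contra hab
  refine (metricChart_pos g hy (sub_ne_zero.2 hab)).ne' ?_
  rw [metricChart_sub_left, h (a - b), sub_self]

theorem fderiv_transition_surjective {x x' : M} {y : Eu n} (hy : y ∈ overlap x x') :
    Function.Surjective (fderiv ℝ (transition x x') y) := by
  intro v
  refine ⟨dchart x ((extChartAt (𝓡 n) x).symm y) (dchartSymm x' (transition x x' y) v), ?_⟩
  have h1 := congrArg (fun L => L (dchartSymm x' (transition x x' y) v))
    (dchartSymm_comp_dchart (mem_overlap.1 hy).1)
  have h2 := congrArg (fun L => L v) (dchart_comp_dchartSymm (transition_mem_target hy))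
  rw [symm_transition hy] at h2
  rw [fderiv_transition hy]
  simp only [ContinuousLinearMap.comp_apply, ContinuousLinearMap.id_apply] at h1 h2 ⊢
  rw [h1, h2]

/-- The transformation law of the Christoffel symbols. -/
theorem christoffelChart_transition (g : RMetric n M) {x x' : M} {y : Eu n}
    (hy : y ∈ overlap x x') (a b : Eu n) :
    fderiv ℝ (transition x x') y (christoffelChart g x y a b) =
      christoffelChart g x' (transition x x' y) (fderiv ℝ (transition x x') y a)
        (fderiv ℝ (transition x x') y b)
      + fderiv ℝ (fderiv ℝ (transition x x')) y a b := by
  have hy1 := (mem_overlap.1 hy).1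
  have hy2 := transition_mem_target hy
  have hτ : ContDiffAt ℝ ∞ (transition (n := n) x x') y :=
    (contDiffOn_transition x x').contDiffAt ((isOpen_overlap x x').mem_nhds hy)
  have hτ1 : DifferentiableAt ℝ (transition (n := n) x x') y := hτ.differentiableAt (by simp)
  have hτ2 : DifferentiableAt ℝ (fderiv ℝ (transition (n := n) x x')) y :=
    (hτ.fderiv_right (m := ∞) (by simp)).differentiableAt (by simp)
  have hsymm : ∀ a b, fderiv ℝ (fderiv ℝ (transition x x')) y a b =
      fderiv ℝ (fderiv ℝ (transition x x')) y b a :=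
    hτ.isSymmSndFDerivAt (by simp; exact WithTop.coe_le_coe.2 le_top)
  set τ' := fderiv ℝ (transition x x') y with hτ'
  set τ'' := fderiv ℝ (fderiv ℝ (transition x x')) y with hτ''
  set G' := metricChart g x' (transition x x' y) with hG'
  have hD : ∀ a b c, fderiv ℝ (metricChart g x) y a b c =
      fderiv ℝ (metricChart g x') (transition x x' y) (τ' a) (τ' b) (τ' c)
        + G' (τ'' a b) (τ' c) + G' (τ' b) (τ'' a c) := by
    intro a b c
    have hb : ∀ b, HasFDerivAt (fun z => fderiv ℝ (transition x x') z b) (τ''.flip b) y :=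
      fun b => (hτ2.hasFDerivAt.clm_apply (hasFDerivAt_const b y)).congr_fderiv (by ext; simp [hτ''])
    have h2 := hasFDerivAt_bilin (differentiableAt_metricChart g hy2) hτ1.hasFDerivAt (hb b) (hb c)
    rw [← fderiv_bilin_const (differentiableAt_metricChart g hy1)]
    rw [(h2.congr_of_eventuallyEq (f₁ := fun z => metricChart g x z b c) ?_).fderiv]
    · simp [hτ', hG']
    · filter_upwards [(isOpen_overlap x x').mem_nhds hy] with z hz
      exact metricChart_transition g hz b c
  -- Insert the derivative `hD` of the transformed metric into the Koszul formula of the first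
  -- chart. By symmetry of `τ''` and of the metric, the six second-derivative terms reduce to twice
  -- `G' (τ'' a b) (τ' c)`; the rest is the Koszul formula of the second chart. Testing on vectors
  -- `τ' c` suffices because `τ'` is onto.
  refine eq_of_metricChart_eq g hy2 fun c' => ?_
  obtain ⟨c, rfl⟩ := fderiv_transition_surjective hy c'
  have k1 := koszul g hy1 a b c
  rw [metricChart_transition g hy] at k1
  have k2 := koszul g hy2 (τ' a) (τ' b) (τ' c)
  rw [hD, hD, hD, hsymm c a, hsymm c b, hsymm b a, metricChart_symm g x' _ (τ' b),
    metricChart_symm g x' _ (τ' a)] at k1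
  rw [map_add, add_apply]
  linarith

theorem contDiffOn_gram (g : RMetric n M) (x : M) (i j : Fin n) :
    ContDiffOn ℝ ∞ (fun y => gram g x y i j) (extChartAt (𝓡 n) x).target := by
  simp only [gram_eq]
  exact ((contDiffOn_metricChart g x).clm_apply contDiffOn_const).clm_apply contDiffOn_const

theorem contDiffOn_det {ι E : Type*} [Fintype ι] [DecidableEq ι] [NormedAddCommGroup E]
    [NormedSpace ℝ E] {s : Set E} {A : E → Matrix ι ι ℝ} {m : ℕ∞ω}
    (h : ∀ i j, ContDiffOn ℝ m (fun y => A y i j) s) : ContDiffOn ℝ m (fun y => (A y).det) s := by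
  simp only [Matrix.det_apply]
  exact ContDiffOn.sum fun σ _ => (contDiffOn_prod fun i _ => h _ _).const_smul _

/-- Cramer's rule: the entries of the inverse are cofactors divided by the determinant, hence as
smooth as the matrix. -/
theorem contDiffOn_matrix_inv {ι E : Type*} [Fintype ι] [DecidableEq ι] [NormedAddCommGroup E]
    [NormedSpace ℝ E] {s : Set E} {A : E → Matrix ι ι ℝ} {m : ℕ∞ω}
    (h : ∀ i j, ContDiffOn ℝ m (fun y => A y i j) s) (hA : ∀ y ∈ s, IsUnit (A y).det) (i j : ι) :
    ContDiffOn ℝ m (fun y => (A y)⁻¹ i j) s := by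
  simp only [Matrix.inv_def, Ring.inverse_eq_inv', Matrix.smul_apply, smul_eq_mul,
    Matrix.adjugate_apply]
  refine ContDiffOn.mul ((contDiffOn_det h).inv fun y hy => (hA y hy).ne_zero)
    (contDiffOn_det fun k l => ?_)
  simp only [Matrix.updateRow_apply]
  split_ifs
  · exact contDiffOn_const
  · exact h k l

theorem contDiffOn_partialD {s : Set (Eu n)} (hs : IsOpen s) {f : Eu n → ℝ}
    (hf : ContDiffOn ℝ ∞ f s) (i : Fin n) : ContDiffOn ℝ ∞ (partialD i f) s :=
  (hf.fderiv_of_isOpen hs (m := ∞) (by simp)).clm_apply contDiffOn_const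

theorem contDiffOn_christoffel (g : RMetric n M) (x : M) (i j k : Fin n) :
    ContDiffOn ℝ ∞ (christoffel g x i j k) (extChartAt (𝓡 n) x).target := by
  have ho := isOpen_extChartAt_target (I := 𝓡 n) x
  refine contDiffOn_const.mul (ContDiffOn.sum fun l _ => ?_)
  exact (contDiffOn_matrix_inv (contDiffOn_gram g x) (fun y hy => isUnit_det_gram g hy) k l).mul
    (((contDiffOn_partialD ho (contDiffOn_gram g x j l) i).add
      (contDiffOn_partialD ho (contDiffOn_gram g x i l) j)).sub
      (contDiffOn_partialD ho (contDiffOn_gram g x i j) l))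

theorem christoffelChart_apply (g : RMetric n M) (x : M) (y a b : Eu n) :
    christoffelChart g x y a b = ∑ i, ∑ j, ∑ k, (christoffel g x i j k y * a i * b j) • e k := by
  simp only [christoffelChart, sum_apply, ContinuousLinearMap.smulRight_apply,
    smul_apply, EuclideanSpace.coe_proj, smul_smul]
  refine Finset.sum_congr rfl fun i _ => Finset.sum_congr rfl fun j _ =>
    Finset.sum_congr rfl fun k _ => ?_
  congr 1
  ring

theorem contDiffOn_christoffelChart (g : RMetric n M) (x : M) :
    ContDiffOn ℝ ∞ (christoffelChart g x) (extChartAt (𝓡 n) x).target := by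
  rw [contDiffOn_clm_apply]
  intro a
  rw [contDiffOn_clm_apply]
  intro b
  simp only [christoffelChart_apply]
  exact ContDiffOn.sum fun i _ => ContDiffOn.sum fun j _ => ContDiffOn.sum fun k _ =>
    ContDiffOn.smul (((contDiffOn_christoffel g x i j k).mul contDiffOn_const).mul
      contDiffOn_const) contDiffOn_const

theorem fderiv_christoffelChart_basis (g : RMetric n M) {x : M} {y : Eu n}
    (hy : y ∈ (extChartAt (𝓡 n) x).target) (i j k : Fin n) :
    fderiv ℝ (christoffelChart g x) y (e i) (e j) (e k) =
      ∑ l, partialD i (christoffel g x j k l) y • e l := by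
  have ho := (isOpen_extChartAt_target (I := 𝓡 n) x).mem_nhds hy
  rw [← fderiv_bilin_const (((contDiffOn_christoffelChart g x).contDiffAt ho).differentiableAt
    (by simp))]
  simp only [christoffelChart_basis]
  have h := HasFDerivAt.fun_sum (u := Finset.univ) fun (l : Fin n) _ =>
    ((((contDiffOn_christoffel g x j k l).contDiffAt ho).differentiableAt
    (by simp)).hasFDerivAt.smul_const (e l : Eu n))
  rw [h.fderiv]
  simp [partialD]

/-- The Riemann tensor at `x`, in terms of the bilinear map `Γ`. -/
theorem riemann_eq (g : RMetric n M) (x : M) (a b c : Eu n) :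
    (riemann g x a b c : Eu n) =
      fderiv ℝ (christoffelChart g x) (extChartAt (𝓡 n) x x) a b c
        - fderiv ℝ (christoffelChart g x) (extChartAt (𝓡 n) x x) b a c
        + christoffelChart g x (extChartAt (𝓡 n) x x) a
            (christoffelChart g x (extChartAt (𝓡 n) x x) b c)
        - christoffelChart g x (extChartAt (𝓡 n) x x) b
            (christoffelChart g x (extChartAt (𝓡 n) x x) a c) := by
  have hy : extChartAt (𝓡 n) x x ∈ (extChartAt (𝓡 n) x).target := mem_extChartAt_target x
  set y := extChartAt (𝓡 n) x x with hyd
  let r (a b c : Eu n) : Eu n := ∑ i, ∑ j, ∑ k, ∑ l,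
    (riemannCoeff g x i j k l y * a i * b j * c k) • e l
  let R (a b c : Eu n) : Eu n := fderiv ℝ (christoffelChart g x) y a b c
        - fderiv ℝ (christoffelChart g x) y b a c
        + christoffelChart g x y a (christoffelChart g x y b c)
        - christoffelChart g x y b (christoffelChart g x y a c)
  change r a b c = R a b c
  refine eq_of_eq_on_basis (S := fun a => r a b c) (T := fun a => R a b c) ⟨?_, ?_⟩ ⟨?_, ?_⟩
    (fun i => ?_) a
  · intro a a'
    simp only [r, PiLp.add_apply, mul_add, add_mul, add_smul, Finset.sum_add_distrib]
  · intro t a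
    simp only [r, PiLp.smul_apply, smul_eq_mul, Finset.smul_sum, smul_smul]
    simp only [mul_assoc, mul_left_comm]
  · intro a a'
    simp only [R, map_add, add_apply]
    abel
  · intro t a
    simp only [R, map_smul, smul_apply, smul_sub, smul_add]
  refine eq_of_eq_on_basis (S := fun b => r (e i) b c) (T := fun b => R (e i) b c)
    ⟨?_, ?_⟩ ⟨?_, ?_⟩ (fun j => ?_) b
  · intro a a'
    simp only [r, PiLp.add_apply, mul_add, add_mul, add_smul, Finset.sum_add_distrib]
  · intro t a
    simp only [r, PiLp.smul_apply, smul_eq_mul, Finset.smul_sum, smul_smul]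
    simp only [mul_assoc, mul_left_comm]
  · intro a a'
    simp only [R, map_add, add_apply]
    abel
  · intro t a
    simp only [R, map_smul, smul_apply, smul_sub, smul_add]
  refine eq_of_eq_on_basis (S := fun c => r (e i) (e j) c) (T := fun c => R (e i) (e j) c)
    ⟨?_, ?_⟩ ⟨?_, ?_⟩ (fun k => ?_) c
  · intro a a'
    simp only [r, PiLp.add_apply, mul_add, add_smul, Finset.sum_add_distrib]
  · intro t a
    simp only [r, PiLp.smul_apply, smul_eq_mul, Finset.smul_sum, smul_smul]
    simp only [mul_assoc, mul_left_comm]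
  · intro a a'
    simp only [R, map_add]
    abel
  · intro t a
    simp only [R, map_smul, smul_sub, smul_add]
  have h1 : r (e i) (e j) (e k) = ∑ l, riemannCoeff g x i j k l y • e l := by
    simp [r, e]
  have h2 : ∀ i j k, christoffelChart g x y (e i) (christoffelChart g x y (e j) (e k)) =
      ∑ l, (∑ m, christoffel g x i m l y * christoffel g x j k m y) • e l := by
    intro i j k
    simp only [christoffelChart_basis, map_sum, map_smul, Finset.smul_sum, smul_smul,
      Finset.sum_smul]
    rw [Finset.sum_comm]
    simp only [mul_comm]
  change r (e i) (e j) (e k) = R (e i) (e j) (e k)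
  rw [h1]
  simp only [R, h2, fderiv_christoffelChart_basis g hy, riemannCoeff, add_smul, sub_smul,
    Finset.sum_add_distrib, Finset.sum_sub_distrib]
  abel

end Charts

/-! ### The vertical and horizontal fields in charts of $\mathrm{Hom}(\mathbb R^n,TM)$. -/

section Charts

variable {n : ℕ} {M : Type*} [TopologicalSpace M] [ChartedSpace (Eu n) M]
  [IsManifold (𝓡 n) ∞ M]

/-- The vertical field `ξ^𝕍` in a chart of `Hom(ℝⁿ, TM)`. -/
def YModel (ξ : Lam2 ℝ n) (z : HomModel n) : HomModel n := (0, z.2.comp (toEnd ξ))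

/-- The standard horizontal field `B_θ` in the chart of `Hom(ℝⁿ, TM)` at `x`. -/
def BModel (g : RMetric n M) (x : M) (θ : Eu n) (z : HomModel n) : HomModel n :=
  (z.2 θ, -(christoffelChart g x z.1 (z.2 θ)).comp z.2)

theorem homChart_symm_of_mem_overlap {x x' : M} {z : HomModel n} (hz : z.1 ∈ overlap x x') :
    (homChart x).symm z ∈ (homChart (n := n) x').source ∧
    homChart x' ((homChart x).symm z) =
      (transition x x' z.1, (fderiv ℝ (transition x x') z.1).comp z.2) := by
  obtain ⟨h1, h2⟩ := mem_overlap.1 hz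
  have hzt : z ∈ (homChart x).target := by rw [homChart_target]; exact ⟨h1, mem_univ _⟩
  have hp := homChart_symm_proj hzt
  have hs : (homChart x).symm z ∈ (homChart (n := n) x').source := by
    rw [homChart_source, mem_ofPred_eq, hp]; exact h2
  refine ⟨hs, ?_⟩
  have hr := (homChart x).right_inv hzt
  rw [homChart_apply ((homChart x).map_target hzt)] at hr
  have hr2 := congrArg Prod.snd hr
  rw [homChart_apply hs]
  ext1
  · simp only [hp]; rfl
  · simp only at hr2 ⊢
    rw [← hr2, fderiv_transition hz, hp]
    have h3 := dchartSymm_comp_dchart h1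
    ext1 v
    have h4 := congrArg (fun L => L (((homChart x).symm z).snd v)) h3
    simp only [ContinuousLinearMap.comp_apply] at h4 ⊢
    exact congrArg _ h4.symm

theorem homChart_self (w : HomBundle n M) :
    homChart w.proj w = (extChartAt (𝓡 n) w.proj w.proj, w.snd) := by
  rw [homChart_apply (mem_homChart_source w), dchart_self]
  rfl

theorem center_mem_overlap {x : M} {w : HomBundle n M} (hw : w ∈ (homChart x).source) :
    extChartAt (𝓡 n) w.proj w.proj ∈ overlap w.proj x := by
  rw [homChart_source, mem_ofPred_eq] at hw
  exact mem_overlap.2 ⟨mem_extChartAt_target _, by rwa [extChartAt_to_inv]⟩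

/-- The preferred chart at `w` is `homChart w.proj`, so the manifold derivative of another chart is
the ordinary derivative of the coordinate change `(y, A) ↦ (τ y, Dτ(y) ∘ A)`. -/
theorem hasMFDerivAt_homChart {x : M} {w : HomBundle n M} (hw : w ∈ (homChart x).source)
    {L : HomModel n →L[ℝ] HomModel n}
    (hL : HasFDerivAt (fun z : HomModel n => (transition w.proj x z.1,
      (fderiv ℝ (transition w.proj x) z.1).comp z.2)) L (homChart w.proj w)) :
    HasMFDerivAt (IHom n) 𝓘(ℝ, HomModel n) (homChart (n := n) x) w L := by
  refine ⟨(contMDiffOn_homChart x).continuousOn.continuousAt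
    ((isOpen_homChart_source x).mem_nhds hw), ?_⟩
  have ho : {z : HomModel n | z.1 ∈ overlap w.proj x} ∈ 𝓝 (homChart w.proj w) := by
    refine ((isOpen_overlap w.proj x).preimage continuous_fst).mem_nhds ?_
    rw [homChart_self]
    exact center_mem_overlap hw
  have h := hL.congr_of_eventuallyEq (f₁ := homChart x ∘ (homChart w.proj).symm) (by
    filter_upwards [ho] with z hz
    exact (homChart_symm_of_mem_overlap hz).2)
  have h2 := h.hasFDerivWithinAt (s := range (IHom n))
  rw [← extChartAt_eq_homChart] at h2
  exact h2

theorem contDiffAt_transition {x x' : M} {y : Eu n} (hy : y ∈ overlap x x') :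
    ContDiffAt ℝ ∞ (transition (n := n) x x') y :=
  (contDiffOn_transition x x').contDiffAt ((isOpen_overlap x x').mem_nhds hy)

theorem mfderiv_homChart {x : M} {w : HomBundle n M} (hw : w ∈ (homChart x).source)
    (a : Eu n) (A : Eu n →L[ℝ] Eu n) :
    mfderiv (IHom n) 𝓘(ℝ, HomModel n) (homChart (n := n) x) w (mkTangent w a A) =
      ((fderiv ℝ (transition w.proj x) (extChartAt (𝓡 n) w.proj w.proj) a,
        (fderiv ℝ (fderiv ℝ (transition w.proj x)) (extChartAt (𝓡 n) w.proj w.proj) a).comp w.snd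
        + (fderiv ℝ (transition w.proj x) (extChartAt (𝓡 n) w.proj w.proj)).comp A) :
          HomModel n) := by
  have hy : extChartAt (𝓡 n) w.proj w.proj ∈ overlap w.proj x := center_mem_overlap hw
  have hτ := contDiffAt_transition hy
  have hτ1 := (hτ.differentiableAt (by simp)).hasFDerivAt
  have hτ2 := ((hτ.fderiv_right (m := ∞) (by simp)).differentiableAt (by simp)).hasFDerivAt
  have h1 : (homChart w.proj w).1 = extChartAt (𝓡 n) w.proj w.proj := by rw [homChart_self]
  have h2 : (homChart w.proj w).2 = w.snd := by rw [homChart_self]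
  rw [← h1] at hτ1 hτ2
  have hf := hasFDerivAt_fst (𝕜 := ℝ) (p := homChart w.proj w)
  have hs := hasFDerivAt_snd (𝕜 := ℝ) (p := homChart w.proj w)
  have key := (hτ1.comp _ hf).prodMk ((hτ2.comp _ hf).clm_comp hs)
  rw [(hasMFDerivAt_homChart hw key).mfderiv]
  refine Prod.ext ?_ (ContinuousLinearMap.ext fun v => ?_)
  · change fderiv ℝ (transition w.proj x) (homChart w.proj w).1 a = _
    rw [h1]
  · change fderiv ℝ (transition w.proj x) (homChart w.proj w).1 (A v)
      + fderiv ℝ (fderiv ℝ (transition w.proj x)) (homChart w.proj w).1 a ((homChart w.proj w).2 v)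
        = _
    rw [h1, h2, add_comm]
    rfl

theorem homChart_eq {x : M} {w : HomBundle n M} (hw : w ∈ (homChart x).source) :
    homChart x w = (transition w.proj x (extChartAt (𝓡 n) w.proj w.proj),
      (fderiv ℝ (transition w.proj x) (extChartAt (𝓡 n) w.proj w.proj)).comp w.snd) := by
  have hx := (homChart_symm_of_mem_overlap (x := w.proj) (x' := x) (z := homChart w.proj w)
    (by rw [homChart_self]; exact center_mem_overlap hw)).2
  rw [(homChart w.proj).left_inv (mem_homChart_source w), homChart_self] at hx
  exact hx

theorem mfderiv_homChart_Y {x : M} {w : HomBundle n M} (hw : w ∈ (homChart x).source)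
    (ξ : Lam2 ℝ n) :
    mfderiv (IHom n) 𝓘(ℝ, HomModel n) (homChart (n := n) x) w (Y ξ w) =
      YModel ξ (homChart x w) := by
  refine (mfderiv_homChart hw 0 _).trans ?_
  rw [homChart_eq hw, YModel]
  refine Prod.ext (map_zero _) (ContinuousLinearMap.ext fun v => ?_)
  change fderiv ℝ (fderiv ℝ (transition w.proj x)) (extChartAt (𝓡 n) w.proj w.proj) 0 (w.snd v)
    + _ = _
  rw [map_zero]
  exact zero_add (fderiv ℝ (transition w.proj x) (extChartAt (𝓡 n) w.proj w.proj)
    (w.snd (toEnd ξ v)))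

/-- The field defined pointwise, each time in the chart at the foot point, has the same formula in
every chart. The coordinate change of `Hom(ℝⁿ, TM)` produces a term with the second derivative of
`τ`, and the inhomogeneous term in the transformation law of `Γ` cancels it. -/
theorem mfderiv_homChart_B (g : RMetric n M) {x : M} {w : HomBundle n M}
    (hw : w ∈ (homChart x).source) (θ : Eu n) :
    mfderiv (IHom n) 𝓘(ℝ, HomModel n) (homChart (n := n) x) w (B g θ w) =
      BModel g x θ (homChart x w) := by
  refine (mfderiv_homChart hw (ev w θ) (-(christoffelMap g w.proj (ev w θ)).comp w.snd)).trans ?_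
  rw [homChart_eq hw, BModel]
  refine Prod.ext rfl (ContinuousLinearMap.ext fun v => ?_)
  have h := christoffelChart_transition g (center_mem_overlap hw) (w.snd θ) (w.snd v)
  change fderiv ℝ (fderiv ℝ (transition w.proj x)) (extChartAt (𝓡 n) w.proj w.proj) (w.snd θ)
      (w.snd v) + fderiv ℝ (transition w.proj x) (extChartAt (𝓡 n) w.proj w.proj)
        (-(christoffelChart g w.proj (extChartAt (𝓡 n) w.proj w.proj) (w.snd θ) (w.snd v)))
    = -(christoffelChart g x (transition w.proj x (extChartAt (𝓡 n) w.proj w.proj))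
      (fderiv ℝ (transition w.proj x) (extChartAt (𝓡 n) w.proj w.proj) (w.snd θ))
      (fderiv ℝ (transition w.proj x) (extChartAt (𝓡 n) w.proj w.proj) (w.snd v)))
  rw [map_neg]
  refine add_neg_eq_iff_eq_add.2 ?_
  refine eq_neg_add_iff_add_eq.2 ?_
  exact h.symm

end Charts

/-! ### The Lie algebra $\Lambda^2\mathbb R^n\cong\mathfrak{so}(n)$. -/

section SkewEndomorphisms

variable {n : ℕ}

theorem e_apply (i j : Fin n) : (e i : Eu n) j = if j = i then 1 else 0 := by
  simp [e]

theorem omega_apply (p q : Pairs n) : (omega p : Lam2 ℝ n) q = if q = p then 1 else 0 := by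
  simp [omega]

theorem inner_e (a : Eu n) (i : Fin n) : inner ℝ a (e i) = a i := by
  simp [e, EuclideanSpace.inner_single_right]

theorem toEnd_apply (ξ : Lam2 ℝ n) (a : Eu n) :
    toEnd ξ a = ∑ p : Pairs n, ξ p • (a p.1.1 • (e p.1.2 : Eu n) - a p.1.2 • e p.1.1) := by
  simp [toEnd]

/-- The identification of `Λ²ℝⁿ` with the skew-symmetric endomorphisms, as a linear map. -/
def toEndL : Lam2 ℝ n →L[ℝ] (Eu n →L[ℝ] Eu n) :=
  LinearMap.toContinuousLinearMap
    { toFun := toEnd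
      map_add' := fun ξ η => by ext1 a; simp [toEnd_apply, add_smul, Finset.sum_add_distrib]
      map_smul' := fun t ξ => by ext1 a; simp [toEnd_apply, Finset.smul_sum, smul_smul] }

theorem toEndL_apply (ξ : Lam2 ℝ n) : toEndL ξ = toEnd ξ := rfl

/-- The coordinates of the skew-symmetric part of an endomorphism. -/
def skewCoords : (Eu n →L[ℝ] Eu n) →L[ℝ] Lam2 ℝ n :=
  LinearMap.toContinuousLinearMap
    { toFun := fun S => WithLp.toLp 2 fun p => S (e p.1.1) p.1.2
      map_add' := fun S T => by ext p; simp
      map_smul' := fun t S => by ext p; simp }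

theorem skewCoords_apply (S : Eu n →L[ℝ] Eu n) (p : Pairs n) :
    skewCoords S p = S (e p.1.1) p.1.2 := rfl

theorem toEnd_basis_of_lt (ξ : Lam2 ℝ n) {k l : Fin n} (h : k < l) :
    toEnd ξ (e k) l = ξ ⟨(k, l), h⟩ := by
  rw [toEnd_apply]
  simp only [WithLp.ofLp_sum, Finset.sum_apply, PiLp.smul_apply, PiLp.sub_apply, e_apply,
    smul_eq_mul]
  rw [Finset.sum_eq_single ⟨(k, l), h⟩]
  · simp [h.ne']
  · rintro ⟨⟨i, j⟩, hij⟩ _ hp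
    simp only [ne_eq, Subtype.mk.injEq, Prod.mk.injEq, not_and] at hp hij ⊢
    split_ifs with h1 h2 h3 h4 <;> simp_all
    omega
  · simp

theorem toEnd_basis_self (ξ : Lam2 ℝ n) (k : Fin n) : toEnd ξ (e k) k = 0 := by
  rw [toEnd_apply]
  simp only [WithLp.ofLp_sum, Finset.sum_apply, PiLp.smul_apply, PiLp.sub_apply, e_apply,
    smul_eq_mul]
  refine Finset.sum_eq_zero fun p _ => ?_
  simp only [@eq_comm _ k]
  ring

theorem inner_toEnd (ξ : Lam2 ℝ n) (a b : Eu n) :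
    inner ℝ (toEnd ξ a) b = -inner ℝ a (toEnd ξ b) := by
  have h : ∀ i, inner ℝ (e i) b = b i := fun i => by rw [real_inner_comm, inner_e]
  rw [toEnd_apply, toEnd_apply, sum_inner, inner_sum, ← Finset.sum_neg_distrib]
  refine Finset.sum_congr rfl fun p _ => ?_
  simp [inner_smul_left, inner_smul_right, inner_sub_left, inner_sub_right, inner_e, h]
  ring

theorem skewCoords_toEnd (ξ : Lam2 ℝ n) : skewCoords (toEnd ξ) = ξ := by
  ext p
  exact toEnd_basis_of_lt ξ p.2

theorem ext_inner_basis {S T : Eu n →L[ℝ] Eu n} (h : ∀ k l, S (e k) l = T (e k) l) : S = T := by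
  ext1 a
  refine eq_of_eq_on_basis ⟨map_add S, map_smul S⟩ ⟨map_add T, map_smul T⟩ (fun k => ?_) a
  ext l
  exact h k l

/-- A skew matrix is determined by its entries above the diagonal, which are exactly the coordinates
stored by `skewCoords`. -/
theorem toEnd_skewCoords {S : Eu n →L[ℝ] Eu n}
    (hS : ∀ a b, inner ℝ (S a) b = -inner ℝ a (S b)) : toEnd (skewCoords S) = S := by
  have h1 : ∀ k l, S (e k) l = -S (e l) k := fun k l => by
    rw [← inner_e, ← inner_e, hS, real_inner_comm]
  have h2 : ∀ k l, toEnd (skewCoords S) (e k) l = -toEnd (skewCoords S) (e l) k := fun k l => by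
    rw [← inner_e, ← inner_e, inner_toEnd, real_inner_comm]
  refine ext_inner_basis fun k l => ?_
  rcases lt_trichotomy k l with h | rfl | h
  · exact toEnd_basis_of_lt _ h
  · rw [toEnd_basis_self]
    linarith [h1 k k]
  · rw [h2, h1, toEnd_basis_of_lt _ h]
    rfl

theorem inner_toEnd_self (ξ : Lam2 ℝ n) (a : Eu n) : inner ℝ (toEnd ξ a) a = 0 := by
  have h := inner_toEnd ξ a a
  rw [real_inner_comm a] at h
  linarith [real_inner_comm a (toEnd ξ a)]

theorem toEnd_omega (p : Pairs n) (a : Eu n) :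
    toEnd (omega p) a = a p.1.1 • (e p.1.2 : Eu n) - a p.1.2 • e p.1.1 := by
  rw [toEnd_apply, Finset.sum_eq_single p]
  · simp [omega_apply]
  · intro q _ hq
    simp [omega_apply, hq]
  · simp

/-- The bracket of `Λ²ℝⁿ ≅ 𝔰𝔬(n)`. -/
def bracketLam2 (ξ η : Lam2 ℝ n) : Lam2 ℝ n :=
  skewCoords ((toEnd ξ).comp (toEnd η) - (toEnd η).comp (toEnd ξ))

theorem toEnd_bracketLam2 (ξ η : Lam2 ℝ n) :
    toEnd (bracketLam2 ξ η) = (toEnd ξ).comp (toEnd η) - (toEnd η).comp (toEnd ξ) := by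
  refine toEnd_skewCoords fun a b => ?_
  simp only [sub_apply, ContinuousLinearMap.comp_apply, inner_sub_left,
    inner_sub_right, inner_toEnd, neg_neg]
  ring

/-- For `p = (i, j)`, `ω_p` sends `e i` to `e j` and `e j` to `-e i`. The coefficient is therefore
`⟨ξ e j, e j⟩ - ⟨ξ e i, e i⟩`, and both terms vanish as `ξ` is skew. It is the vertical part of the
unimodularity in `sum_structCoeff`. -/
theorem bracketLam2_omega_apply_self (ξ : Lam2 ℝ n) (p : Pairs n) :
    bracketLam2 ξ (omega p) p = 0 := by
  have hne : p.1.1 ≠ p.1.2 := p.2.ne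
  rw [bracketLam2, skewCoords_apply, ← inner_e]
  simp only [sub_apply, ContinuousLinearMap.comp_apply, inner_sub_left]
  rw [inner_toEnd (omega p) _ (e p.1.2)]
  simp only [toEnd_omega, e_apply, hne, hne.symm, if_true, if_false]
  simp [inner_toEnd_self, inner_neg_right]

theorem bracketLam2_swap (ξ η : Lam2 ℝ n) : bracketLam2 ξ η = -bracketLam2 η ξ := by
  rw [bracketLam2, bracketLam2, ← map_neg, neg_sub]

end SkewEndomorphisms

/-! ### Brackets of the fields in charts, and the structure functions of the frame. -/

section ModelFields

variable {n : ℕ} {M : Type*} [TopologicalSpace M] [ChartedSpace (Eu n) M]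
  [IsManifold (𝓡 n) ∞ M]

theorem hasFDerivAt_YModel (ξ : Lam2 ℝ n) (z ζ : HomModel n) :
    DifferentiableAt ℝ (YModel ξ) z ∧ fderiv ℝ (YModel ξ) z ζ = (0, ζ.2.comp (toEnd ξ)) := by
  have h : HasFDerivAt (YModel ξ) _ z := (hasFDerivAt_const (0 : Eu n) z).prodMk
    ((hasFDerivAt_snd (𝕜 := ℝ) (p := z)).clm_comp (hasFDerivAt_const (toEnd ξ) z))
  refine ⟨h.differentiableAt, ?_⟩
  rw [h.fderiv]
  refine Prod.ext rfl (ContinuousLinearMap.ext fun v => ?_)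
  simp

theorem mem_homChart_target {x : M} {z : HomModel n} (hz : z ∈ (homChart x).target) :
    z.1 ∈ (extChartAt (𝓡 n) x).target := by
  rw [homChart_target] at hz; exact hz.1

theorem hasFDerivAt_BModel (g : RMetric n M) {x : M} (θ : Eu n) {z : HomModel n}
    (hz : z ∈ (homChart x).target) (ζ : HomModel n) :
    DifferentiableAt ℝ (BModel g x θ) z ∧ fderiv ℝ (BModel g x θ) z ζ =
      (ζ.2 θ, -((fderiv ℝ (christoffelChart g x) z.1 ζ.1 (z.2 θ)).comp z.2
        + (christoffelChart g x z.1 (ζ.2 θ)).comp z.2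
        + (christoffelChart g x z.1 (z.2 θ)).comp ζ.2)) := by
  have hΓ := (((contDiffOn_christoffelChart g x).contDiffAt
    ((isOpen_extChartAt_target x).mem_nhds (mem_homChart_target hz))).differentiableAt
    (by simp)).hasFDerivAt
  have hs := hasFDerivAt_snd (𝕜 := ℝ) (p := z)
  have h1 := hs.clm_apply (hasFDerivAt_const θ z)
  have h2 := hΓ.comp z (hasFDerivAt_fst (𝕜 := ℝ) (p := z))
  have h : HasFDerivAt (BModel g x θ) _ z := h1.prodMk ((h2.clm_apply h1).clm_comp hs).neg
  refine ⟨h.differentiableAt, ?_⟩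
  rw [h.fderiv]
  refine Prod.ext ?_ (ContinuousLinearMap.ext fun v => ?_)
  · simp
  · simp
    abel

theorem lieBracket_YModel_YModel (ξ η : Lam2 ℝ n) (z : HomModel n) :
    VectorField.lieBracket ℝ (YModel ξ) (YModel η) z = YModel (bracketLam2 ξ η) z := by
  rw [VectorField.lieBracket, (hasFDerivAt_YModel η z _).2, (hasFDerivAt_YModel ξ z _).2]
  refine Prod.ext (sub_zero _) (ContinuousLinearMap.ext fun v => ?_)
  simp [YModel, toEnd_bracketLam2]

/-- Differentiating `Γ(Aθ) ∘ A` in the direction `A ∘ ξ` gives `Γ(Aξθ) ∘ A + Γ(Aθ) ∘ A ∘ ξ`. The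
last term cancels with the derivative of the vertical field, and what remains is the horizontal
field of `ξθ`. -/
theorem lieBracket_YModel_BModel (g : RMetric n M) {x : M} (ξ : Lam2 ℝ n) (θ : Eu n)
    {z : HomModel n} (hz : z ∈ (homChart x).target) :
    VectorField.lieBracket ℝ (YModel ξ) (BModel g x θ) z = BModel g x (toEnd ξ θ) z := by
  rw [VectorField.lieBracket, (hasFDerivAt_YModel ξ z _).2, (hasFDerivAt_BModel g θ hz _).2]
  refine Prod.ext ?_ (ContinuousLinearMap.ext fun v => ?_)
  · simp [YModel, BModel]
  · simp [YModel, BModel]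

/-- The base component is `Γ(Aθ', Aθ) - Γ(Aθ, Aθ')`, zero by torsion-freeness. In the fibre
component the terms differentiating the inner `Γ`-argument cancel for the same reason, and minus the
curvature endomorphism composed with the frame is left. -/
theorem lieBracket_BModel_BModel (g : RMetric n M) {x : M} (θ θ' : Eu n)
    {z : HomModel n} (hz : z ∈ (homChart x).target) :
    VectorField.lieBracket ℝ (BModel g x θ) (BModel g x θ') z =
      (0, -(fderiv ℝ (christoffelChart g x) z.1 (z.2 θ) (z.2 θ')
        - fderiv ℝ (christoffelChart g x) z.1 (z.2 θ') (z.2 θ)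
        + (christoffelChart g x z.1 (z.2 θ)).comp (christoffelChart g x z.1 (z.2 θ'))
        - (christoffelChart g x z.1 (z.2 θ')).comp (christoffelChart g x z.1 (z.2 θ))).comp
          z.2) := by
  have hs := christoffelChart_symm g (mem_homChart_target hz) (z.2 θ) (z.2 θ')
  rw [VectorField.lieBracket, (hasFDerivAt_BModel g θ hz _).2, (hasFDerivAt_BModel g θ' hz _).2]
  refine Prod.ext ?_ (ContinuousLinearMap.ext fun v => ?_)
  · simp [BModel, hs]
  · simp [BModel, hs]
    abel

/-- The index set of the frame `(B_{𝐞ᵢ}, Y_{𝐞ᵢ ∧ 𝐞ⱼ})` of the tangent bundle of `FM`. -/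
abbrev FrameIdx (n : ℕ) := Fin n ⊕ Pairs n

/-- The frame `(B_{𝐞ᵢ}, Y_{𝐞ᵢ ∧ 𝐞ⱼ})` of the tangent bundle of `FM`. -/
def frameField (g : RMetric n M) (c : FrameIdx n) (w : HomBundle n M) :
    TangentSpace (IHom n) w :=
  Sum.elim (fun i => B g (e i) w) (fun p => Y (omega p) w) c

/-- The frame `(B_{𝐞ᵢ}, Y_{𝐞ᵢ ∧ 𝐞ⱼ})` in a chart of `Hom(ℝⁿ, TM)`. -/
def frameModel (g : RMetric n M) (x : M) (c : FrameIdx n) (z : HomModel n) : HomModel n :=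
  Sum.elim (fun i => BModel g x (e i) z) (fun p => YModel (omega p) z) c

/-- The structure functions of the frame `(B_{𝐞ᵢ}, Y_{𝐞ᵢ ∧ 𝐞ⱼ})`. -/
def structCoeff (g : RMetric n M) (w : HomBundle n M) : FrameIdx n → FrameIdx n → FrameIdx n → ℝ
  | .inl i, .inl j => Sum.elim (fun _ => 0) (fun p => -curvTwoForm g w (e i) (e j) p)
  | .inr p, .inl i => Sum.elim (fun k => toEnd (omega p) (e i) k) (fun _ => 0)
  | .inl i, .inr p => Sum.elim (fun k => -toEnd (omega p) (e i) k) (fun _ => 0)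
  | .inr p, .inr q => Sum.elim (fun _ => 0) (fun r => bracketLam2 (omega p) (omega q) r)

/-- Unimodularity of the frame, the algebraic source of its vanishing divergence. Every summand is
zero: `[B, B]` is vertical, `[Y, B]` is horizontal, a skew endomorphism has zero diagonal, and
`[ω_q, ω_p]` has no `ω_q` component. -/
theorem sum_structCoeff (g : RMetric n M) (w : HomBundle n M) (a : FrameIdx n) :
    ∑ b, structCoeff g w b a b = 0 := by
  rcases a with i | p
  · simp [structCoeff, Fintype.sum_sum_type]
  · simp [structCoeff, Fintype.sum_sum_type, toEnd_basis_self, bracketLam2_swap _ (omega p),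
      bracketLam2_omega_apply_self]

theorem mfderiv_homChart_frameField (g : RMetric n M) {x : M} {w : HomBundle n M}
    (hw : w ∈ (homChart x).source) (c : FrameIdx n) :
    mfderiv (IHom n) 𝓘(ℝ, HomModel n) (homChart (n := n) x) w (frameField g c w) =
      frameModel g x c (homChart x w) := by
  rcases c with i | p
  · exact mfderiv_homChart_B g hw _
  · exact mfderiv_homChart_Y hw _

theorem sum_smul_YModel (c : Pairs n → ℝ) (z : HomModel n) :
    ∑ p, c p • YModel (omega p) z = YModel (WithLp.toLp 2 c) z := by
  have h : (WithLp.toLp 2 c : Lam2 ℝ n) = ∑ p, c p • omega p := by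
    ext q
    simp [Finset.sum_apply, omega_apply]
  refine Prod.ext (by simp [YModel, Prod.fst_sum]) ?_
  simp only [YModel, Prod.snd_sum, Prod.smul_snd]
  rw [h, ← toEndL_apply, map_sum]
  ext1 v
  simp [toEndL_apply]

theorem sum_smul_BModel (g : RMetric n M) (x : M) (θ : Eu n) (z : HomModel n) :
    ∑ i, θ i • BModel g x (e i) z = BModel g x θ z := by
  refine Prod.ext ?_ (ContinuousLinearMap.ext fun v => ?_)
  · conv_rhs => rw [← sum_smul_e θ]
    simp [BModel, Prod.fst_sum]
  · conv_rhs => rw [← sum_smul_e θ]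
    simp [BModel, Prod.snd_sum]

theorem contDiff_YModel (ξ : Lam2 ℝ n) : ContDiff ℝ ∞ (YModel ξ) :=
  contDiff_const.prodMk (contDiff_snd.clm_comp contDiff_const)

theorem contDiffOn_BModel (g : RMetric n M) (x : M) (θ : Eu n) :
    ContDiffOn ℝ ∞ (BModel g x θ) (homChart x).target := by
  have h1 : ContDiff ℝ ∞ fun z : HomModel n => z.2 θ := contDiff_snd.clm_apply contDiff_const
  refine h1.contDiffOn.prodMk (ContDiffOn.neg (ContDiffOn.clm_comp (ContDiffOn.clm_apply ?_
    h1.contDiffOn) contDiff_snd.contDiffOn))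
  exact (contDiffOn_christoffelChart g x).comp contDiff_fst.contDiffOn
    fun z hz => mem_homChart_target hz

theorem contDiffOn_frameModel (g : RMetric n M) (x : M) (c : FrameIdx n) :
    ContDiffOn ℝ ∞ (frameModel g x c) (homChart x).target := by
  rcases c with i | p
  · exact contDiffOn_BModel g x _
  · exact (contDiff_YModel _).contDiffOn

/-- The pullback of the metric by frames, in a chart. -/
def pullMetric (g : RMetric n M) (x : M) (z : HomModel n) (a b : Eu n) : ℝ :=
  metricChart g x z.1 (z.2 a) (z.2 b)

theorem fderiv_pullMetric (g : RMetric n M) {x : M} {z : HomModel n}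
    (hz : z ∈ (homChart x).target) (a b : Eu n) (ζ : HomModel n) :
    fderiv ℝ (fun z => pullMetric g x z a b) z ζ =
      fderiv ℝ (metricChart g x) z.1 ζ.1 (z.2 a) (z.2 b) + metricChart g x z.1 (ζ.2 a) (z.2 b)
        + metricChart g x z.1 (z.2 a) (ζ.2 b) := by
  have hs := hasFDerivAt_snd (𝕜 := ℝ) (p := z)
  have h := hasFDerivAt_bilin (differentiableAt_metricChart g (mem_homChart_target hz))
    (hasFDerivAt_fst (𝕜 := ℝ) (p := z)) (hs.clm_apply (hasFDerivAt_const a z))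
    (hs.clm_apply (hasFDerivAt_const b z))
  change fderiv ℝ (fun z : HomModel n => metricChart g x z.1 (z.2 a) (z.2 b)) z ζ = _
  rw [h.fderiv]
  simp

theorem contDiffOn_pullMetric (g : RMetric n M) (x : M) (a b : Eu n) :
    ContDiffOn ℝ ∞ (fun z => pullMetric g x z a b) (homChart x).target := by
  refine ContDiffOn.clm_apply (ContDiffOn.clm_apply ?_ ?_) ?_
  · exact (contDiffOn_metricChart g x).comp contDiff_fst.contDiffOn
      fun z hz => mem_homChart_target hz
  · exact (contDiff_snd.clm_apply contDiff_const).contDiffOn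
  · exact (contDiff_snd.clm_apply contDiff_const).contDiffOn

/-- Moving horizontally transports the frame parallelly, so by metric compatibility its inner
products stay constant. This holds at every linear map, not only at isometries; hence it may be
differentiated again along horizontal fields. -/
theorem fderiv_pullMetric_BModel (g : RMetric n M) {x : M} {z : HomModel n}
    (hz : z ∈ (homChart x).target) (a b θ : Eu n) :
    fderiv ℝ (fun z => pullMetric g x z a b) z (BModel g x θ z) = 0 := by
  rw [fderiv_pullMetric g hz, metric_compatible g (mem_homChart_target hz)]
  simp [BModel]

/-- The isometries in a chart of `Hom(ℝⁿ, TM)`. -/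
def isomModel (g : RMetric n M) (x : M) : Set (HomModel n) :=
  {z | ∀ a b, pullMetric g x z a b = inner ℝ a b}

/-- The frame is tangent to the set of isometries. For vertical fields the derivative is `⟨ξa, b⟩ +
⟨a, ξb⟩` once the frame is an isometry, which is zero because `ξ` is skew. -/
theorem fderiv_pullMetric_frameModel (g : RMetric n M) {x : M} {z : HomModel n}
    (hz : z ∈ (homChart x).target) (hz2 : z ∈ isomModel g x) (a b : Eu n) (c : FrameIdx n) :
    fderiv ℝ (fun z => pullMetric g x z a b) z (frameModel g x c z) = 0 := by
  rcases c with i | p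
  · exact fderiv_pullMetric_BModel g hz a b _
  · rw [fderiv_pullMetric g hz]
    have h1 := hz2 (toEnd (omega p) a) b
    have h2 := hz2 a (toEnd (omega p) b)
    rw [pullMetric] at h1 h2
    simp [frameModel, YModel, h1, h2, inner_toEnd]

theorem isomModel_injective {g : RMetric n M} {x : M} {z : HomModel n}
    (hz : z ∈ isomModel g x) : Function.Injective z.2 := by
  refine (injective_iff_map_eq_zero z.2).2 fun a ha => ?_
  have h := hz a a
  rw [pullMetric, ha] at h
  simpa using h.symm

/-- The curvature endomorphism is skew-symmetric. -/
theorem metricChart_curvature_skew (g : RMetric n M) {x : M} {z : HomModel n}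
    (hz : z ∈ (homChart x).target) (θ θ' a b : Eu n) :
    metricChart g x z.1
        ((VectorField.lieBracket ℝ (BModel g x θ) (BModel g x θ') z).2 a) (z.2 b)
      + metricChart g x z.1 (z.2 a)
        ((VectorField.lieBracket ℝ (BModel g x θ) (BModel g x θ') z).2 b) = 0 := by
  have ho := (isOpen_homChart_target (n := n) x).mem_nhds hz
  -- Both horizontal fields annihilate `g(Aa, Ab)` on an open set, so their bracket annihilates it
  -- too. The bracket has no base component, so this derivative is exactly the symmetrized
  -- curvature.
  have h := VectorField.fderiv_apply_lieBracket (𝕜 := ℝ) (x := z) (n := ∞)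
    ((contDiffOn_pullMetric g x a b).contDiffAt ho)
    (by simp; exact WithTop.coe_le_coe.2 le_top)
    (((contDiffOn_BModel g x θ').contDiffAt ho).differentiableAt (by simp))
    (((contDiffOn_BModel g x θ).contDiffAt ho).differentiableAt (by simp))
  have h0 : ∀ θ, fderiv ℝ (fun z => fderiv ℝ (fun z => pullMetric g x z a b) z (BModel g x θ z)) z
      = 0 := fun θ => by
    have : (fun z => fderiv ℝ (fun z => pullMetric g x z a b) z (BModel g x θ z)) =ᶠ[𝓝 z]
        fun _ => (0 : ℝ) := by
      filter_upwards [ho] with z hz using fderiv_pullMetric_BModel g hz a b θ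
    rw [this.fderiv_eq]
    simp
  rw [h0, h0, fderiv_pullMetric g hz] at h
  have h1 : (VectorField.lieBracket ℝ (BModel g x θ) (BModel g x θ') z).1 = 0 := by
    rw [lieBracket_BModel_BModel g θ θ' hz]
  rw [h1] at h
  simpa using h

end ModelFields

/-- Brackets of `f`-related fields are `f`-related: differentiate the two relations; the second
derivative of `f` is symmetric and drops out. -/
theorem lieBracket_of_related {E F : Type*} [NormedAddCommGroup E] [NormedSpace ℝ E]
    [NormedAddCommGroup F] [NormedSpace ℝ F] {f : E → F} {v v' : E → E} {V V' : F → F} {y : E}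
    (hf : ContDiffAt ℝ ∞ f y) (hv : DifferentiableAt ℝ v y) (hv' : DifferentiableAt ℝ v' y)
    (hV : DifferentiableAt ℝ V (f y)) (hV' : DifferentiableAt ℝ V' (f y))
    (h : ∀ᶠ z in 𝓝 y, fderiv ℝ f z (v z) = V (f z))
    (h' : ∀ᶠ z in 𝓝 y, fderiv ℝ f z (v' z) = V' (f z)) :
    fderiv ℝ f y (VectorField.lieBracket ℝ v v' y) = VectorField.lieBracket ℝ V V' (f y) := by
  have hf1 : DifferentiableAt ℝ f y := hf.differentiableAt (by simp)
  rw [VectorField.fderiv_apply_lieBracket hf (by simp; exact WithTop.coe_le_coe.2 le_top) hv' hv,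
    EventuallyEq.fderiv_eq (f := fun z => V' (f z)) h',
    EventuallyEq.fderiv_eq (f := fun z => V (f z)) h, VectorField.lieBracket]
  have h1 := (hV'.hasFDerivAt.comp y hf1.hasFDerivAt).fderiv
  have h2 := (hV.hasFDerivAt.comp y hf1.hasFDerivAt).fderiv
  simp only [Function.comp_def] at h1 h2
  rw [h1, h2]
  simp [h.self_of_nhds, h'.self_of_nhds]

/-! ### Brackets of the frame on $FM$ and in frame charts. -/

section Frames

variable {n : ℕ} {M : Type*} [TopologicalSpace M] [ChartedSpace (Eu n) M]
  [IsManifold (𝓡 n) ∞ M]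

theorem inner_eq_metricChart_center (g : RMetric n M) (x : M) (a b : Eu n) :
    g.inner x (show TangentSpace (𝓡 n) x from a) (show TangentSpace (𝓡 n) x from b) =
      metricChart g x (extChartAt (𝓡 n) x x) a b := by
  have h := inner_eq_metricChart g
    (mem_homChart_source (⟨x, .id ℝ (Eu n)⟩ : HomBundle n M)) a b
  rw [homChart_self] at h
  exact h

theorem homChart_mem_target {x : M} {w : HomBundle n M} (hw : w ∈ (homChart x).source) :
    homChart x w ∈ (homChart (n := n) x).target := (homChart x).map_source hw

theorem homChart_mem_isomModel {g : RMetric n M} {o : OrientationForm n M} {x : M}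
    {w : HomBundle n M} (hw : w ∈ (homChart x).source) (hF : w ∈ FM g o) :
    homChart x w ∈ isomModel g x := fun a b => by
  rw [pullMetric, ← inner_eq_metricChart g hw, hF.1]

/-- An injective endomorphism of a finite-dimensional space is an equivalence. -/
theorem exists_equiv_of_injective {E : Type*} [NormedAddCommGroup E] [NormedSpace ℝ E]
    [FiniteDimensional ℝ E] {A : E →L[ℝ] E}
    (hA : Function.Injective A) : ∃ L : E ≃L[ℝ] E, (L : E →L[ℝ] E) = A :=
  ⟨(LinearEquiv.ofInjectiveEndo (A : E →ₗ[ℝ] E) hA).toContinuousLinearEquiv, by ext; rfl⟩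

theorem sum_frameModel_inl (g : RMetric n M) (x : M) (z : HomModel n) {s : FrameIdx n → ℝ}
    {θ : Eu n} (hl : ∀ i, s (Sum.inl i) = θ i) (hr : ∀ p, s (Sum.inr p) = 0) :
    ∑ k, s k • frameModel g x k z = BModel g x θ z := by
  rw [Fintype.sum_sum_type, ← sum_smul_BModel g x θ z,
    Finset.sum_eq_zero (s := Finset.univ) (f := fun p => s (Sum.inr p) • frameModel g x (Sum.inr p) z)
      (fun p _ => by rw [hr p]; exact zero_smul ℝ (frameModel g x (Sum.inr p) z))]
  refine (add_zero _).trans (Finset.sum_congr rfl fun i _ => ?_)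
  rw [hl]; rfl

theorem sum_frameModel_inr (g : RMetric n M) (x : M) (z : HomModel n) {s : FrameIdx n → ℝ}
    {ξ : Lam2 ℝ n} (hl : ∀ i, s (Sum.inl i) = 0) (hr : ∀ p, s (Sum.inr p) = ξ p) :
    ∑ k, s k • frameModel g x k z = YModel ξ z := by
  rw [Fintype.sum_sum_type,
    Finset.sum_eq_zero (s := Finset.univ) (f := fun p => s (Sum.inl p) • frameModel g x (Sum.inl p) z)
      (fun p _ => by rw [hl p]; exact zero_smul ℝ (frameModel g x (Sum.inl p) z))]
  refine (zero_add _).trans (Eq.trans ?_ (sum_smul_YModel ξ z))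
  exact Finset.sum_congr rfl fun p _ => by rw [hr]; rfl

theorem metricChart_neg_left (g : RMetric n M) (x : M) (y a b : Eu n) :
    metricChart g x y (-a) b = -metricChart g x y a b := by
  simp

/-- The brackets of the frame of `FM`. -/
theorem lieBracket_frameModel {g : RMetric n M} {o : OrientationForm n M} {w : HomBundle n M}
    (hF : w ∈ FM g o) (c d : FrameIdx n) :
    VectorField.lieBracket ℝ (frameModel g w.proj c) (frameModel g w.proj d) (homChart w.proj w) =
      ∑ k, structCoeff g w c d k • frameModel g w.proj k (homChart w.proj w) := by
  have hs := mem_homChart_source w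
  have hz := homChart_mem_target hs
  have hi := homChart_mem_isomModel hs hF
  set z := homChart w.proj w with hzdef
  rcases c with i | p <;> rcases d with j | q
  · change VectorField.lieBracket ℝ (BModel g w.proj (e i)) (BModel g w.proj (e j)) z = _
    rw [sum_frameModel_inr g w.proj z (ξ := WithLp.toLp 2 fun p => -curvTwoForm g w (e i) (e j) p)
      (fun _ => rfl) (fun _ => rfl)]
    obtain ⟨L, hL⟩ := exists_equiv_of_injective (isomModel_injective hi)
    have hskew := metricChart_curvature_skew g hz (e i) (e j)
    have hb := lieBracket_BModel_BModel g (e i) (e j) hz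
    set C := VectorField.lieBracket ℝ (BModel g w.proj (e i)) (BModel g w.proj (e j)) z
    have hLa : ∀ a, z.2 (L.symm a) = a := fun a => by
      rw [← hL]; exact L.apply_symm_apply a
    -- `S` is the vertical part of the bracket read in the frame. Skewness of the curvature makes it
    -- skew, so it is `toEnd` of its coordinates, and these are the components of minus the
    -- curvature two-form.
    set S : Eu n →L[ℝ] Eu n := (L.symm : Eu n →L[ℝ] Eu n).comp C.2 with hS
    have hSC : ∀ a, z.2 (S a) = C.2 a := fun a => hLa _
    have hin : ∀ a b, inner ℝ (S a) b = metricChart g w.proj z.1 (C.2 a) (z.2 b) := fun a b => by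
      rw [← hi (S a) b, pullMetric, hSC]
    have hSs : ∀ a b, inner ℝ (S a) b = -inner ℝ a (S b) := fun a b => by
      rw [hin, real_inner_comm, hin, metricChart_symm g w.proj z.1 (C.2 b)]
      linarith [hskew a b]
    have hcoord : skewCoords S = WithLp.toLp 2 fun p => -curvTwoForm g w (e i) (e j) p := by
      ext p
      rw [skewCoords_apply, ← inner_e, hin, hb]
      have h2 : z.2 = w.snd := by rw [hzdef, homChart_self]
      have h1 : z.1 = extChartAt (𝓡 n) w.proj w.proj := by rw [hzdef, homChart_self]
      rw [h1, h2]
      change _ = -g.inner w.proj (riemann g w.proj (w.snd (e i)) (w.snd (e j)) (w.snd (e p.1.1)))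
        (w.snd (e p.1.2))
      have hr := riemann_eq g w.proj (w.snd (e i)) (w.snd (e j)) (w.snd (e p.1.1))
      have := inner_eq_metricChart_center g w.proj
        (riemann g w.proj (w.snd (e i)) (w.snd (e j)) (w.snd (e p.1.1))) (w.snd (e p.1.2))
      refine Eq.trans ?_ (congrArg Neg.neg this.symm)
      rw [hr]
      exact metricChart_neg_left g _ _ _ _
    rw [← hcoord, YModel, toEnd_skewCoords hSs]
    refine Prod.ext ?_ (ContinuousLinearMap.ext fun v => (hSC v).symm)
    rw [hb]
  · change VectorField.lieBracket ℝ (BModel g w.proj (e i)) (YModel (omega q)) z = _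
    rw [sum_frameModel_inl g w.proj z (θ := -toEnd (omega q) (e i)) (fun _ => rfl) (fun _ => rfl),
      VectorField.lieBracket_swap, lieBracket_YModel_BModel g _ _ hz]
    simp [BModel]
  · change VectorField.lieBracket ℝ (YModel (omega p)) (BModel g w.proj (e j)) z = _
    rw [sum_frameModel_inl g w.proj z (θ := toEnd (omega p) (e j)) (fun _ => rfl) (fun _ => rfl),
      lieBracket_YModel_BModel g _ _ hz]
  · change VectorField.lieBracket ℝ (YModel (omega p)) (YModel (omega q)) z = _
    rw [sum_frameModel_inr g w.proj z (ξ := bracketLam2 (omega p) (omega q)) (fun _ => rfl)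
      (fun _ => rfl), lieBracket_YModel_YModel]

/-- A local parametrization of `FM` with a smooth local inverse, and the frame of `FM` in this
parametrization. -/
structure FrameChart (g : RMetric n M) (o : OrientationForm n M) where
  param : LocalParam g o
  nhd : Set (HomBundle n M)
  isOpen_nhd : IsOpen nhd
  inv : HomBundle n M → ParamSpace n
  contMDiffOn_inv : ContMDiffOn (IHom n) 𝓘(ℝ, ParamSpace n) ∞ inv nhd
  image_eq : param.toFun '' param.domain = FM g o ∩ nhd
  inv_param : ∀ y ∈ param.domain, inv (param.toFun y) = y
  field : FrameIdx n → ParamSpace n → ParamSpace n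
  contDiffOn_field : ∀ c, ContDiffOn ℝ ∞ (field c) param.domain
  mfderiv_field : ∀ c, ∀ y ∈ param.domain,
    mfderiv 𝓘(ℝ, ParamSpace n) (IHom n) param.toFun y (field c y) =
      frameField g c (param.toFun y)

namespace FrameChart

variable {g : RMetric n M} {o : OrientationForm n M} (C : FrameChart g o)

theorem param_mem {y : ParamSpace n} (hy : y ∈ C.param.domain) :
    C.param.toFun y ∈ FM g o ∩ C.nhd := C.image_eq ▸ mem_image_of_mem _ hy

theorem inv_mem {w : HomBundle n M} (hw : w ∈ FM g o ∩ C.nhd) : C.inv w ∈ C.param.domain := by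
  rw [← C.image_eq] at hw
  obtain ⟨y, hy, rfl⟩ := hw
  rwa [C.inv_param y hy]

theorem param_inv {w : HomBundle n M} (hw : w ∈ FM g o ∩ C.nhd) :
    C.param.toFun (C.inv w) = w := by
  rw [← C.image_eq] at hw
  obtain ⟨y, hy, rfl⟩ := hw
  rw [C.inv_param y hy]

theorem mdifferentiableAt_param {y : ParamSpace n} (hy : y ∈ C.param.domain) :
    MDifferentiableAt 𝓘(ℝ, ParamSpace n) (IHom n) C.param.toFun y :=
  (C.param.contMDiffOn.contMDiffAt (C.param.isOpen_domain.mem_nhds hy)).mdifferentiableAt (by simp)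

theorem contDiffAt_homChart_param {x : M} {y : ParamSpace n} (hy : y ∈ C.param.domain)
    (hx : C.param.toFun y ∈ (homChart x).source) :
    ContDiffAt ℝ ∞ (homChart x ∘ C.param.toFun) y :=
  (((contMDiffOn_homChart x).contMDiffAt ((isOpen_homChart_source x).mem_nhds hx)).comp y
    (C.param.contMDiffOn.contMDiffAt (C.param.isOpen_domain.mem_nhds hy))).contDiffAt

theorem fderiv_homChart_param {x : M} {y : ParamSpace n} (hy : y ∈ C.param.domain)
    (hx : C.param.toFun y ∈ (homChart x).source) (c : FrameIdx n) :
    fderiv ℝ (homChart x ∘ C.param.toFun) y (C.field c y) =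
      frameModel g x c (homChart x (C.param.toFun y)) := by
  have h := mfderiv_comp (I' := IHom n) y
    (((contMDiffOn_homChart x).contMDiffAt
      ((isOpen_homChart_source x).mem_nhds hx)).mdifferentiableAt (by simp))
    (C.mdifferentiableAt_param hy)
  have h2 := congrArg (fun L => L (C.field c y)) h
  have h3 := mfderiv_homChart_frameField g hx c
  rw [← C.mfderiv_field c y hy] at h3
  rw [← mfderiv_eq_fderiv]
  exact h2.trans h3

/-- The differential of a local parametrization is injective in any chart. -/
theorem fderiv_homChart_param_injective {x : M} {y : ParamSpace n} (hy : y ∈ C.param.domain)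
    (hx : C.param.toFun y ∈ (homChart x).source) :
    Function.Injective (fderiv ℝ (homChart x ∘ C.param.toFun) y) := by
  have hinv := isInvertible_mfderiv_extChartAt (I := IHom n) (x := (⟨x, 0⟩ : HomBundle n M))
    (y := C.param.toFun y) (by rw [extChartAt_mk_eq_homChart]; exact hx)
  rw [extChartAt_mk_eq_homChart] at hinv
  have h := mfderiv_comp (I' := IHom n) y
    (((contMDiffOn_homChart x).contMDiffAt
      ((isOpen_homChart_source x).mem_nhds hx)).mdifferentiableAt (by simp))
    (C.mdifferentiableAt_param hy)
  rw [← mfderiv_eq_fderiv]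
  obtain ⟨L, hL⟩ := hinv
  intro v v' hvv
  have h2 : ∀ v, mfderiv 𝓘(ℝ, ParamSpace n) 𝓘(ℝ, HomModel n) (homChart x ∘ C.param.toFun) y v =
      L (mfderiv 𝓘(ℝ, ParamSpace n) (IHom n) C.param.toFun y v) := fun v => by
    have := congrArg (fun L => L v) h
    rw [← hL] at this
    exact this
  refine C.param.immersion y hy (L.injective ?_)
  exact (h2 v).symm.trans (hvv.trans (h2 v'))

/-- The differential of the parametrization relates `field` to `frameModel`, hence also their
brackets, and it is injective, so the bracket formula in the chart at `w` pulls back. -/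
theorem lieBracket_field {y : ParamSpace n} (hy : y ∈ C.param.domain) (c d : FrameIdx n) :
    VectorField.lieBracket ℝ (C.field c) (C.field d) y =
      ∑ k, structCoeff g (C.param.toFun y) c d k • C.field k y := by
  set w := C.param.toFun y with hw
  have hs := mem_homChart_source w
  have ho := C.param.isOpen_domain.mem_nhds hy
  have hev : ∀ᶠ y' in 𝓝 y, y' ∈ C.param.domain ∧ C.param.toFun y' ∈ (homChart w.proj).source := by
    filter_upwards [ho, (C.param.contMDiffOn.continuousOn.continuousAt ho).preimage_mem_nhds
      ((isOpen_homChart_source w.proj).mem_nhds hs)] with y' h1 h2 using ⟨h1, h2⟩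
  have hm := (isOpen_homChart_target w.proj).mem_nhds (homChart_mem_target hs)
  have hrel := lieBracket_of_related (C.contDiffAt_homChart_param hy hs)
    (((C.contDiffOn_field c).contDiffAt ho).differentiableAt (by simp))
    (((C.contDiffOn_field d).contDiffAt ho).differentiableAt (by simp))
    (((contDiffOn_frameModel g w.proj c).contDiffAt hm).differentiableAt (by simp))
    (((contDiffOn_frameModel g w.proj d).contDiffAt hm).differentiableAt (by simp))
    (by filter_upwards [hev] with y' h' using C.fderiv_homChart_param h'.1 h'.2 c)
    (by filter_upwards [hev] with y' h' using C.fderiv_homChart_param h'.1 h'.2 d)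
  refine C.fderiv_homChart_param_injective hy hs ?_
  rw [hrel]
  refine (lieBracket_frameModel (C.param_mem hy).1 c d).trans ?_
  rw [map_sum]
  refine Finset.sum_congr rfl fun k _ => ?_
  rw [map_smul, C.fderiv_homChart_param hy hs]

end FrameChart

end Frames

/-! ### Existence of frame charts through coordinates adapted to $FM$. -/

/-- A smooth map is a local diffeomorphism where its differential is invertible. -/
theorem exists_local_diffeo {E : Type*} [NormedAddCommGroup E] [NormedSpace ℝ E]
    [FiniteDimensional ℝ E] {f : E → E} {s : Set E} {a : E} (hs : IsOpen s) (ha : a ∈ s)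
    (hf : ContDiffOn ℝ ∞ f s) (hinj : Function.Injective (fderiv ℝ f a)) :
    ∃ Ψ : OpenPartialHomeomorph E E, a ∈ Ψ.source ∧ Ψ.source ⊆ s ∧
      (∀ z ∈ Ψ.source, Ψ z = f z) ∧ ContDiffOn ℝ ∞ Ψ.symm Ψ.target ∧
      ∀ z ∈ Ψ.source, Function.Injective (fderiv ℝ f z) := by
  have : CompleteSpace E := FiniteDimensional.complete ℝ E
  obtain ⟨L, hL⟩ := exists_equiv_of_injective hinj
  have hfa := hf.contDiffAt (hs.mem_nhds ha)
  have hder : HasFDerivAt f (L : E →L[ℝ] E) a := by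
    rw [hL]; exact (hfa.differentiableAt (by simp)).hasFDerivAt
  set Φ := hfa.toOpenPartialHomeomorph f hder (by simp)
  -- Invertibility is an open condition. Shrinking the inverse-function domain to the points where
  -- it holds makes the local inverse smooth on the whole target, not only at the image of `a`.
  set t : Set E := s ∩ fderiv ℝ f ⁻¹' range ((↑) : (E ≃L[ℝ] E) → E →L[ℝ] E) with ht
  have hto : IsOpen t :=
    (hf.continuousOn_fderiv_of_isOpen hs (by simp)).isOpen_inter_preimage hs
      (ContinuousLinearEquiv.isOpen)
  have hta : a ∈ t := ⟨ha, L, hL⟩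
  have hsrc : (Φ.restrOpen t hto).source = Φ.source ∩ t := Φ.restrOpen_source t hto
  have hcoe : ∀ z, Φ.restrOpen t hto z = f z := fun z => rfl
  refine ⟨Φ.restrOpen t hto, ?_, ?_, fun z _ => hcoe z, ?_, ?_⟩
  · rw [hsrc]; exact ⟨hfa.mem_toOpenPartialHomeomorph_source hder (by simp), hta⟩
  · rw [hsrc]; exact fun z hz => hz.2.1
  · intro y hy
    have hz := (Φ.restrOpen t hto).map_target hy
    rw [hsrc] at hz
    obtain ⟨L', hL'⟩ := hz.2.2
    have hfz := hf.contDiffAt (hs.mem_nhds hz.2.1)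
    refine (OpenPartialHomeomorph.contDiffAt_symm _ hy (f₀' := L') ?_ hfz).contDiffWithinAt
    rw [hL']
    exact (hfz.differentiableAt (by simp)).hasFDerivAt
  · rw [hsrc]
    rintro z ⟨-, -, L', hL'⟩
    rw [← hL']
    exact L'.injective

/-- The skew-symmetric part of an endomorphism of `ℝⁿ`. -/
def skewPart {n : ℕ} : (Eu n →L[ℝ] Eu n) →L[ℝ] (Eu n →L[ℝ] Eu n) :=
  LinearMap.toContinuousLinearMap
    { toFun := fun S => (1 / 2 : ℝ) • (S - ContinuousLinearMap.adjoint S)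
      map_add' := fun S T => by rw [map_add]; module
      map_smul' := fun r S => by
        rw [map_smulₛₗ]; simp only [conj_trivial, RingHom.id_apply]; module }

theorem skewPart_apply {n : ℕ} (S : Eu n →L[ℝ] Eu n) :
    skewPart S = (1 / 2 : ℝ) • (S - ContinuousLinearMap.adjoint S) := rfl

theorem inner_skewPart {n : ℕ} (S : Eu n →L[ℝ] Eu n) (a b : Eu n) :
    inner ℝ (skewPart S a) b = (1 / 2 : ℝ) * (inner ℝ (S a) b - inner ℝ a (S b)) := by
  simp [skewPart_apply, inner_sub_left, inner_smul_left, ContinuousLinearMap.adjoint_inner_left]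

theorem toEnd_skewCoords_skewPart {n : ℕ} (S : Eu n →L[ℝ] Eu n) :
    toEnd (skewCoords (skewPart S)) = skewPart S :=
  toEnd_skewCoords fun a b => by
    rw [inner_skewPart, real_inner_comm (skewPart S b) a, inner_skewPart,
      real_inner_comm (S a) b, real_inner_comm (S b) a]
    ring

/-- The coordinates of `ParamSpace`. -/
def splitParam {n : ℕ} : ParamSpace n ≃L[ℝ] Eu n × Lam2 ℝ n :=
  LinearEquiv.toContinuousLinearEquiv
    { toFun := fun y => (WithLp.toLp 2 fun i => y (Sum.inl i), WithLp.toLp 2 fun p => y (Sum.inr p))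
      invFun := fun q => WithLp.toLp 2 (Sum.elim q.1 q.2)
      map_add' := fun _ _ => rfl
      map_smul' := fun _ _ => rfl
      left_inv := fun y => by ext (i | p) <;> rfl
      right_inv := fun q => rfl }

section Frames

variable {n : ℕ} {M : Type*} [TopologicalSpace M] [ChartedSpace (Eu n) M]
  [IsManifold (𝓡 n) ∞ M]

/-- The pullback of the metric by frames, as an endomorphism of `ℝⁿ`. -/
def pullForm (g : RMetric n M) (x : M) (z : HomModel n) : Eu n →L[ℝ] Eu n :=
  ∑ i, ∑ k, pullMetric g x z (e i) (e k) •
    (EuclideanSpace.proj i : Eu n →L[ℝ] ℝ).smulRight (e k)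

theorem pullForm_apply (g : RMetric n M) (x : M) (z : HomModel n) (a : Eu n) (k : Fin n) :
    pullForm g x z a k = pullMetric g x z a (e k) := by
  have h : pullMetric g x z a (e k) = ∑ i, a i * pullMetric g x z (e i) (e k) := by
    conv_lhs => rw [← sum_smul_e a]
    simp [pullMetric]
  rw [h]
  simp [pullForm, e_apply, mul_comm]

theorem inner_pullForm (g : RMetric n M) (x : M) (z : HomModel n) (a b : Eu n) :
    inner ℝ (pullForm g x z a) b = pullMetric g x z a b := by
  conv_rhs => rw [← sum_smul_e b]
  conv_lhs => rw [← sum_smul_e b]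
  rw [inner_sum]
  have : pullMetric g x z a (∑ i, b i • e i) = ∑ i, b i * pullMetric g x z a (e i) := by
    simp [pullMetric]
  rw [this]
  exact Finset.sum_congr rfl fun k _ => by rw [inner_smul_right, inner_e, pullForm_apply]

theorem pullMetric_symm (g : RMetric n M) (x : M) (z : HomModel n) (a b : Eu n) :
    pullMetric g x z a b = pullMetric g x z b a := metricChart_symm g x _ _ _

theorem mem_isomModel_iff_pullForm {g : RMetric n M} {x : M} {z : HomModel n} :
    z ∈ isomModel g x ↔ pullForm g x z = .id ℝ (Eu n) := by
  refine ⟨fun h => ?_, fun h a b => ?_⟩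
  · ext1 a
    refine ext_inner_right ℝ fun b => ?_
    rw [inner_pullForm, h a b]; rfl
  · rw [← inner_pullForm, h]; rfl

theorem contDiffOn_pullForm (g : RMetric n M) (x : M) :
    ContDiffOn ℝ ∞ (pullForm g x) (homChart x).target :=
  ContDiffOn.sum fun i _ => ContDiffOn.sum fun k _ =>
    (contDiffOn_pullMetric g x (e i) (e k)).smul contDiffOn_const

theorem inner_fderiv_pullForm (g : RMetric n M) {x : M} {z : HomModel n}
    (hz : z ∈ (homChart x).target) (ζ : HomModel n) (a b : Eu n) :
    inner ℝ (fderiv ℝ (pullForm g x) z ζ a) b =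
      fderiv ℝ (fun z => pullMetric g x z a b) z ζ := by
  have hd := ((contDiffOn_pullForm g x).contDiffAt
    ((isOpen_homChart_target x).mem_nhds hz)).differentiableAt (by simp)
  have h := ((innerSL ℝ b).hasFDerivAt.comp z
    (hd.hasFDerivAt.clm_apply (hasFDerivAt_const a z))).fderiv
  have h2 : (innerSL ℝ b ∘ fun y => pullForm g x y a) = fun z => pullMetric g x z a b := by
    funext y
    rw [← inner_pullForm, real_inner_comm]; rfl
  rw [h2] at h
  rw [h, real_inner_comm]
  simp

/-- The sign of frames, in a chart of `Hom(ℝⁿ, TM)`. -/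
def signModel (o : OrientationForm n M) (x : M) (z : HomModel n) : ℝ :=
  z.2.det * o.form ((extChartAt (𝓡 n) x).symm z.1) (coordField x z.1)

theorem continuousOn_signModel (o : OrientationForm n M) (x : M) :
    ContinuousOn (signModel (n := n) o x) (homChart x).target :=
  (ContinuousLinearMap.continuous_det.comp continuous_snd).continuousOn.mul
    ((o.continuousOn x).comp continuous_fst.continuousOn fun _ hz => mem_homChart_target hz)

/-- The form on the frame is its value on the coordinate basis times the determinant of the frame in
coordinates. Thus the orientation condition becomes the positivity of a continuous function. -/
theorem form_eq_signModel (o : OrientationForm n M) {x : M} {w : HomBundle n M}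
    (hw : w ∈ (homChart x).source) :
    o.form w.proj (fun i => ev w (e i)) = signModel o x (homChart x w) := by
  have hp : w.proj ∈ (extChartAt (𝓡 n) x).source := by rwa [homChart_source] at hw
  have key : ∀ a, dchartSymm x (homChart x w).1 ((homChart x w).2 a) = w.snd a := fun a => by
    have h := congrArg (fun L => L (w.snd a))
      (dchartSymm_comp_dchart ((extChartAt (𝓡 n) x).map_source hp))
    rw [(extChartAt (𝓡 n) x).left_inv hp] at h
    rw [homChart_apply hw]
    exact h
  have hpr : (extChartAt (𝓡 n) x).symm (homChart x w).1 = w.proj := by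
    rw [homChart_apply hw]; exact (extChartAt (𝓡 n) x).left_inv hp
  set z := homChart x w
  have hform : ∀ p : M, p = w.proj → o.form w.proj (fun i => ev w (e i)) =
      o.form p (fun i => dchartSymm x z.1 (z.2 (e i))) := by
    rintro p rfl
    exact congrArg _ (funext fun i => (key (e i)).symm)
  rw [hform _ hpr, signModel]
  set η : Eu n [⋀^Fin n]→ₗ[ℝ] ℝ := AlternatingMap.compLinearMap (o.form ((extChartAt (𝓡 n) x).symm z.1))
    (dchartSymm x z.1 : Eu n →ₗ[ℝ] Eu n)
  set b := (EuclideanSpace.basisFun (Fin n) ℝ).toBasis with hb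
  have hbe : (b : Fin n → Eu n) = e := by
    funext i; simp [hb, e]
  have h1 := congrArg (fun f => f ((z.2 : Eu n →ₗ[ℝ] Eu n) ∘ e)) (η.eq_smul_basis_det b)
  simp only [AlternatingMap.smul_apply, smul_eq_mul] at h1
  rw [b.det_comp, ← hbe, b.det_self, mul_one, mul_comm] at h1
  rw [hbe] at h1
  exact h1

theorem mem_FM_iff {g : RMetric n M} {o : OrientationForm n M} {x : M} {w : HomBundle n M}
    (hw : w ∈ (homChart x).source) :
    w ∈ FM g o ↔ homChart x w ∈ isomModel g x ∧ 0 < signModel o x (homChart x w) := by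
  rw [← form_eq_signModel o hw]
  refine and_congr ⟨fun h a b => ?_, fun h a b => ?_⟩ Iff.rfl
  · rw [pullMetric, ← inner_eq_metricChart g hw, h]
  · rw [inner_eq_metricChart g hw]; exact h a b

/-- An isometric frame is a basis, and an alternating `n`-form that vanishes on one basis vanishes
identically. Consequently `≥ 0` and `> 0` describe the same orientation condition on isometries. -/
theorem form_ne_zero {g : RMetric n M} (o : OrientationForm n M) {w : HomBundle n M}
    (hw : ∀ a b : Eu n, g.inner w.proj (ev w a) (ev w b) = inner ℝ a b) :
    o.form w.proj (fun i => ev w (e i)) ≠ 0 := by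
  have hinj : Function.Injective (show Eu n →L[ℝ] Eu n from w.snd) := by
    refine (injective_iff_map_eq_zero (show Eu n →L[ℝ] Eu n from w.snd)).2 fun a ha => ?_
    have h := hw a a
    have h0 : ev w a = 0 := ha
    rw [h0] at h
    simpa using h.symm
  obtain ⟨L, hL⟩ := exists_equiv_of_injective hinj
  set b := (EuclideanSpace.basisFun (Fin n) ℝ).toBasis.map L.toLinearEquiv with hb
  have hbe : ∀ i, b i = w.snd (e i) := fun i => by
    have := congrArg (fun S => S (e i)) hL
    simp only [ContinuousLinearEquiv.coe_coe] at this
    simp only [hb, Module.Basis.map_apply]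
    refine Eq.trans ?_ this
    simp [e]
  intro h0
  refine o.ne_zero w.proj (Module.Basis.ext_alternating b fun v hv => ?_)
  set σ : Equiv.Perm (Fin n) := Equiv.ofBijective v (Finite.injective_iff_bijective.1 hv)
  have h1 := AlternatingMap.map_perm (o.form w.proj) b σ
  have h2 : o.form w.proj b = 0 := by
    rw [← h0]; exact congrArg _ (funext hbe)
  rw [h2] at h1
  refine Eq.trans ?_ (h1.trans (smul_zero _))
  rfl

end Frames

section Frames

variable {n : ℕ} {M : Type*} [TopologicalSpace M] [ChartedSpace (Eu n) M]
  [IsManifold (𝓡 n) ∞ M]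

/-- Coordinates of `Hom(ℝⁿ, TM)` adapted to `FM`, given a left inverse `K` of a frame. -/
def adaptedMap (g : RMetric n M) (x : M) (K : Eu n →L[ℝ] Eu n) (z : HomModel n) : HomModel n :=
  (z.1, (1 / 2 : ℝ) • pullForm g x z + skewPart (K.comp z.2))

/-- The coordinates of `FM` in `adaptedMap`. -/
def adaptedCoords (K : Eu n →L[ℝ] Eu n) : HomModel n →L[ℝ] ParamSpace n :=
  (splitParam (n := n)).symm.toContinuousLinearMap.comp
    ((ContinuousLinearMap.fst ℝ _ _).prod ((skewCoords.comp skewPart).comp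
      ((ContinuousLinearMap.compL ℝ (Eu n) (Eu n) (Eu n) K).comp (ContinuousLinearMap.snd ℝ _ _))))

/-- The slice of `adaptedMap` which is `FM`. -/
def adaptedSlice (y : ParamSpace n) : HomModel n :=
  ((splitParam y).1, (1 / 2 : ℝ) • .id ℝ (Eu n) + toEndL (splitParam y).2)

theorem splitParam_adaptedCoords (K : Eu n →L[ℝ] Eu n) (z : HomModel n) :
    splitParam (adaptedCoords K z) = (z.1, skewCoords (skewPart (K.comp z.2))) :=
  splitParam.apply_symm_apply _

theorem contDiffOn_adaptedMap (g : RMetric n M) (x : M) (K : Eu n →L[ℝ] Eu n) :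
    ContDiffOn ℝ ∞ (adaptedMap g x K) (homChart x).target :=
  contDiff_fst.contDiffOn.prodMk (((contDiffOn_pullForm g x).const_smul _).add
    (skewPart.contDiff.comp (contDiff_const.clm_comp contDiff_snd)).contDiffOn)

theorem fderiv_adaptedMap (g : RMetric n M) {x : M} (K : Eu n →L[ℝ] Eu n) {z : HomModel n}
    (hz : z ∈ (homChart x).target) (ζ : HomModel n) :
    fderiv ℝ (adaptedMap g x K) z ζ =
      (ζ.1, (1 / 2 : ℝ) • fderiv ℝ (pullForm g x) z ζ + skewPart (K.comp ζ.2)) := by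
  have hd := ((contDiffOn_pullForm g x).contDiffAt
    ((isOpen_homChart_target x).mem_nhds hz)).differentiableAt (by simp)
  have h := ((hasFDerivAt_fst (𝕜 := ℝ) (p := z)).prodMk ((hd.hasFDerivAt.const_smul (1 / 2 : ℝ)).add
    (skewPart.hasFDerivAt.comp z ((hasFDerivAt_const K z).clm_comp
      (hasFDerivAt_snd (𝕜 := ℝ) (p := z)))))).fderiv
  have h2 := congrArg (fun L => L ζ) h
  refine Eq.trans h2 ?_
  simp

theorem contDiff_adaptedSlice : ContDiff ℝ ∞ (adaptedSlice (n := n)) := by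
  refine (contDiff_fst.comp splitParam.contDiff).prodMk (contDiff_const.add ?_)
  exact toEndL.contDiff.comp (contDiff_snd.comp splitParam.contDiff)

theorem fderiv_adaptedSlice (y v : ParamSpace n) :
    fderiv ℝ adaptedSlice y v = ((splitParam v).1, toEnd (splitParam v).2) := by
  have hs := (splitParam (n := n)).hasFDerivAt (x := y)
  have h := ((hasFDerivAt_fst.comp y hs).prodMk
    ((toEndL.hasFDerivAt.comp y (hasFDerivAt_snd.comp y hs)).const_add
      ((1 / 2 : ℝ) • .id ℝ (Eu n)))).fderiv
  exact congrArg (fun L => L v) h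

theorem adaptedMap_of_mem_isomModel {g : RMetric n M} {x : M} (K : Eu n →L[ℝ] Eu n)
    {z : HomModel n} (hz : z ∈ isomModel g x) :
    adaptedMap g x K z = adaptedSlice (adaptedCoords K z) := by
  rw [adaptedMap, adaptedSlice, splitParam_adaptedCoords, mem_isomModel_iff_pullForm.1 hz,
    toEndL_apply, toEnd_skewCoords_skewPart]

/-- The pulled-back metric is symmetric, while `skewPart` and `toEnd` are skew. Comparing the
symmetric parts gives the isometry condition; comparing the skew parts gives the coordinates. -/
theorem eq_of_adaptedMap_eq {g : RMetric n M} {x : M} {K : Eu n →L[ℝ] Eu n}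
    {z : HomModel n} {y : ParamSpace n} (h : adaptedMap g x K z = adaptedSlice y) :
    z ∈ isomModel g x ∧ adaptedCoords K z = y := by
  have h1 := congrArg Prod.fst h
  have h2 := congrArg Prod.snd h
  simp only [adaptedMap, adaptedSlice, toEndL_apply] at h1 h2
  have h3 : ∀ a b, (1 / 2 : ℝ) * pullMetric g x z a b + inner ℝ (skewPart (K.comp z.2) a) b =
      (1 / 2 : ℝ) * inner ℝ a b + inner ℝ (toEnd (splitParam y).2 a) b := fun a b => by
    have := congrArg (fun S : Eu n →L[ℝ] Eu n => inner ℝ (S a) b) h2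
    simpa [inner_add_left, inner_smul_left, inner_pullForm] using this
  have hs : ∀ a b, inner ℝ (skewPart (K.comp z.2) a) b = -inner ℝ (skewPart (K.comp z.2) b) a :=
    fun a b => by
      rw [inner_skewPart, inner_skewPart, real_inner_comm (K.comp z.2 a) b,
        real_inner_comm (K.comp z.2 b) a]
      ring
  have ht : ∀ a b, inner ℝ (toEnd (splitParam y).2 a) b = -inner ℝ (toEnd (splitParam y).2 b) a :=
    fun a b => by rw [inner_toEnd, real_inner_comm]
  have hz : z ∈ isomModel g x := fun a b => by
    have e1 := h3 a b
    have e2 := h3 b a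
    rw [pullMetric_symm, real_inner_comm a b] at e2
    linarith [hs a b, ht a b]
  refine ⟨hz, splitParam.injective ?_⟩
  rw [splitParam_adaptedCoords]
  refine Prod.ext h1 ?_
  have : skewPart (K.comp z.2) = toEnd (splitParam y).2 := by
    ext1 a
    refine ext_inner_right ℝ fun b => ?_
    have := h3 a b
    rw [hz a b] at this
    linarith
  rw [this, skewCoords_toEnd]

/-- Write the fibre variation as `z.2 ∘ S`. The symmetric slot of the derivative gives `(S + Sᵀ) /
2` and the skew slot `(S - Sᵀ) / 2`, so their sum is `S`. This is the purpose of the factor `1 / 2`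
in `adaptedMap`. -/
theorem fderiv_adaptedMap_injective {g : RMetric n M} {x : M} {K : Eu n →L[ℝ] Eu n}
    {z : HomModel n} (hz : z ∈ (homChart x).target) (hzi : z ∈ isomModel g x)
    (hK' : z.2.comp K = .id ℝ (Eu n)) :
    Function.Injective (fderiv ℝ (adaptedMap g x K) z) := by
  refine (injective_iff_map_eq_zero _).2 fun ζ hζ => ?_
  rw [fderiv_adaptedMap g K hz] at hζ
  have h1 : ζ.1 = 0 := congrArg Prod.fst hζ
  have h2 := congrArg Prod.snd hζ
  set S := K.comp ζ.2 with hS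
  have hzS : ζ.2 = z.2.comp S := by
    rw [hS, ← ContinuousLinearMap.comp_assoc, hK', ContinuousLinearMap.id_comp]
  have hSa : ∀ a, ζ.2 a = z.2 (S a) := fun a => by rw [hzS]; rfl
  have hS0 : S = 0 := by
    ext1 a
    refine ext_inner_right ℝ fun b => ?_
    have h3 := congrArg (fun T : Eu n →L[ℝ] Eu n => inner ℝ (T a) b) h2
    simp only [add_apply, smul_apply, inner_add_left, inner_smul_left, Prod.snd_zero,
      zero_apply, inner_zero_left, inner_skewPart, inner_fderiv_pullForm g hz,
      fderiv_pullMetric g hz, h1, map_zero, zero_add, hSa] at h3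
    have e1 := hzi (S a) b
    have e2 := hzi a (S b)
    rw [pullMetric] at e1 e2
    rw [e1, e2] at h3
    simp only [conj_trivial] at h3
    simp only [zero_apply, inner_zero_left]
    linarith
  refine Prod.ext h1 ?_
  rw [hzS, hS0]
  simp

theorem fderiv_adaptedMap_frameModel (g : RMetric n M) {x : M} (K : Eu n →L[ℝ] Eu n)
    {z : HomModel n} (hz : z ∈ (homChart x).target) (hzi : z ∈ isomModel g x) (c : FrameIdx n) :
    fderiv ℝ (adaptedMap g x K) z (frameModel g x c z) =
      ((frameModel g x c z).1, skewPart (K.comp (frameModel g x c z).2)) := by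
  rw [fderiv_adaptedMap g K hz]
  refine Prod.ext rfl ?_
  have : fderiv ℝ (pullForm g x) z (frameModel g x c z) = 0 := by
    ext1 a
    refine ext_inner_right ℝ fun b => ?_
    rw [inner_fderiv_pullForm g hz, fderiv_pullMetric_frameModel g hz hzi]
    simp
  rw [this]
  exact (congrArg (· + _) (smul_zero (1 / 2 : ℝ))).trans (zero_add _)

/-- Since the frame is tangent to the isometries, `adaptedMap` sends it to a vector tangent to the
slice. The parameter velocity can then be read off linearly by `adaptedCoords`. -/
theorem fderiv_slice_frameModel (g : RMetric n M) {x : M} (K : Eu n →L[ℝ] Eu n)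
    {φ : ParamSpace n → HomModel n} {y : ParamSpace n} (hφ : DifferentiableAt ℝ φ y)
    (hev : adaptedMap g x K ∘ φ =ᶠ[𝓝 y] adaptedSlice) (hz : φ y ∈ (homChart x).target)
    (hzi : φ y ∈ isomModel g x) (hinj : Function.Injective (fderiv ℝ (adaptedMap g x K) (φ y)))
    (c : FrameIdx n) :
    fderiv ℝ φ y (adaptedCoords K (frameModel g x c (φ y))) = frameModel g x c (φ y) := by
  refine hinj ?_
  have h3 := (((contDiffOn_adaptedMap g x K).contDiffAt ((isOpen_homChart_target x).mem_nhds
    hz)).differentiableAt (by simp)).hasFDerivAt.comp y hφ.hasFDerivAt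
  have h5 := h3.fderiv
  rw [hev.fderiv_eq] at h5
  refine (congrArg (fun L => L (adaptedCoords K (frameModel g x c (φ y)))) h5).symm.trans ?_
  rw [fderiv_adaptedSlice, splitParam_adaptedCoords, toEnd_skewCoords_skewPart,
    fderiv_adaptedMap_frameModel g K hz hzi]

theorem mfderiv_eq_frameField (g : RMetric n M) {x : M} {ψ : ParamSpace n → HomBundle n M}
    {φ : ParamSpace n → HomModel n} {y v : ParamSpace n}
    (hψ : MDifferentiableAt 𝓘(ℝ, ParamSpace n) (IHom n) ψ y) (hs : ψ y ∈ (homChart x).source)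
    (hev : homChart x ∘ ψ =ᶠ[𝓝 y] φ) (c : FrameIdx n)
    (hv : fderiv ℝ φ y v = frameModel g x c (homChart x (ψ y))) :
    mfderiv 𝓘(ℝ, ParamSpace n) (IHom n) ψ y v = frameField g c (ψ y) := by
  have hinvt := isInvertible_mfderiv_extChartAt (I := IHom n) (x := (⟨x, 0⟩ : HomBundle n M))
    (y := ψ y) (by rw [extChartAt_mk_eq_homChart]; exact hs)
  rw [extChartAt_mk_eq_homChart] at hinvt
  have h := mfderiv_comp (I' := IHom n) y
    (((contMDiffOn_homChart x).contMDiffAt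
      ((isOpen_homChart_source x).mem_nhds hs)).mdifferentiableAt (by simp)) hψ
  rw [hev.mfderiv_eq, mfderiv_eq_fderiv] at h
  obtain ⟨Λ, hΛ⟩ := hinvt
  refine Λ.injective ?_
  have h6 := congrArg (fun L => L v) h
  have h7 := mfderiv_homChart_frameField g hs c
  rw [← hΛ] at h6 h7
  exact (h6.symm.trans hv).trans h7.symm

/-- Every point of `FM` lies in a frame chart. -/
theorem exists_frameChart {g : RMetric n M} {o : OrientationForm n M} {w₀ : HomBundle n M}
    (hw₀ : w₀ ∈ FM g o) : ∃ C : FrameChart g o, w₀ ∈ C.nhd := by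
  set x := w₀.proj with hx
  have hs₀ := mem_homChart_source w₀
  have hz₀ := homChart_mem_target hs₀
  obtain ⟨hi₀, hσ₀⟩ := (mem_FM_iff hs₀).1 hw₀
  rw [← hx] at hs₀ hz₀ hi₀ hσ₀
  set z₀ := homChart x w₀ with hz₀def
  obtain ⟨L, hL⟩ := exists_equiv_of_injective (isomModel_injective hi₀)
  -- The inverse of the frame `w₀` itself, which makes the differential of `adaptedMap` invertible
  -- at `z₀`.
  set K : Eu n →L[ℝ] Eu n := L.symm.toContinuousLinearMap with hKdef
  have hK' : z₀.2.comp K = .id ℝ (Eu n) := by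
    rw [← hL]; ext1 a; exact L.apply_symm_apply a
  obtain ⟨Ψ, hΨ₀, hΨs, hΨ, hΨsymm, hΨinj⟩ := exists_local_diffeo (isOpen_homChart_target x) hz₀
    (contDiffOn_adaptedMap g x K) (fderiv_adaptedMap_injective hz₀ hi₀ hK')
  have hsc : Continuous (adaptedSlice (n := n)) := contDiff_adaptedSlice.continuous
  set U : Set (ParamSpace n) := adaptedSlice ⁻¹' Ψ.target with hU
  have hUo : IsOpen U := Ψ.open_target.preimage hsc
  set φ : ParamSpace n → HomModel n := fun y => Ψ.symm (adaptedSlice y) with hφ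
  have hφU : ContDiffOn ℝ ∞ φ U := hΨsymm.comp contDiff_adaptedSlice.contDiffOn fun y hy => hy
  have hφs : ∀ y ∈ U, φ y ∈ Ψ.source := fun y hy => Ψ.map_target hy
  have hφt : ∀ y ∈ U, φ y ∈ (homChart x).target := fun y hy => hΨs (hφs y hy)
  have hφm : ∀ y ∈ U, adaptedMap g x K (φ y) = adaptedSlice y := fun y hy => by
    rw [← hΨ _ (hφs y hy)]; exact Ψ.right_inv hy
  have hφi : ∀ y ∈ U, φ y ∈ isomModel g x := fun y hy => (eq_of_adaptedMap_eq (hφm y hy)).1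
  have hφc : ∀ y ∈ U, adaptedCoords K (φ y) = y := fun y hy => (eq_of_adaptedMap_eq (hφm y hy)).2
  -- The slice over `U` parametrizes isometries irrespective of orientation; the open sign condition
  -- selects the oriented ones.
  set dom : Set (ParamSpace n) := U ∩ (fun y => signModel o x (φ y)) ⁻¹' Ioi 0 with hdom
  have hdomo : IsOpen dom :=
    ((continuousOn_signModel o x).comp hφU.continuousOn hφt).isOpen_inter_preimage hUo isOpen_Ioi
  set ψ : ParamSpace n → HomBundle n M := fun y => (homChart x).symm (φ y) with hψ
  have hψs : ∀ y ∈ U, ψ y ∈ (homChart x).source := fun y hy => (homChart x).map_target (hφt y hy)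
  have hψc : ∀ y ∈ U, homChart x (ψ y) = φ y := fun y hy => (homChart x).right_inv (hφt y hy)
  have hψsm : ContMDiffOn 𝓘(ℝ, ParamSpace n) (IHom n) ∞ ψ dom :=
    (contMDiffOn_homChart_symm x).comp (hφU.mono inter_subset_left).contMDiffOn
      fun y hy => hφt y hy.1
  set nhd : Set (HomBundle n M) := (homChart x).source ∩ homChart x ⁻¹' Ψ.source with hnhd
  have hnhdo : IsOpen nhd := (contMDiffOn_homChart x).continuousOn.isOpen_inter_preimage
    (isOpen_homChart_source x) Ψ.open_source
  set inv : HomBundle n M → ParamSpace n := fun w => adaptedCoords K (homChart x w) with hinv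
  have hinvs : ContMDiffOn (IHom n) 𝓘(ℝ, ParamSpace n) ∞ inv nhd :=
    ((adaptedCoords K).contDiff.contMDiff).comp_contMDiffOn
      ((contMDiffOn_homChart x).mono inter_subset_left)
  have hinvψ : ∀ y ∈ dom, inv (ψ y) = y := fun y hy => by
    simp only [hinv]; rw [hψc y hy.1, hφc y hy.1]
  have hψFM : ∀ y ∈ dom, ψ y ∈ FM g o ∩ nhd := fun y hy => by
    refine ⟨(mem_FM_iff (hψs y hy.1)).2 ?_, hψs y hy.1, ?_⟩
    · rw [hψc y hy.1]; exact ⟨hφi y hy.1, hy.2⟩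
    · rw [mem_preimage, hψc y hy.1]; exact hφs y hy.1
  have hmd : ∀ y ∈ dom, MDifferentiableAt 𝓘(ℝ, ParamSpace n) (IHom n) ψ y := fun y hy =>
    (hψsm.contMDiffAt (hdomo.mem_nhds hy)).mdifferentiableAt (by simp)
  refine ⟨{
    param := {
      toFun := ψ
      domain := dom
      isOpen_domain := hdomo
      contMDiffOn := hψsm
      injOn := fun y hy y' hy' h => by rw [← hinvψ y hy, ← hinvψ y' hy', h]
      immersion := ?_
      mapsTo := fun y hy => (hψFM y hy).1 }
    nhd := nhd
    isOpen_nhd := hnhdo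
    inv := inv
    contMDiffOn_inv := hinvs
    image_eq := ?_
    inv_param := hinvψ
    -- `adaptedCoords K` is linear and a left inverse of `φ`, so it turns the frame at `φ y` into
    -- its parameter velocity.
    field := fun c y => adaptedCoords K (frameModel g x c (φ y))
    contDiffOn_field := fun c => (adaptedCoords K).contDiff.comp_contDiffOn
      ((contDiffOn_frameModel g x c).comp (hφU.mono inter_subset_left) fun y hy => hφt y hy.1)
    mfderiv_field := ?_ }, hs₀, hΨ₀⟩
  · intro y hy
    have h := mfderiv_comp (I' := IHom n) y
      ((hinvs.contMDiffAt (hnhdo.mem_nhds (hψFM y hy).2)).mdifferentiableAt (by simp)) (hmd y hy)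
    have h2 : inv ∘ ψ =ᶠ[𝓝 y] id := by
      filter_upwards [hdomo.mem_nhds hy] with y' hy' using hinvψ y' hy'
    rw [h2.mfderiv_eq, mfderiv_id] at h
    intro v v' hv
    have e1 := congrArg (fun L => L v) h
    have e2 := congrArg (fun L => L v') h
    exact e1.trans ((congrArg _ hv).trans e2.symm)
  · refine Subset.antisymm ?_ ?_
    · rintro _ ⟨y, hy, rfl⟩
      exact hψFM y hy
    · rintro w ⟨hwF, hws, hwΨ⟩
      obtain ⟨hi, hσ⟩ := (mem_FM_iff hws).1 hwF
      have h1 : adaptedSlice (inv w) = Ψ (homChart x w) := by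
        rw [hΨ _ hwΨ]; exact (adaptedMap_of_mem_isomModel K hi).symm
      have h2 : φ (inv w) = homChart x w := by
        simp only [hφ]; rw [h1]; exact Ψ.left_inv hwΨ
      refine ⟨inv w, ⟨?_, ?_⟩, ?_⟩
      · rw [hU, mem_preimage, h1]; exact Ψ.map_source hwΨ
      · rw [mem_preimage, h2]; exact hσ
      · simp only [hψ]; rw [h2]; exact (homChart x).left_inv hws
  · intro c y hy
    have hφd : DifferentiableAt ℝ φ y :=
      (hφU.contDiffAt (hUo.mem_nhds hy.1)).differentiableAt (by simp)
    refine mfderiv_eq_frameField g (hmd y hy) (hψs y hy.1) (φ := φ) ?_ c ?_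
    · filter_upwards [hUo.mem_nhds hy.1] with y' hy' using hψc y' hy'
    · rw [hψc y hy.1]
      refine fderiv_slice_frameModel g K hφd ?_ (hφt y hy.1) (hφi y hy.1) (hΨinj _ (hφs y hy.1)) c
      filter_upwards [hUo.mem_nhds hy.1] with y' hy' using hφm y' hy'

end Frames

/-! ### Riemannian density and derivations in frame charts. -/

section Frames

variable {n : ℕ} {M : Type*} [TopologicalSpace M] [ChartedSpace (Eu n) M]
  [IsManifold (𝓡 n) ∞ M]

/-- The coordinates of a tangent vector in the frame `B_{𝐞ᵢ}`, `Y_{𝐞ᵢ ∧ 𝐞ⱼ}`. -/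
def frameCoords (g : RMetric n M) (w : HomBundle n M) :
    TangentSpace (IHom n) w →ₗ[ℝ] ParamSpace n where
  toFun ζ := WithLp.toLp 2 (Sum.elim (fun i => g.inner w.proj (dproj w ζ) (ev w (e i)))
    fun p => g.inner w.proj (connMap g w ζ (e p.1.1)) (ev w (e p.1.2)))
  map_add' ζ ζ' := by
    have h1 : dproj w (ζ + ζ') = dproj w ζ + dproj w ζ' := rfl
    have h2 : connMap g w (ζ + ζ') = connMap g w ζ + connMap g w ζ' := by
      have : christoffelMap g w.proj (dproj w ζ + dproj w ζ') =
        christoffelMap g w.proj (dproj w ζ) + christoffelMap g w.proj (dproj w ζ') :=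
        (christoffelMap g w.proj).map_add _ _
      ext1 v
      have h3 := congrArg (fun L : Eu n →L[ℝ] Eu n => L (w.snd v)) this
      have h4 : connMap g w (ζ + ζ') v = (show HomModel n from ζ).2 v + (show HomModel n from ζ').2 v
        + christoffelMap g w.proj (dproj w ζ + dproj w ζ') (w.snd v) := rfl
      have h5 : (connMap g w ζ + connMap g w ζ') v = ((show HomModel n from ζ).2 v
        + christoffelMap g w.proj (dproj w ζ) (w.snd v)) + ((show HomModel n from ζ').2 v
        + christoffelMap g w.proj (dproj w ζ') (w.snd v)) := rfl
      rw [h4, h5]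
      refine (congrArg (_ + ·) h3).trans ?_
      exact add_add_add_comm _ _ _ _
    ext (i | p)
    · simp [h1]
    · simp [h2]
  map_smul' r ζ := by
    have h1 : dproj w (r • ζ) = r • dproj w ζ := rfl
    have h2 : connMap g w (r • ζ) = r • connMap g w ζ := by
      have : christoffelMap g w.proj (r • dproj w ζ) = r • christoffelMap g w.proj (dproj w ζ) :=
        (christoffelMap g w.proj).map_smul _ _
      ext1 v
      have h3 := congrArg (fun L : Eu n →L[ℝ] Eu n => L (w.snd v)) this
      have h4 : connMap g w (r • ζ) v = r • (show HomModel n from ζ).2 v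
        + christoffelMap g w.proj (r • dproj w ζ) (w.snd v) := rfl
      have h5 : (r • connMap g w ζ) v = r • ((show HomModel n from ζ).2 v
        + christoffelMap g w.proj (dproj w ζ) (w.snd v)) := rfl
      rw [h4, h5]
      refine (congrArg (_ + ·) h3).trans ?_
      exact (smul_add _ _ _).symm
    ext (i | p)
    · simp [h1]
    · simp [h2]

theorem GFM_eq (g : RMetric n M) (w : HomBundle n M) (ζ ζ' : TangentSpace (IHom n) w) :
    GFM g w ζ ζ' = ∑ c, frameCoords g w ζ c * frameCoords g w ζ' c :=
  (Fintype.sum_sum_type fun c => frameCoords g w ζ c * frameCoords g w ζ' c).symm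

theorem frameCoords_frameField {g : RMetric n M} {o : OrientationForm n M} {w : HomBundle n M}
    (hw : w ∈ FM g o) (c : FrameIdx n) :
    frameCoords g w (frameField g c w) = EuclideanSpace.single c 1 := by
  have key : ∀ a k, g.inner w.proj (ev w a) (ev w (e k)) = a k := fun a k => by
    rw [hw.1, inner_e]
  ext d
  rcases c with i | p
  · rcases d with j | q
    · refine (key (e i) j).trans ?_
      simp [e_apply, eq_comm]
    · have h : connMap g w (B g (e i) w) = 0 := by
        ext1 v
        exact neg_add_cancel (christoffelMap g w.proj (w.snd (e i)) (w.snd v))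
      have h2 : frameCoords g w (frameField g (Sum.inl i) w) (Sum.inr q) =
        g.inner w.proj (connMap g w (B g (e i) w) (e q.1.1)) (ev w (e q.1.2)) := rfl
      rw [h2, h]
      simp
  · rcases d with j | q
    · have h2 : frameCoords g w (frameField g (Sum.inr p) w) (Sum.inl j) =
        g.inner w.proj 0 (ev w (e j)) := rfl
      rw [h2]
      simp
    · have h : connMap g w (Y (omega p) w) (e q.1.1) = ev w (toEnd (omega p) (e q.1.1)) := by
        have : christoffelMap g w.proj 0 = 0 := (christoffelMap g w.proj).map_zero
        have h3 := congrArg (fun L : Eu n →L[ℝ] Eu n => L (w.snd (e q.1.1))) this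
        exact (congrArg (_ + ·) h3).trans (add_zero _)
      have h2 : frameCoords g w (frameField g (Sum.inr p) w) (Sum.inr q) =
        g.inner w.proj (connMap g w (Y (omega p) w) (e q.1.1)) (ev w (e q.1.2)) := rfl
      rw [h2, h, key, ← skewCoords_apply, skewCoords_toEnd]
      simp [omega_apply]

/-- The coframe of `FM` in a local parametrization. -/
def LocalParam.coframe {g : RMetric n M} {o : OrientationForm n M} (ψ : LocalParam g o)
    (y : ParamSpace n) : ParamSpace n →ₗ[ℝ] ParamSpace n :=
  (frameCoords g (ψ.toFun y)).comp
    (mfderiv 𝓘(ℝ, ParamSpace n) (IHom n) ψ.toFun y).toLinearMap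

/-- `G_FM` is the Euclidean product pulled back by the coframe, so its Gram matrix in coordinates is
`AᵀA` with `A` the matrix of the coframe, and `√det(AᵀA) = |det A|`. -/
theorem LocalParam.density_eq {g : RMetric n M} {o : OrientationForm n M} (ψ : LocalParam g o)
    (y : ParamSpace n) : ψ.density y = |LinearMap.det (ψ.coframe y)| := by
  set b := (EuclideanSpace.basisFun (Fin n ⊕ Pairs n) ℝ).toBasis
  set A := LinearMap.toMatrix b b (ψ.coframe y) with hA
  have h : (Matrix.of fun a b : Fin n ⊕ Pairs n => GFM g (ψ.toFun y)
      (mfderiv 𝓘(ℝ, ParamSpace n) (IHom n) ψ.toFun y (EuclideanSpace.single a 1))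
      (mfderiv 𝓘(ℝ, ParamSpace n) (IHom n) ψ.toFun y (EuclideanSpace.single b 1))) =
      A.transpose * A := by
    ext c d
    have hAc : ∀ k c, A k c = frameCoords g (ψ.toFun y)
        (mfderiv 𝓘(ℝ, ParamSpace n) (IHom n) ψ.toFun y (EuclideanSpace.single c 1)) k := by
      intro k c
      rw [hA, LinearMap.toMatrix_apply]
      simp only [b, OrthonormalBasis.coe_toBasis, EuclideanSpace.basisFun_apply,
        OrthonormalBasis.coe_toBasis_repr_apply, EuclideanSpace.basisFun_repr]
      rfl
    rw [Matrix.mul_apply, Matrix.of_apply, GFM_eq]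
    exact Finset.sum_congr rfl fun k _ => by rw [Matrix.transpose_apply, hAc, hAc]
  rw [LocalParam.density, h, Matrix.det_mul, Matrix.det_transpose, ← sq, Real.sqrt_sq_eq_abs, hA,
    LinearMap.det_toMatrix]

namespace FrameChart

variable {g : RMetric n M} {o : OrientationForm n M} (C : FrameChart g o)

/-- The frame, as a matrix. -/
def frameMap (y : ParamSpace n) : ParamSpace n →ₗ[ℝ] ParamSpace n :=
  ((EuclideanSpace.basisFun (FrameIdx n) ℝ).toBasis).constr ℝ fun c => C.field c y

theorem frameMap_single (y : ParamSpace n) (c : FrameIdx n) :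
    C.frameMap y (EuclideanSpace.single c 1) = C.field c y := by
  have := ((EuclideanSpace.basisFun (FrameIdx n) ℝ).toBasis).constr_basis ℝ (fun c => C.field c y) c
  rwa [OrthonormalBasis.coe_toBasis, EuclideanSpace.basisFun_apply] at this

theorem coframe_frameMap {y : ParamSpace n} (hy : y ∈ C.param.domain) :
    (C.param.coframe y).comp (C.frameMap y) = LinearMap.id := by
  refine ((EuclideanSpace.basisFun (FrameIdx n) ℝ).toBasis).ext fun c => ?_
  rw [OrthonormalBasis.coe_toBasis, EuclideanSpace.basisFun_apply, LinearMap.comp_apply,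
    LinearMap.id_apply, C.frameMap_single]
  have h := frameCoords_frameField (C.param_mem hy).1 c
  rw [← C.mfderiv_field c y hy] at h
  exact h

theorem det_coframe {y : ParamSpace n} (hy : y ∈ C.param.domain) :
    LinearMap.det (C.param.coframe y) * LinearMap.det (C.frameMap y) = 1 := by
  rw [← LinearMap.det_comp, C.coframe_frameMap hy, LinearMap.det_id]

theorem density_eq {y : ParamSpace n} (hy : y ∈ C.param.domain) :
    C.param.density y = |LinearMap.det (C.frameMap y)|⁻¹ := by
  rw [LocalParam.density_eq, ← abs_inv]
  congr 1
  exact eq_inv_of_mul_eq_one_left (C.det_coframe hy)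

theorem det_frameMap_ne_zero {y : ParamSpace n} (hy : y ∈ C.param.domain) :
    LinearMap.det (C.frameMap y) ≠ 0 := right_ne_zero_of_mul_eq_one (C.det_coframe hy)

/-- The frame in a frame chart, as a basis. -/
def fieldBasis {y : ParamSpace n} (hy : y ∈ C.param.domain) :
    Module.Basis (FrameIdx n) ℝ (ParamSpace n) :=
  ((EuclideanSpace.basisFun (FrameIdx n) ℝ).toBasis).map
    (LinearMap.equivOfDetNeZero (C.frameMap y) (C.det_frameMap_ne_zero hy))

theorem fieldBasis_apply {y : ParamSpace n} (hy : y ∈ C.param.domain) (c : FrameIdx n) :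
    C.fieldBasis hy c = C.field c y := by
  rw [← frameMap_single, fieldBasis, Module.Basis.map_apply]
  simp

theorem det_frameMap (y : ParamSpace n) :
    LinearMap.det (C.frameMap y) =
      (EuclideanSpace.basisFun (FrameIdx n) ℝ).toBasis.det fun c => C.field c y := by
  set b := (EuclideanSpace.basisFun (FrameIdx n) ℝ).toBasis
  have h := b.det_comp (C.frameMap y) b
  rw [b.det_self, mul_one] at h
  rw [← h]
  congr 1
  funext c
  simp [b, frameMap_single]

/-- A basis determinant, as a continuous multilinear map. -/
def detCLM (n : ℕ) : ContinuousMultilinearMap ℝ (fun _ : FrameIdx n => ParamSpace n) ℝ :=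
  { (EuclideanSpace.basisFun (FrameIdx n) ℝ).toBasis.det.toMultilinearMap with
    cont := by
      refine Continuous.matrix_det (A := fun v : FrameIdx n → ParamSpace n =>
        (EuclideanSpace.basisFun (FrameIdx n) ℝ).toBasis.toMatrix v) ?_
      refine continuous_matrix fun i j => ?_
      simp only [Module.Basis.toMatrix_apply, OrthonormalBasis.coe_toBasis_repr_apply,
        EuclideanSpace.basisFun_repr]
      exact (EuclideanSpace.proj (𝕜 := ℝ) i).continuous.comp (continuous_apply j) }

theorem detCLM_apply (v : FrameIdx n → ParamSpace n) :
    detCLM n v = (EuclideanSpace.basisFun (FrameIdx n) ℝ).toBasis.det v := rfl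

theorem contDiffOn_det_frameMap :
    ContDiffOn ℝ ∞ (fun y => LinearMap.det (C.frameMap y)) C.param.domain := by
  simp_rw [det_frameMap, ← detCLM_apply]
  exact (detCLM n).contDiff.comp_contDiffOn (contDiffOn_pi.2 C.contDiffOn_field)

end FrameChart

/-- Derivations along the frame, in a frame chart. -/
theorem der_param {V : Type*} [NormedAddCommGroup V] [NormedSpace ℝ V] {g : RMetric n M}
    {o : OrientationForm n M} (C : FrameChart g o) {f : HomBundle n M → V}
    (hf : ContMDiffOn (IHom n) 𝓘(ℝ, V) ∞ f (FM g o)) {y : ParamSpace n} (hy : y ∈ C.param.domain)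
    (c : FrameIdx n) :
    der g o (frameField g c) f (C.param.toFun y) = fderiv ℝ (f ∘ C.param.toFun) y (C.field c y) := by
  have ho := C.param.isOpen_domain.mem_nhds hy
  -- `FM` has positive codimension in general, so a derivative within it need not be unique in the
  -- ambient space. Any such derivative composed with the parametrization is the derivative on an
  -- open set, which is unique.
  have h1 := ((hf _ (C.param_mem hy).1).mdifferentiableWithinAt (by simp)).hasMFDerivWithinAt
  have h2 := (C.mdifferentiableAt_param hy).hasMFDerivAt.hasMFDerivWithinAt (s := C.param.domain)
  have h3 := (h1.comp y h2 fun y hy => (C.param_mem hy).1).hasMFDerivAt ho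
  have h4 : HasFDerivAt (f ∘ C.param.toFun) (show ParamSpace n →L[ℝ] V from
      (mfderivWithin (IHom n) 𝓘(ℝ, V) f (FM g o) (C.param.toFun y)).comp
        (mfderiv 𝓘(ℝ, ParamSpace n) (IHom n) C.param.toFun y)) y :=
    hasMFDerivAt_iff_hasFDerivAt.1 h3
  rw [h4.fderiv, der, ← C.mfderiv_field c y hy]
  rfl

theorem contDiffOn_comp_param {V : Type*} [NormedAddCommGroup V] [NormedSpace ℝ V]
    {g : RMetric n M} {o : OrientationForm n M} (C : FrameChart g o) {f : HomBundle n M → V}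
    (hf : ContMDiffOn (IHom n) 𝓘(ℝ, V) ∞ f (FM g o)) :
    ContDiffOn ℝ ∞ (f ∘ C.param.toFun) C.param.domain :=
  (hf.comp C.param.contMDiffOn fun _ hy => (C.param_mem hy).1).contDiffOn

theorem contDiffOn_fderiv_comp_param {V : Type*} [NormedAddCommGroup V] [NormedSpace ℝ V]
    {g : RMetric n M} {o : OrientationForm n M} (C : FrameChart g o) {f : HomBundle n M → V}
    (hf : ContMDiffOn (IHom n) 𝓘(ℝ, V) ∞ f (FM g o)) (c : FrameIdx n) :
    ContDiffOn ℝ ∞ (fun y => fderiv ℝ (f ∘ C.param.toFun) y (C.field c y)) C.param.domain :=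
  ((contDiffOn_comp_param C hf).fderiv_of_isOpen C.param.isOpen_domain (by simp)).clm_apply
    (C.contDiffOn_field c)

/-- Derivatives of smooth functions along the frame are smooth. -/
theorem contMDiffOn_der {V : Type*} [NormedAddCommGroup V] [NormedSpace ℝ V]
    {g : RMetric n M} {o : OrientationForm n M} {f : HomBundle n M → V}
    (hf : ContMDiffOn (IHom n) 𝓘(ℝ, V) ∞ f (FM g o)) (c : FrameIdx n) :
    ContMDiffOn (IHom n) 𝓘(ℝ, V) ∞ (der g o (frameField g c) f) (FM g o) := by
  intro w hw
  obtain ⟨C, hC⟩ := exists_frameChart hw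
  have h1 : ContMDiffOn (IHom n) 𝓘(ℝ, V) ∞
      ((fun y => fderiv ℝ (f ∘ C.param.toFun) y (C.field c y)) ∘ C.inv) (FM g o ∩ C.nhd) :=
    (contDiffOn_fderiv_comp_param C hf c).contMDiffOn.comp
      (C.contMDiffOn_inv.mono inter_subset_right) fun w hw => C.inv_mem hw
  have h2 : ContMDiffOn (IHom n) 𝓘(ℝ, V) ∞ (der g o (frameField g c) f) (FM g o ∩ C.nhd) :=
    h1.congr fun w hw => by
      conv_lhs => rw [← C.param_inv hw]
      exact der_param C hf (C.inv_mem hw) c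
  exact (h2 w ⟨hw, hC⟩).mono_of_mem_nhdsWithin
    (inter_mem self_mem_nhdsWithin (mem_nhdsWithin_of_mem_nhds (C.isOpen_nhd.mem_nhds hC)))

/-- The commutators of the derivatives along the frame. -/
theorem der_comm {V : Type*} [NormedAddCommGroup V] [NormedSpace ℝ V]
    {g : RMetric n M} {o : OrientationForm n M} {f : HomBundle n M → V}
    (hf : ContMDiffOn (IHom n) 𝓘(ℝ, V) ∞ f (FM g o)) {w : HomBundle n M} (hw : w ∈ FM g o)
    (c d : FrameIdx n) :
    der g o (frameField g c) (der g o (frameField g d) f) w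
      - der g o (frameField g d) (der g o (frameField g c) f) w =
      ∑ k, structCoeff g w c d k • der g o (frameField g k) f w := by
  obtain ⟨C, hC⟩ := exists_frameChart hw
  obtain ⟨y, hy, rfl⟩ : ∃ y ∈ C.param.domain, C.param.toFun y = w :=
    ⟨C.inv w, C.inv_mem ⟨hw, hC⟩, C.param_inv ⟨hw, hC⟩⟩
  have ho := C.param.isOpen_domain.mem_nhds hy
  have hdd : ∀ c d, der g o (frameField g c) (der g o (frameField g d) f) (C.param.toFun y) =
      fderiv ℝ (fun y => fderiv ℝ (f ∘ C.param.toFun) y (C.field d y)) y (C.field c y) :=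
    fun c d => by
      rw [der_param C (contMDiffOn_der hf d) hy]
      congr 1
      refine EventuallyEq.fderiv_eq ?_
      filter_upwards [ho] with y hy using der_param C hf hy d
  rw [hdd, hdd, ← VectorField.fderiv_apply_lieBracket
    ((contDiffOn_comp_param C hf).contDiffAt ho)
    (by simp; exact WithTop.coe_le_coe.2 le_top)
    (((C.contDiffOn_field d).contDiffAt ho).differentiableAt (by simp))
    (((C.contDiffOn_field c).contDiffAt ho).differentiableAt (by simp)), C.lieBracket_field hy,
    map_sum]
  refine Finset.sum_congr rfl fun k _ => ?_
  rw [map_smul, der_param C hf hy]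

end Frames

/-! ### The Liouville measure: local description, compactness of $FM$, finiteness. -/

section Frames

variable {n : ℕ} {M : Type*} [TopologicalSpace M] [ChartedSpace (Eu n) M]
  [IsManifold (𝓡 n) ∞ M] {g : RMetric n M} {o : OrientationForm n M}

namespace LocalParam

/-- The volume measure of `FM` on the image of a local parametrization. -/
def measure (ψ : LocalParam g o) : Measure (HomBundle n M) :=
  ((volume.restrict ψ.domain).withDensity fun y => ENNReal.ofReal (ψ.density y)).map ψ.toFun

theorem measure_le (ψ : LocalParam g o) : ψ.measure ≤ liouville g o :=
  le_iSup (fun ψ : LocalParam g o => ψ.measure) ψ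

theorem measurableSet_preimage (ψ : LocalParam g o) {S : Set (HomBundle n M)}
    (hS : MeasurableSet S) : MeasurableSet (ψ.domain ∩ ψ.toFun ⁻¹' S) := by
  have h1 : Measurable (ψ.domain.domRestrict ψ.toFun) :=
    (continuousOn_iff_continuous_domRestrict.1 ψ.contMDiffOn.continuousOn).measurable
  have h2 := ψ.isOpen_domain.measurableSet.subtype_image (h1 hS)
  convert h2 using 1
  ext y
  simp only [mem_inter_iff, mem_preimage, mem_image, Subtype.exists, exists_and_right,
    exists_eq_right]
  exact ⟨fun h => ⟨h.1, h.2⟩, fun ⟨h1, h2⟩ => ⟨h1, h2⟩⟩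

theorem aemeasurable_toFun (ψ : LocalParam g o) :
    AEMeasurable ψ.toFun
      ((volume.restrict ψ.domain).withDensity fun y => ENNReal.ofReal (ψ.density y)) :=
  (ψ.contMDiffOn.continuousOn.aemeasurable ψ.isOpen_domain.measurableSet).mono_ac
    (withDensity_absolutelyContinuous _ _)

theorem measure_apply (ψ : LocalParam g o) {S : Set (HomBundle n M)} (hS : MeasurableSet S) :
    ψ.measure S = ∫⁻ y in ψ.domain ∩ ψ.toFun ⁻¹' S, ENNReal.ofReal (ψ.density y) := by
  rw [measure, Measure.map_apply_of_aemeasurable ψ.aemeasurable_toFun hS, withDensity_apply',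
    Measure.restrict_restrict' ψ.isOpen_domain.measurableSet, inter_comm]

theorem contDiffOn_inv_comp (ψ : LocalParam g o) (C : FrameChart g o) :
    ContDiffOn ℝ ∞ (C.inv ∘ ψ.toFun) (ψ.domain ∩ ψ.toFun ⁻¹' C.nhd) :=
  (C.contMDiffOn_inv.comp (ψ.contMDiffOn.mono inter_subset_left) fun _ hy => hy.2).contDiffOn

theorem isOpen_preimage_nhd (ψ : LocalParam g o) (C : FrameChart g o) :
    IsOpen (ψ.domain ∩ ψ.toFun ⁻¹' C.nhd) :=
  ψ.contMDiffOn.continuousOn.isOpen_inter_preimage ψ.isOpen_domain C.isOpen_nhd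

/-- Chain rule for `ψ = C.param ∘ (C.inv ∘ ψ)`. It yields the Jacobian relation between densities,
hence the independence of the measure from the parametrization. -/
theorem coframe_eq (ψ : LocalParam g o) (C : FrameChart g o) {y : ParamSpace n}
    (hy : y ∈ ψ.domain ∩ ψ.toFun ⁻¹' C.nhd) :
    ψ.coframe y = (C.param.coframe (C.inv (ψ.toFun y))).comp
      (fderiv ℝ (C.inv ∘ ψ.toFun) y).toLinearMap := by
  have ho := (ψ.isOpen_preimage_nhd C).mem_nhds hy
  have hd := ((ψ.contDiffOn_inv_comp C).contDiffAt ho).differentiableAt (by simp)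
  have hF := fun y (hy : y ∈ ψ.domain ∩ ψ.toFun ⁻¹' C.nhd) =>
    (⟨ψ.mapsTo hy.1, hy.2⟩ : ψ.toFun y ∈ FM g o ∩ C.nhd)
  have hev : C.param.toFun ∘ (C.inv ∘ ψ.toFun) =ᶠ[𝓝 y] ψ.toFun := by
    filter_upwards [ho] with y hy using C.param_inv (hF y hy)
  have h := mfderiv_comp (I' := 𝓘(ℝ, ParamSpace n)) (I'' := IHom n) y
    (C.mdifferentiableAt_param (C.inv_mem (hF y hy))) hd.mdifferentiableAt
  rw [hev.mfderiv_eq, mfderiv_eq_fderiv] at h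
  have key : ∀ w' w : HomBundle n M, w' = w → ∀ ζ : HomModel n,
      frameCoords g w (show TangentSpace (IHom n) w from ζ) =
        frameCoords g w' (show TangentSpace (IHom n) w' from ζ) := by
    rintro w' w rfl ζ; rfl
  ext1 v
  have h2 := congrArg (fun L => L v) h
  have h3 : ψ.coframe y v = frameCoords g (ψ.toFun y)
    (mfderiv 𝓘(ℝ, ParamSpace n) (IHom n) ψ.toFun y v) := rfl
  rw [h3]
  exact (congrArg (frameCoords g (ψ.toFun y)) h2).trans (key _ _ (C.param_inv (hF y hy)) _)

theorem density_eq_mul (ψ : LocalParam g o) (C : FrameChart g o) {y : ParamSpace n}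
    (hy : y ∈ ψ.domain ∩ ψ.toFun ⁻¹' C.nhd) :
    ψ.density y = |(fderiv ℝ (C.inv ∘ ψ.toFun) y).det| * C.param.density (C.inv (ψ.toFun y)) := by
  rw [density_eq, density_eq, ψ.coframe_eq C hy, LinearMap.det_comp, abs_mul, mul_comm]

/-- On the domain of a frame chart, the volume measures of all local parametrizations are bounded by
the one of this frame chart. -/
theorem measure_le_of_subset (ψ : LocalParam g o) (C : FrameChart g o) {S : Set (HomBundle n M)}
    (hS : MeasurableSet S) (hSn : S ⊆ C.nhd) : ψ.measure S ≤ C.param.measure S := by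
  rw [measure_apply _ hS, measure_apply _ hS]
  set s := ψ.domain ∩ ψ.toFun ⁻¹' S
  have hs : MeasurableSet s := ψ.measurableSet_preimage hS
  have hsub : s ⊆ ψ.domain ∩ ψ.toFun ⁻¹' C.nhd := fun y hy => ⟨hy.1, hSn hy.2⟩
  have hF : ∀ y ∈ s, ψ.toFun y ∈ FM g o ∩ C.nhd := fun y hy => ⟨ψ.mapsTo hy.1, hSn hy.2⟩
  have hinj : InjOn (C.inv ∘ ψ.toFun) s := fun y hy y' hy' h =>
    ψ.injOn hy.1 hy'.1 (by rw [← C.param_inv (hF y hy), ← C.param_inv (hF y' hy')]; exact congrArg _ h)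
  have h := lintegral_image_eq_lintegral_abs_det_fderiv_mul volume hs (f := C.inv ∘ ψ.toFun)
    (f' := fderiv ℝ (C.inv ∘ ψ.toFun)) (fun y hy =>
      (((ψ.contDiffOn_inv_comp C).contDiffAt ((ψ.isOpen_preimage_nhd C).mem_nhds
        (hsub hy))).differentiableAt (by simp)).hasFDerivAt.hasFDerivWithinAt) hinj
    (fun y => ENNReal.ofReal (C.param.density y))
  have h2 : ∫⁻ y in s, ENNReal.ofReal (ψ.density y) =
      ∫⁻ y in s, ENNReal.ofReal |(fderiv ℝ (C.inv ∘ ψ.toFun) y).det| *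
        ENNReal.ofReal (C.param.density ((C.inv ∘ ψ.toFun) y)) :=
    setLIntegral_congr_fun hs fun y hy => by
      rw [ψ.density_eq_mul C (hsub hy), ENNReal.ofReal_mul (abs_nonneg _)]
      rfl
  rw [h2, ← h]
  refine lintegral_mono_set ?_
  rintro _ ⟨y, hy, rfl⟩
  refine ⟨C.inv_mem (hF y hy), ?_⟩
  rw [mem_preimage, Function.comp_apply, C.param_inv (hF y hy)]
  exact hy.2

end LocalParam

/-- The Liouville measure on the domain of a frame chart. -/
theorem liouville_restrict_nhd (C : FrameChart g o) :
    (liouville g o).restrict C.nhd = C.param.measure := by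
  have hn := C.isOpen_nhd.measurableSet
  have hc : C.param.measure.restrict C.nhd = C.param.measure := by
    refine Measure.restrict_eq_self_of_ae_mem ?_
    rw [ae_iff]
    have h : {w | w ∉ C.nhd} = C.nhdᶜ := rfl
    rw [h, C.param.measure_apply hn.compl]
    have : C.param.domain ∩ C.param.toFun ⁻¹' C.nhdᶜ = ∅ := by
      ext y
      simp only [mem_inter_iff, mem_preimage, mem_compl_iff, mem_empty_iff_false, iff_false, not_and,
        not_not]
      exact fun hy => (C.param_mem hy).2
    rw [this]
    simp
  -- The right side bounds the measure of every parametrization: inside `C.nhd` by the change of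
  -- variables, outside by the supremum itself. Hence it bounds their supremum.
  have hle : liouville g o ≤ C.param.measure + (liouville g o).restrict C.nhdᶜ := by
    refine iSup_le fun ψ => ?_
    change ψ.measure ≤ _
    rw [← Measure.restrict_add_restrict_compl (μ := ψ.measure) hn]
    refine add_le_add ?_ (Measure.restrict_mono le_rfl ψ.measure_le)
    refine Measure.le_iff.2 fun S hS => ?_
    rw [Measure.restrict_apply hS]
    exact (ψ.measure_le_of_subset C (hS.inter hn) inter_subset_right).trans
      (measure_mono inter_subset_left)
  refine le_antisymm ?_ ?_
  · refine (Measure.restrict_mono le_rfl hle).trans ?_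
    rw [Measure.restrict_add, hc, Measure.restrict_restrict hn, inter_compl_self]
    simp
  · rw [← hc]
    exact Measure.restrict_mono le_rfl C.param.measure_le

/-- Points over the same base point are separated in a common chart, the others by their
projections. It makes the compact set `FM` closed, hence measurable. -/
instance [T2Space M] : T2Space (HomBundle n M) := by
  refine ⟨fun w w' hne => ?_⟩
  by_cases h : w.proj = w'.proj
  · set x := w.proj
    have hs : w ∈ (homChart x).source := mem_homChart_source w
    have hs' : w' ∈ (homChart x).source := by
      rw [h]; exact mem_homChart_source w'
    have hc : homChart x w ≠ homChart x w' := fun h' => hne ((homChart x).injOn hs hs' h')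
    obtain ⟨U, V, hU, hV, h1, h2, h3⟩ := t2_separation hc
    have hcont := (contMDiffOn_homChart (n := n) x).continuousOn
    refine ⟨_, _, hcont.isOpen_inter_preimage (isOpen_homChart_source x) hU,
      hcont.isOpen_inter_preimage (isOpen_homChart_source x) hV, ⟨hs, h1⟩, ⟨hs', h2⟩, ?_⟩
    exact (h3.preimage _).mono inter_subset_right inter_subset_right
  · obtain ⟨U, V, hU, hV, h1, h2, h3⟩ := t2_separation h
    have hcont : Continuous (Bundle.TotalSpace.proj : HomBundle n M → M) :=
      FiberBundle.continuous_proj _ _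
    exact ⟨_, _, hU.preimage hcont, hV.preimage hcont, h1, h2, h3.preimage _⟩

/-- The minimum of the positive continuous function `g(a, a)` over `K` times the unit sphere,
extended by homogeneity. -/
theorem exists_metricChart_lower_bound (g : RMetric n M) (x : M) {K : Set (Eu n)} (hK : IsCompact K)
    (hKt : K ⊆ (extChartAt (𝓡 n) x).target) :
    ∃ c, 0 < c ∧ ∀ y ∈ K, ∀ a, c * ‖a‖ ^ 2 ≤ metricChart g x y a a := by
  have hc : ContinuousOn (fun q : Eu n × Eu n => metricChart g x q.1 q.2 q.2)
      (K ×ˢ Metric.sphere (0 : Eu n) 1) := by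
    have h1 : ContinuousOn (fun q : Eu n × Eu n => metricChart g x q.1)
        (K ×ˢ Metric.sphere (0 : Eu n) 1) :=
      ((contDiffOn_metricChart g x).continuousOn.mono hKt).comp continuous_fst.continuousOn
        fun q hq => hq.1
    exact (h1.clm_apply continuous_snd.continuousOn).clm_apply continuous_snd.continuousOn
  obtain ⟨c, hc0, hcle⟩ := (hK.prod (isCompact_sphere (0 : Eu n) 1)).exists_forall_le' hc (a := 0)
    (fun q hq => metricChart_pos g (hKt hq.1) (by
      intro h0
      have := hq.2
      rw [h0] at this
      simp at this))
  refine ⟨c, hc0, fun y hy a => ?_⟩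
  by_cases ha : a = 0
  · simp [ha]
  have hn : ‖a‖ ≠ 0 := norm_ne_zero_iff.2 ha
  have := hcle (y, ‖a‖⁻¹ • a) ⟨hy, by simp [norm_smul, hn]⟩
  simp only [map_smul, smul_apply, smul_eq_mul] at this
  have h2 : 0 < ‖a‖ ^ 2 := by positivity
  calc c * ‖a‖ ^ 2 ≤ (‖a‖⁻¹ * (‖a‖⁻¹ * metricChart g x y a a)) * ‖a‖ ^ 2 :=
        mul_le_mul_of_nonneg_right this h2.le
    _ = _ := by field_simp

/-- In the chart an isometry satisfies `c‖Aa‖² ≤ g(Aa, Aa) = ‖a‖²`, so it is bounded by `1 / √c`.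
The remaining conditions are closed: the strict sign may be relaxed to `≥ 0` by `form_ne_zero`. -/
theorem isCompact_FM_inter [T2Space M] {x : M} {K : Set M} (hK : IsCompact K)
    (hKs : K ⊆ (extChartAt (𝓡 n) x).source) :
    IsCompact (FM g o ∩ Bundle.TotalSpace.proj ⁻¹' K) := by
  set K' := extChartAt (𝓡 n) x '' K with hK'
  have hK'c : IsCompact K' := hK.image_of_continuousOn ((continuousOn_extChartAt x).mono hKs)
  have hK't : K' ⊆ (extChartAt (𝓡 n) x).target := by
    rintro _ ⟨p, hp, rfl⟩
    exact (extChartAt (𝓡 n) x).map_source (hKs hp)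
  obtain ⟨c, hc0, hc⟩ := exists_metricChart_lower_bound g x hK'c hK't
  set D : Set (HomModel n) := K' ×ˢ Metric.closedBall 0 (√c)⁻¹ with hD
  have hDc : IsCompact D := hK'c.prod (isCompact_closedBall _ _)
  have hDt : D ⊆ (homChart x).target := fun z hz => by
    rw [homChart_target]; exact ⟨hK't hz.1, mem_univ _⟩
  set Z : Set (HomModel n) := (D ∩ pullForm g x ⁻¹' {.id ℝ (Eu n)}) ∩
    (D ∩ signModel o x ⁻¹' Ici 0) with hZ
  have hZc : IsCompact Z := by
    refine hDc.of_isClosed_subset (IsClosed.inter ?_ ?_) fun z hz => hz.1.1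
    · exact ((contDiffOn_pullForm g x).continuousOn.mono hDt).preimage_isClosed_of_isClosed
        hDc.isClosed isClosed_singleton
    · exact ((continuousOn_signModel o x).mono hDt).preimage_isClosed_of_isClosed
        hDc.isClosed isClosed_Ici
  have hZt : Z ⊆ (homChart x).target := fun z hz => hDt hz.1.1
  convert hZc.image_of_continuousOn ((contMDiffOn_homChart_symm x).continuousOn.mono hZt) using 1
  refine Subset.antisymm ?_ ?_
  · rintro w ⟨hwF, hwK⟩
    have hw : w ∈ (homChart x).source := by
      rw [homChart_source]; exact hKs hwK
    obtain ⟨hi, hσ⟩ := (mem_FM_iff hw).1 hwF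
    have hDw : homChart x w ∈ D := by
      have h1 : (homChart x w).1 ∈ K' := by
        rw [homChart_apply hw]; exact mem_image_of_mem _ hwK
      refine ⟨h1, ?_⟩
      rw [mem_closedBall_zero_iff]
      refine ContinuousLinearMap.opNorm_le_bound _ (by positivity) fun a => ?_
      have h2 := hc _ h1 ((homChart x w).2 a)
      have h3 := hi a a
      rw [pullMetric] at h3
      rw [h3, real_inner_self_eq_norm_sq] at h2
      have hsc : 0 < √c := Real.sqrt_pos.2 hc0
      rw [← div_eq_inv_mul, le_div_iff₀ hsc]
      refine le_of_sq_le_sq ?_ (norm_nonneg _)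
      rw [mul_pow, Real.sq_sqrt hc0.le]
      linarith
    exact ⟨homChart x w, ⟨⟨hDw, mem_isomModel_iff_pullForm.1 hi⟩, hDw, hσ.le⟩,
      (homChart x).left_inv hw⟩
  · rintro _ ⟨z, hz, rfl⟩
    have hw := (homChart (n := n) x).map_target (hZt hz)
    have hr := (homChart (n := n) x).right_inv (hZt hz)
    refine ⟨?_, ?_⟩
    · have hi : z ∈ isomModel g x := mem_isomModel_iff_pullForm.2 hz.1.2
      refine (mem_FM_iff hw).2 ⟨by rwa [hr], ?_⟩
      have hne := form_ne_zero (g := g) o (w := (homChart x).symm z) fun a b => by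
        rw [inner_eq_metricChart g hw, hr]; exact hi a b
      rw [form_eq_signModel o hw] at hne
      refine lt_of_le_of_ne ?_ hne.symm
      rw [hr]; exact hz.2.2
    · rw [mem_preimage, homChart_symm_proj (hZt hz)]
      obtain ⟨p, hp, hpz⟩ := hz.1.1.1
      rw [← hpz, (extChartAt (𝓡 n) x).left_inv (hKs hp)]
      exact hp

theorem isCompact_FM [T2Space M] [CompactSpace M] (g : RMetric n M) (o : OrientationForm n M) :
    IsCompact (FM g o) := by
  have h : ∃ T, IsCompact T ∧ FM g o ∩ Bundle.TotalSpace.proj ⁻¹' (univ : Set M) ⊆ T ∧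
      T ⊆ FM g o := by
    refine isCompact_univ.induction_on (p := fun s : Set M => ∃ T, IsCompact T ∧
      FM g o ∩ Bundle.TotalSpace.proj ⁻¹' s ⊆ T ∧ T ⊆ FM g o)
      ⟨∅, isCompact_empty, by simp, by simp⟩ ?_ ?_ ?_
    · rintro s t hst ⟨T, h1, h2, h3⟩
      exact ⟨T, h1, (inter_subset_inter_right _ (preimage_mono hst)).trans h2, h3⟩
    · rintro s t ⟨T, h1, h2, h3⟩ ⟨T', h1', h2', h3'⟩
      refine ⟨T ∪ T', h1.union h1', ?_, union_subset h3 h3'⟩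
      rw [preimage_union, inter_union_distrib_left]
      exact union_subset_union h2 h2'
    · intro x _
      obtain ⟨K, hK, hxK, hKs⟩ := exists_compact_subset (isOpen_extChartAt_source (I := 𝓡 n) x)
        (mem_extChartAt_source x)
      exact ⟨K, mem_nhdsWithin_of_mem_nhds (mem_interior_iff_mem_nhds.1 hxK), _,
        isCompact_FM_inter hK hKs, subset_rfl, inter_subset_left⟩
  obtain ⟨T, h1, h2, h3⟩ := h
  rw [preimage_univ, inter_univ] at h2
  rwa [h2.antisymm h3]

/-- Each parametrization has its image in `FM`, so the restriction of the supremum to `FM` is still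
an upper bound. -/
theorem liouville_compl_FM [T2Space M] [CompactSpace M] (g : RMetric n M)
    (o : OrientationForm n M) : liouville g o (FM g o)ᶜ = 0 := by
  have hF := (isCompact_FM g o).isClosed.measurableSet
  have hle : liouville g o ≤ (liouville g o).restrict (FM g o) := by
    refine iSup_le fun ψ => ?_
    change ψ.measure ≤ _
    have hc : ψ.measure.restrict (FM g o) = ψ.measure := by
      refine Measure.restrict_eq_self_of_ae_mem ?_
      rw [ae_iff]
      have h : {w | w ∉ FM g o} = (FM g o)ᶜ := rfl
      rw [h, ψ.measure_apply hF.compl]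
      have : ψ.domain ∩ ψ.toFun ⁻¹' (FM g o)ᶜ = ∅ := by
        ext y
        simp only [mem_inter_iff, mem_preimage, mem_compl_iff, mem_empty_iff_false, iff_false,
          not_and, not_not]
        exact fun hy => ψ.mapsTo hy
      rw [this]
      simp
    rw [← hc]
    exact Measure.restrict_mono le_rfl ψ.measure_le
  have := Measure.le_iff.1 hle _ hF.compl
  rw [Measure.restrict_apply hF.compl, compl_inter_self, measure_empty] at this
  exact le_antisymm this bot_le

theorem FrameChart.continuousOn_density (C : FrameChart g o) :
    ContinuousOn C.param.density C.param.domain := by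
  have h : ContinuousOn (fun y => |LinearMap.det (C.frameMap y)|⁻¹) C.param.domain :=
    C.contDiffOn_det_frameMap.continuousOn.abs.inv₀ fun y hy =>
      abs_ne_zero.2 (C.det_frameMap_ne_zero hy)
  exact h.congr fun y hy => C.density_eq hy

/-- `FM` is compact, and near each of its points the measure is a continuous density over a bounded
ball in a frame chart. -/
instance [T2Space M] [CompactSpace M] : IsFiniteMeasure (liouville g o) := by
  have hF : liouville g o (FM g o) < ⊤ := by
    refine (isCompact_FM g o).measure_lt_top_of_nhdsWithin fun w hw => ?_
    obtain ⟨C, hC⟩ := exists_frameChart hw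
    have hy := C.inv_mem ⟨hw, hC⟩
    obtain ⟨r, hr, hball⟩ := Metric.nhds_basis_closedBall.mem_iff.1
      (C.param.isOpen_domain.mem_nhds hy)
    have hWo := C.contMDiffOn_inv.continuousOn.isOpen_inter_preimage C.isOpen_nhd
      (Metric.isOpen_ball (x := C.inv w) (ε := r))
    refine ⟨_, mem_nhdsWithin_of_mem_nhds (hWo.mem_nhds ⟨hC, Metric.mem_ball_self hr⟩), ?_⟩
    have h1 : liouville g o (C.nhd ∩ C.inv ⁻¹' Metric.ball (C.inv w) r) =
        C.param.measure (C.nhd ∩ C.inv ⁻¹' Metric.ball (C.inv w) r) := by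
      rw [← liouville_restrict_nhd, Measure.restrict_eq_self _ inter_subset_left]
    rw [h1, C.param.measure_apply hWo.measurableSet]
    have h2 : C.param.domain ∩ C.param.toFun ⁻¹' (C.nhd ∩ C.inv ⁻¹' Metric.ball (C.inv w) r) ⊆
        Metric.closedBall (C.inv w) r := by
      rintro y ⟨hy, -, hy2⟩
      rw [mem_preimage, C.inv_param y hy] at hy2
      exact Metric.ball_subset_closedBall hy2
    refine (lintegral_mono_set h2).trans_lt ?_
    exact ((C.continuousOn_density.mono hball).integrableOn_compact
      (isCompact_closedBall _ _)).lintegral_lt_top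
  refine ⟨?_⟩
  rw [← union_compl_self (FM g o)]
  exact (measure_union_le _ _).trans_lt (by rw [liouville_compl_FM, add_zero]; exact hF)

theorem ae_mem_FM [T2Space M] [CompactSpace M] (g : RMetric n M) (o : OrientationForm n M) :
    ∀ᵐ w ∂(liouville g o), w ∈ FM g o := liouville_compl_FM g o

theorem aestronglyMeasurable_of_continuousOn [T2Space M] [CompactSpace M] {V : Type*}
    [NormedAddCommGroup V] [SecondCountableTopology V] {f : HomBundle n M → V}
    (hf : ContinuousOn f (FM g o)) : AEStronglyMeasurable f (liouville g o) := by
  have h := hf.aestronglyMeasurable (μ := liouville g o) (isCompact_FM g o).isClosed.measurableSet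
  rwa [Measure.restrict_eq_self_of_ae_mem (ae_mem_FM g o)] at h

theorem memLp_of_continuousOn [T2Space M] [CompactSpace M] {V : Type*}
    [NormedAddCommGroup V] [SecondCountableTopology V] {f : HomBundle n M → V}
    (hf : ContinuousOn f (FM g o)) (p : ENNReal) : MemLp f p (liouville g o) := by
  obtain ⟨c, hc⟩ := (isCompact_FM g o).exists_bound_of_continuousOn hf
  refine MemLp.of_bound (aestronglyMeasurable_of_continuousOn hf) c ?_
  filter_upwards [ae_mem_FM g o] with w hw using hc w hw

/-- Integrals of functions carried by the domain of a frame chart. -/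
theorem integral_eq_of_frameChart [T2Space M] [CompactSpace M] {V : Type*}
    [NormedAddCommGroup V] [NormedSpace ℝ V] [SecondCountableTopology V] {f : HomBundle n M → V}
    (hf : ContinuousOn f (FM g o)) (C : FrameChart g o) (h0 : ∀ w ∈ FM g o \ C.nhd, f w = 0) :
    ∫ w, f w ∂(liouville g o) =
      ∫ y in C.param.domain, C.param.density y • f (C.param.toFun y) := by
  have h1 : ∫ w in C.nhd, f w ∂(liouville g o) = ∫ w, f w ∂(liouville g o) := by
    refine setIntegral_eq_integral_of_ae_compl_eq_zero ?_
    filter_upwards [ae_mem_FM g o] with w hw hn using h0 w ⟨hw, hn⟩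
  have hm : AEStronglyMeasurable f C.param.measure :=
    (aestronglyMeasurable_of_continuousOn hf).mono_measure C.param.measure_le
  rw [← h1, liouville_restrict_nhd, LocalParam.measure,
    integral_map C.param.aemeasurable_toFun hm, integral_withDensity_eq_integral_toReal_smul₀]
  · refine setIntegral_congr_fun C.param.isOpen_domain.measurableSet fun y hy => ?_
    rw [ENNReal.toReal_ofReal]
    exact Real.sqrt_nonneg _
  · exact (C.continuousOn_density.aemeasurable C.param.isOpen_domain.measurableSet).ennreal_ofReal
  · exact ae_of_all _ fun _ => ENNReal.ofReal_lt_top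

end Frames

/-! ### Vanishing divergence of the frame and integration by parts in a chart. -/

theorem alternating_update_basis {ι E : Type*} [Fintype ι] [DecidableEq ι] [AddCommGroup E]
    [Module ℝ E] (b : Module.Basis ι ℝ E) (f : E [⋀^ι]→ₗ[ℝ] ℝ) (i : ι) (w : E) :
    f (Function.update b i w) = b.repr w i * f b := by
  conv_lhs => rw [← b.sum_repr w]
  rw [f.map_update_sum, Finset.sum_eq_single i]
  · rw [f.map_update_smul, Function.update_eq_self, smul_eq_mul]
  · intro k _ hk
    rw [f.map_update_smul, f.map_update_self b (Ne.symm hk), smul_zero]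
  · simp

theorem sum_repr_eq_trace {ι E : Type*} [Fintype ι] [DecidableEq ι] [AddCommGroup E]
    [Module ℝ E] (b : Module.Basis ι ℝ E) (A : E →ₗ[ℝ] E) :
    ∑ i, b.repr (A (b i)) i = LinearMap.trace ℝ E A := by
  rw [LinearMap.trace_eq_matrix_trace ℝ b, Matrix.trace]
  exact Finset.sum_congr rfl fun i _ => by rw [Matrix.diag_apply, LinearMap.toMatrix_apply]

/-- The integral of a partial derivative of a compactly supported function vanishes. -/
theorem integral_fderiv_eq_zero {E V : Type*} [NormedAddCommGroup E] [NormedSpace ℝ E]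
    [FiniteDimensional ℝ E] [MeasurableSpace E] [BorelSpace E] (μ : Measure E)
    [μ.IsAddHaarMeasure] [NormedAddCommGroup V] [NormedSpace ℝ V] {f : E → V}
    (hf : ContDiff ℝ 1 f) (hc : HasCompactSupport f) (v : E) : ∫ x, fderiv ℝ f x v ∂μ = 0 := by
  have hi : Integrable f μ := hf.continuous.integrable_of_hasCompactSupport hc
  have hi' : Integrable (fun x => fderiv ℝ f x v) μ :=
    ((hf.continuous_fderiv (by simp)).clm_apply continuous_const).integrable_of_hasCompactSupport
      (hc.fderiv_apply ℝ v)
  have h := integral_smul_fderiv_eq_neg_fderiv_smul_of_integrable (𝕜 := ℝ) (f := fun _ : E => (1 : ℝ))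
    (g := f) (v := v) (μ := μ) (by simp) (by simpa using hi') (by simpa using hi)
    (fun x _ => by fun_prop) (fun x _ => (hf.differentiable (by simp)) x)
  simpa using h

section Frames

variable {n : ℕ} {M : Type*} [TopologicalSpace M] [ChartedSpace (Eu n) M]
  [IsManifold (𝓡 n) ∞ M] {g : RMetric n M} {o : OrientationForm n M}

namespace FrameChart

variable (C : FrameChart g o)

/-- Jacobi's formula by columns. The derivative of column `b` along `field c` is the derivative of
`field c` along `field b` minus the bracket `[field b, field c]`. The former contributes the trace,
the latter the sum in `sum_structCoeff`, which is zero. -/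
theorem fderiv_det_frameMap {y : ParamSpace n} (hy : y ∈ C.param.domain) (c : FrameIdx n) :
    fderiv ℝ (fun y => LinearMap.det (C.frameMap y)) y (C.field c y) =
      LinearMap.trace ℝ _ (fderiv ℝ (C.field c) y).toLinearMap * LinearMap.det (C.frameMap y) := by
  have ho := C.param.isOpen_domain.mem_nhds hy
  have hd : ∀ b, DifferentiableAt ℝ (C.field b) y := fun b =>
    ((C.contDiffOn_field b).contDiffAt ho).differentiableAt (by simp)
  have h1 : HasFDerivAt (fun y => LinearMap.det (C.frameMap y))
      (((detCLM n).linearDeriv fun b => C.field b y).comp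
        (ContinuousLinearMap.pi fun b => fderiv ℝ (C.field b) y)) y := by
    simp_rw [det_frameMap, ← detCLM_apply]
    exact ((detCLM n).hasFDerivAt (fun b => C.field b y)).comp y
      (hasFDerivAt_pi.2 fun b => (hd b).hasFDerivAt)
  have hb : (fun b => C.field b y) = C.fieldBasis hy := funext fun b => (C.fieldBasis_apply hy b).symm
  rw [h1.fderiv, ContinuousLinearMap.comp_apply, ContinuousMultilinearMap.linearDeriv_apply,
    det_frameMap, hb, ← sum_repr_eq_trace (C.fieldBasis hy), Finset.sum_mul]
  have key : ∀ b, fderiv ℝ (C.field b) y (C.field c y) =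
      fderiv ℝ (C.field c) y (C.field b y) - ∑ k, structCoeff g (C.param.toFun y) b c k •
        C.field k y := fun b => by
    rw [← C.lieBracket_field hy, VectorField.lieBracket]
    abel
  have hrepr : ∀ b, (C.fieldBasis hy).repr (∑ k, structCoeff g (C.param.toFun y) b c k •
      C.field k y) b = structCoeff g (C.param.toFun y) b c b := fun b => by
    simp_rw [← C.fieldBasis_apply hy]
    rw [Module.Basis.repr_sum_self]
  have hterm : ∀ b, detCLM n (Function.update (C.fieldBasis hy) b
      (fderiv ℝ (C.field b) y (C.field c y))) =
      (C.fieldBasis hy).repr (fderiv ℝ (C.field c) y (C.fieldBasis hy b)) b *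
        (EuclideanSpace.basisFun (FrameIdx n) ℝ).toBasis.det (C.fieldBasis hy) -
      structCoeff g (C.param.toFun y) b c b *
        (EuclideanSpace.basisFun (FrameIdx n) ℝ).toBasis.det (C.fieldBasis hy) := fun b => by
    rw [detCLM_apply, alternating_update_basis, key, map_sub, Finsupp.sub_apply, hrepr, sub_mul,
      C.fieldBasis_apply]
  have hsum : ∑ b, structCoeff g (C.param.toFun y) b c b *
        (EuclideanSpace.basisFun (FrameIdx n) ℝ).toBasis.det (C.fieldBasis hy) = 0 := by
    rw [← Finset.sum_mul, sum_structCoeff, zero_mul]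
  refine (Finset.sum_congr rfl fun b _ => hterm b).trans ?_
  rw [Finset.sum_sub_distrib, hsum, sub_zero]
  rfl

theorem contDiffOn_density : ContDiffOn ℝ ∞ C.param.density C.param.domain := by
  refine ContDiffOn.congr (f := fun y => |LinearMap.det (C.frameMap y)|⁻¹) ?_
    fun y hy => C.density_eq hy
  refine ContDiffOn.inv (fun y hy => ?_) fun y hy => abs_ne_zero.2 (C.det_frameMap_ne_zero hy)
  exact (contDiffAt_abs (C.det_frameMap_ne_zero hy)).comp_contDiffWithinAt y
    (C.contDiffOn_det_frameMap y hy)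

/-- The fields of the frame are divergence free. -/
theorem fderiv_density {y : ParamSpace n} (hy : y ∈ C.param.domain) (c : FrameIdx n) :
    fderiv ℝ C.param.density y (C.field c y) +
      C.param.density y * LinearMap.trace ℝ _ (fderiv ℝ (C.field c) y).toLinearMap = 0 := by
  have ho := C.param.isOpen_domain.mem_nhds hy
  set D := fun y => LinearMap.det (C.frameMap y) with hD
  have hD0 : D y ≠ 0 := C.det_frameMap_ne_zero hy
  have hDd : DifferentiableAt ℝ D y :=
    (C.contDiffOn_det_frameMap.contDiffAt ho).differentiableAt (by simp)
  have hρd : DifferentiableAt ℝ C.param.density y :=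
    (C.contDiffOn_density.contDiffAt ho).differentiableAt (by simp)
  -- The density is the inverse of `|D|`, so its product with `D` is a locally constant sign;
  -- differentiating it turns the formula for `D` into one for the density.
  have hconst : (fun y => C.param.density y * D y) =ᶠ[𝓝 y] fun _ => SignType.sign (D y) := by
    rcases lt_or_gt_of_ne hD0 with h | h
    · filter_upwards [ho, hDd.continuousAt.eventually_lt_const h] with z hz hz'
      rw [C.density_eq hz, sign_neg h]
      have : D z ≠ 0 := hz'.ne
      rw [abs_of_neg hz', inv_neg, neg_mul, inv_mul_cancel₀ this]
      simp
    · filter_upwards [ho, hDd.continuousAt.eventually_const_lt h] with z hz hz'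
      rw [C.density_eq hz, sign_pos h]
      have : D z ≠ 0 := hz'.ne'
      rw [abs_of_pos hz', inv_mul_cancel₀ this]
      simp
  have h := congrArg (fun L => L (C.field c y)) (hρd.hasFDerivAt.mul hDd.hasFDerivAt).fderiv
  have h2 : fderiv ℝ (C.param.density * D) y = 0 := by
    have := hconst.fderiv_eq (𝕜 := ℝ)
    simp only [fderiv_fun_const] at this
    exact this
  rw [h2] at h
  simp only [zero_apply, add_apply, smul_apply, smul_eq_mul, hD, C.fderiv_det_frameMap hy] at h
  have h3 : LinearMap.det (C.frameMap y) * (fderiv ℝ C.param.density y (C.field c y) +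
      C.param.density y * LinearMap.trace ℝ _ (fderiv ℝ (C.field c) y).toLinearMap) = 0 := by
    rw [h]; ring
  exact (mul_eq_zero.1 h3).resolve_left hD0

/-- The coordinate divergence of the field weighted by the density: the two sums of the product rule
are the two terms of `fderiv_density`. -/
theorem sum_fderiv_density_mul {y : ParamSpace n} (hy : y ∈ C.param.domain) (c : FrameIdx n) :
    ∑ a, fderiv ℝ (fun y => C.param.density y * C.field c y a) y (EuclideanSpace.single a 1) = 0 := by
  have ho := C.param.isOpen_domain.mem_nhds hy
  have hρd : DifferentiableAt ℝ C.param.density y :=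
    (C.contDiffOn_density.contDiffAt ho).differentiableAt (by simp)
  have hfd : DifferentiableAt ℝ (C.field c) y :=
    ((C.contDiffOn_field c).contDiffAt ho).differentiableAt (by simp)
  have h1 : ∀ a, fderiv ℝ (fun y => C.param.density y * C.field c y a) y
      (EuclideanSpace.single a 1) = C.field c y a * fderiv ℝ C.param.density y
        (EuclideanSpace.single a 1) + C.param.density y * fderiv ℝ (C.field c) y
          (EuclideanSpace.single a 1) a := fun a => by
    have h := (hρd.hasFDerivAt.mul ((EuclideanSpace.proj (𝕜 := ℝ) a).hasFDerivAt.comp y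
      hfd.hasFDerivAt)).fderiv
    refine (congrArg (fun L => L (EuclideanSpace.single a 1)) h).trans ?_
    simp [add_comm]
  simp_rw [h1]
  rw [Finset.sum_add_distrib, ← Finset.mul_sum, ← C.fderiv_density hy c]
  congr 1
  · set b := EuclideanSpace.basisFun (FrameIdx n) ℝ
    conv_rhs => rw [← b.sum_repr (C.field c y)]
    rw [map_sum]
    refine Finset.sum_congr rfl fun a _ => ?_
    rw [map_smul, smul_eq_mul, EuclideanSpace.basisFun_repr, EuclideanSpace.basisFun_apply]
  · rw [← sum_repr_eq_trace (EuclideanSpace.basisFun (FrameIdx n) ℝ).toBasis]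
    congr 1
    refine Finset.sum_congr rfl fun a _ => ?_
    rw [OrthonormalBasis.coe_toBasis_repr_apply, EuclideanSpace.basisFun_repr,
      OrthonormalBasis.coe_toBasis, EuclideanSpace.basisFun_apply]
    rfl

/-- Integration by parts in a frame chart. -/
theorem integral_density_smul_fderiv {V : Type*} [NormedAddCommGroup V] [NormedSpace ℝ V]
    {G : ParamSpace n → V} (hG : ContDiffOn ℝ ∞ G C.param.domain) {T : Set (ParamSpace n)}
    (hT : IsCompact T) (hTd : T ⊆ C.param.domain) (h0 : ∀ y ∈ C.param.domain \ T, G y = 0)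
    (c : FrameIdx n) :
    ∫ y in C.param.domain, C.param.density y • fderiv ℝ G y (C.field c y) = 0 := by
  set dom := C.param.domain
  have hdo : IsOpen dom := C.param.isOpen_domain
  -- The components of the field weighted by the density and `G`, extended by zero. As `G` vanishes
  -- off the compact `T`, they are smooth with compact support on the whole space.
  set Q : FrameIdx n → ParamSpace n → V := fun a =>
    dom.indicator fun y => (C.param.density y * C.field c y a) • G y with hQ
  have hsm : ∀ a, ContDiffOn ℝ ∞ (fun y => C.param.density y * C.field c y a) dom := fun a =>
    C.contDiffOn_density.mul ((EuclideanSpace.proj (𝕜 := ℝ) a).contDiff.comp_contDiffOn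
      (C.contDiffOn_field c))
  have hQdom : ∀ a, ∀ y ∈ dom, Q a =ᶠ[𝓝 y] fun y => (C.param.density y * C.field c y a) • G y :=
    fun a y hy => by
      filter_upwards [hdo.mem_nhds hy] with z hz using indicator_of_mem hz _
  have hQ0 : ∀ a, ∀ y ∉ T, Q a y = 0 := fun a y hy => by
    by_cases hyd : y ∈ dom
    · simp only [hQ]
      rw [indicator_of_mem hyd, h0 y ⟨hyd, hy⟩, smul_zero]
    · exact indicator_of_notMem hyd _
  have hQs : ∀ a, ContDiff ℝ ∞ (Q a) := fun a => contDiff_iff_contDiffAt.2 fun y => by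
    by_cases hyT : y ∈ T
    · have hyd := hTd hyT
      exact (((hsm a).smul hG).contDiffAt (hdo.mem_nhds hyd)).congr_of_eventuallyEq (hQdom a y hyd)
    · refine (contDiffAt_const (c := (0 : V))).congr_of_eventuallyEq ?_
      filter_upwards [hT.isClosed.isOpen_compl.mem_nhds hyT] with z hz using hQ0 a z hz
  have hQc : ∀ a, HasCompactSupport (Q a) := fun a => HasCompactSupport.intro hT (hQ0 a)
  -- The integrand is the divergence of `Q`: the term in which `G` is not differentiated vanishes by
  -- `sum_fderiv_density_mul`.
  have hpt : ∀ y, dom.indicator (fun y => C.param.density y • fderiv ℝ G y (C.field c y)) y =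
      ∑ a, fderiv ℝ (Q a) y (EuclideanSpace.single a 1) := fun y => by
    by_cases hyd : y ∈ dom
    · have ho := hdo.mem_nhds hyd
      have hGd : DifferentiableAt ℝ G y := (hG.contDiffAt ho).differentiableAt (by simp)
      have h1 : ∀ a, fderiv ℝ (Q a) y (EuclideanSpace.single a 1) =
          (C.param.density y * C.field c y a) • fderiv ℝ G y (EuclideanSpace.single a 1) +
          fderiv ℝ (fun y => C.param.density y * C.field c y a) y (EuclideanSpace.single a 1) •
            G y := fun a => by
        have hd := (((hsm a).contDiffAt ho).differentiableAt (by simp)).hasFDerivAt.smul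
          hGd.hasFDerivAt
        rw [(hQdom a y hyd).fderiv_eq]
        refine (congrArg (fun L => L (EuclideanSpace.single a 1)) hd.fderiv).trans ?_
        simp
      simp_rw [h1]
      rw [indicator_of_mem hyd, Finset.sum_add_distrib, ← Finset.sum_smul,
        C.sum_fderiv_density_mul hyd, zero_smul, add_zero]
      conv_lhs => rw [← (EuclideanSpace.basisFun (FrameIdx n) ℝ).sum_repr (C.field c y)]
      rw [map_sum, Finset.smul_sum]
      refine Finset.sum_congr rfl fun a _ => ?_
      rw [map_smul, smul_smul, EuclideanSpace.basisFun_repr, EuclideanSpace.basisFun_apply]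
    · rw [indicator_of_notMem hyd]
      refine (Finset.sum_eq_zero fun a _ => ?_).symm
      have hyT : y ∉ T := fun h => hyd (hTd h)
      have : Q a =ᶠ[𝓝 y] fun _ => (0 : V) := by
        filter_upwards [hT.isClosed.isOpen_compl.mem_nhds hyT] with z hz using hQ0 a z hz
      rw [this.fderiv_eq]
      simp
  rw [← integral_indicator hdo.measurableSet]
  simp_rw [hpt]
  rw [integral_finsetSum]
  · exact Finset.sum_eq_zero fun a _ =>
      integral_fderiv_eq_zero volume ((hQs a).of_le (by exact_mod_cast le_top)) (hQc a) _
  · intro a _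
    exact (((hQs a).continuous_fderiv (by simp)).clm_apply
      continuous_const).integrable_of_hasCompactSupport ((hQc a).fderiv_apply ℝ _)

end FrameChart

end Frames

/-! ### Calculus with derivatives along the frame, and their integrals over $FM$. -/

section Frames

variable {n : ℕ} {M : Type*} [TopologicalSpace M] [ChartedSpace (Eu n) M]
  [IsManifold (𝓡 n) ∞ M] {g : RMetric n M} {o : OrientationForm n M}
  {V W U : Type*} [NormedAddCommGroup V] [NormedSpace ℝ V] [NormedAddCommGroup W] [NormedSpace ℝ W]
  [NormedAddCommGroup U] [NormedSpace ℝ U]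

theorem der_eq_zero_of_eventuallyEq {f : HomBundle n M → V} {w : HomBundle n M}
    (hw : w ∈ FM g o) (hf : ∀ᶠ w' in 𝓝 w, w' ∈ FM g o → f w' = 0)
    (Z : (w : HomBundle n M) → TangentSpace (IHom n) w) : der g o Z f w = 0 := by
  have h : f =ᶠ[𝓝[FM g o] w] fun _ => (0 : V) := eventually_nhdsWithin_iff.2 hf
  have h2 := h.mfderivWithin_eq (I := IHom n) (I' := 𝓘(ℝ, V)) (hf.self_of_nhds hw)
  rw [der, h2, mfderivWithin_const]
  rfl

theorem exists_param {w : HomBundle n M} (hw : w ∈ FM g o) :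
    ∃ C : FrameChart g o, ∃ y ∈ C.param.domain, C.param.toFun y = w := by
  obtain ⟨C, hC⟩ := exists_frameChart hw
  exact ⟨C, C.inv w, C.inv_mem ⟨hw, hC⟩, C.param_inv ⟨hw, hC⟩⟩

theorem differentiableAt_comp_param (C : FrameChart g o) {f : HomBundle n M → V}
    (hf : ContMDiffOn (IHom n) 𝓘(ℝ, V) ∞ f (FM g o)) {y : ParamSpace n}
    (hy : y ∈ C.param.domain) : DifferentiableAt ℝ (f ∘ C.param.toFun) y :=
  ((contDiffOn_comp_param C hf).contDiffAt (C.param.isOpen_domain.mem_nhds hy)).differentiableAt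
    (by simp)

theorem contMDiffOn_clm_comp (L : V →L[ℝ] W) {f : HomBundle n M → V}
    (hf : ContMDiffOn (IHom n) 𝓘(ℝ, V) ∞ f (FM g o)) :
    ContMDiffOn (IHom n) 𝓘(ℝ, W) ∞ (fun w => L (f w)) (FM g o) :=
  L.contDiff.contMDiff.comp_contMDiffOn hf

theorem der_clm (L : V →L[ℝ] W) {f : HomBundle n M → V}
    (hf : ContMDiffOn (IHom n) 𝓘(ℝ, V) ∞ f (FM g o)) (c : FrameIdx n) {w : HomBundle n M}
    (hw : w ∈ FM g o) :
    der g o (frameField g c) (fun w => L (f w)) w = L (der g o (frameField g c) f w) := by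
  obtain ⟨C, y, hy, rfl⟩ := exists_param hw
  rw [der_param C hf hy, der_param C (contMDiffOn_clm_comp L hf) hy]
  have h := L.hasFDerivAt.comp y (differentiableAt_comp_param C hf hy).hasFDerivAt
  exact congrArg (fun T => T (C.field c y)) h.fderiv

theorem contMDiffOn_bilin (L : V →L[ℝ] W →L[ℝ] U) {f : HomBundle n M → V} {h : HomBundle n M → W}
    (hf : ContMDiffOn (IHom n) 𝓘(ℝ, V) ∞ f (FM g o))
    (hh : ContMDiffOn (IHom n) 𝓘(ℝ, W) ∞ h (FM g o)) :
    ContMDiffOn (IHom n) 𝓘(ℝ, U) ∞ (fun w => L (f w) (h w)) (FM g o) :=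
  L.isBoundedBilinearMap.contDiff.contMDiff.comp_contMDiffOn (hf.prodMk_space hh)

theorem der_bilin (L : V →L[ℝ] W →L[ℝ] U) {f : HomBundle n M → V} {h : HomBundle n M → W}
    (hf : ContMDiffOn (IHom n) 𝓘(ℝ, V) ∞ f (FM g o))
    (hh : ContMDiffOn (IHom n) 𝓘(ℝ, W) ∞ h (FM g o)) (c : FrameIdx n) {w : HomBundle n M}
    (hw : w ∈ FM g o) :
    der g o (frameField g c) (fun w => L (f w) (h w)) w =
      L (der g o (frameField g c) f w) (h w) + L (f w) (der g o (frameField g c) h w) := by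
  obtain ⟨C, y, hy, rfl⟩ := exists_param hw
  rw [der_param C hf hy, der_param C hh hy, der_param C (contMDiffOn_bilin L hf hh) hy]
  have h := L.hasFDerivAt_of_bilinear (differentiableAt_comp_param C hf hy).hasFDerivAt
    (differentiableAt_comp_param C hh hy).hasFDerivAt
  refine (congrArg (fun T => T (C.field c y)) h.fderiv).trans ?_
  simp [add_comm]

theorem contMDiffOn_add_fun {f h : HomBundle n M → V}
    (hf : ContMDiffOn (IHom n) 𝓘(ℝ, V) ∞ f (FM g o))
    (hh : ContMDiffOn (IHom n) 𝓘(ℝ, V) ∞ h (FM g o)) :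
    ContMDiffOn (IHom n) 𝓘(ℝ, V) ∞ (fun w => f w + h w) (FM g o) :=
  contDiff_add.contMDiff.comp_contMDiffOn (hf.prodMk_space hh)

theorem der_add {f h : HomBundle n M → V}
    (hf : ContMDiffOn (IHom n) 𝓘(ℝ, V) ∞ f (FM g o))
    (hh : ContMDiffOn (IHom n) 𝓘(ℝ, V) ∞ h (FM g o)) (c : FrameIdx n) {w : HomBundle n M}
    (hw : w ∈ FM g o) :
    der g o (frameField g c) (fun w => f w + h w) w =
      der g o (frameField g c) f w + der g o (frameField g c) h w := by
  obtain ⟨C, y, hy, rfl⟩ := exists_param hw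
  rw [der_param C hf hy, der_param C hh hy, der_param C (contMDiffOn_add_fun hf hh) hy]
  exact congrArg (fun T => T (C.field c y)) (fderiv_add (differentiableAt_comp_param C hf hy)
    (differentiableAt_comp_param C hh hy))

theorem contMDiffOn_sum_smul {ι : Type*} (s : Finset ι) (a : ι → ℝ) {f : ι → HomBundle n M → V}
    (hf : ∀ i, ContMDiffOn (IHom n) 𝓘(ℝ, V) ∞ (f i) (FM g o)) :
    ContMDiffOn (IHom n) 𝓘(ℝ, V) ∞ (fun w => ∑ i ∈ s, a i • f i w) (FM g o) := by
  classical
  induction s using Finset.induction_on with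
  | empty => simpa using contMDiffOn_const
  | insert i s hi ih =>
    simp_rw [Finset.sum_insert hi]
    exact contMDiffOn_add_fun (contMDiffOn_clm_comp (a i • ContinuousLinearMap.id ℝ V) (hf i)) ih

theorem der_sum_smul {ι : Type*} (s : Finset ι) (a : ι → ℝ) {f : ι → HomBundle n M → V}
    (hf : ∀ i, ContMDiffOn (IHom n) 𝓘(ℝ, V) ∞ (f i) (FM g o)) (c : FrameIdx n)
    {w : HomBundle n M} (hw : w ∈ FM g o) :
    der g o (frameField g c) (fun w => ∑ i ∈ s, a i • f i w) w =
      ∑ i ∈ s, a i • der g o (frameField g c) (f i) w := by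
  classical
  induction s using Finset.induction_on with
  | empty => exact der_eq_zero_of_eventuallyEq hw (by simp) _
  | insert i s hi ih =>
    simp_rw [Finset.sum_insert hi]
    refine (der_add (contMDiffOn_clm_comp (a i • ContinuousLinearMap.id ℝ V) (hf i))
      (contMDiffOn_sum_smul s a hf) c hw).trans ?_
    rw [ih]
    exact congrArg (· + _) (der_clm (a i • ContinuousLinearMap.id ℝ V) (hf i) c hw)

section Compact

variable [T2Space M] [CompactSpace M]

theorem integral_der_eq_zero_of_frameChart [SecondCountableTopology V] (C : FrameChart g o)
    {f : HomBundle n M → V} (hf : ContMDiffOn (IHom n) 𝓘(ℝ, V) ∞ f (FM g o))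
    {T : Set (HomBundle n M)} (hT : IsClosed T) (hTC : T ⊆ C.nhd)
    (h0 : ∀ w ∈ FM g o \ T, f w = 0) (c : FrameIdx n) :
    ∫ w, der g o (frameField g c) f w ∂(liouville g o) = 0 := by
  rw [integral_eq_of_frameChart (contMDiffOn_der hf c).continuousOn C fun w hw =>
    der_eq_zero_of_eventuallyEq hw.1 ?_ _]
  · have hc : IsCompact (FM g o ∩ T) := (isCompact_FM g o).inter_right hT
    have hsub : FM g o ∩ T ⊆ FM g o ∩ C.nhd := inter_subset_inter_right _ hTC
    rw [← C.integral_density_smul_fderiv (contDiffOn_comp_param C hf)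
      (hc.image_of_continuousOn (C.contMDiffOn_inv.continuousOn.mono (hsub.trans inter_subset_right)))
      (by rintro _ ⟨w, hw, rfl⟩; exact C.inv_mem (hsub hw)) (fun y hy => ?_) c]
    · exact setIntegral_congr_fun C.param.isOpen_domain.measurableSet fun y hy => by
        rw [der_param C hf hy]
    · refine h0 _ ⟨(C.param_mem hy.1).1, fun hyT => hy.2 ⟨_, ⟨(C.param_mem hy.1).1, hyT⟩, ?_⟩⟩
      exact C.inv_param y hy.1
  · filter_upwards [hT.isOpen_compl.mem_nhds fun h => hw.2 (hTC h)] with w' hw' hF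
    exact h0 w' ⟨hF, hw'⟩

theorem exists_cutoff {w : HomBundle n M} (hw : w ∈ FM g o) :
    ∃ β : HomBundle n M → ℝ, ∃ C : FrameChart g o, ContMDiff (IHom n) 𝓘(ℝ, ℝ) ∞ β ∧
      tsupport β ⊆ C.nhd ∧ ∀ᶠ w' in 𝓝 w, β w' = 1 := by
  obtain ⟨C, hC⟩ := exists_frameChart hw
  obtain ⟨β, -, hβ⟩ := (SmoothBumpFunction.nhds_basis_tsupport (I := IHom n) w).mem_iff.1
    (C.isOpen_nhd.mem_nhds hC)
  exact ⟨β, C, β.contMDiff, hβ, β.eventuallyEq_one⟩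

/-- The fields of the frame are divergence free: derivatives along them integrate to zero. -/
theorem integral_der_eq_zero [SecondCountableTopology V]
    {f : HomBundle n M → V} (hf : ContMDiffOn (IHom n) 𝓘(ℝ, V) ∞ f (FM g o)) (c : FrameIdx n) :
    ∫ w, der g o (frameField g c) f w ∂(liouville g o) = 0 := by
  classical
  choose! β C hβs hβC hβ1 using fun (w : HomBundle n M) (hw : w ∈ FM g o) => exists_cutoff hw
  obtain ⟨t, htF, ht⟩ := (isCompact_FM g o).elim_nhds_subcover (fun w => {w' | β w w' = 1})
    fun w hw => hβ1 w hw
  have hint : ∀ f : HomBundle n M → V, ContMDiffOn (IHom n) 𝓘(ℝ, V) ∞ f (FM g o) →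
      Integrable (der g o (frameField g c) f) (liouville g o) := fun f hf =>
    (memLp_one_iff_integrable.1 (memLp_of_continuousOn (contMDiffOn_der hf c).continuousOn 1))
  -- In place of a partition of unity, `f` is multiplied by the factors `1 - β w` one at a time.
  -- Each factor changes the function by `β w` times a smooth function, supported in one frame
  -- chart, so the integral is unchanged. After all factors of the cover the function is zero on
  -- `FM`.
  have key : ∀ s : Finset (HomBundle n M), (∀ w ∈ s, w ∈ FM g o) →
      ContMDiffOn (IHom n) 𝓘(ℝ, V) ∞ (fun w' => (∏ w ∈ s, (1 - β w w')) • f w') (FM g o) ∧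
      ∫ w, der g o (frameField g c) f w ∂(liouville g o) =
      ∫ w, der g o (frameField g c) (fun w' => (∏ w ∈ s, (1 - β w w')) • f w') w
        ∂(liouville g o) := by
    intro s
    induction s using Finset.induction_on with
    | empty => intro _; simpa using hf
    | insert w₀ s hw₀ ih =>
      intro hs
      obtain ⟨h1, h2⟩ := ih fun w hw => hs w (Finset.mem_insert_of_mem hw)
      have hw₀F := hs w₀ (Finset.mem_insert_self _ _)
      set h := fun w' => (∏ w ∈ s, (1 - β w w')) • f w' with hh
      have hβh : ContMDiffOn (IHom n) 𝓘(ℝ, V) ∞ (fun w' => -(β w₀ w' • h w')) (FM g o) :=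
        contMDiffOn_bilin (-ContinuousLinearMap.lsmul ℝ ℝ) (hβs w₀ hw₀F).contMDiffOn h1
      have hsum : (fun w' => (∏ w ∈ insert w₀ s, (1 - β w w')) • f w') =
          fun w' => h w' + -(β w₀ w' • h w') := by
        funext w'
        rw [Finset.prod_insert hw₀, hh]
        module
      rw [hsum]
      refine ⟨contMDiffOn_add_fun h1 hβh, ?_⟩
      have h3 : ∫ w, der g o (frameField g c) (fun w' => -(β w₀ w' • h w')) w ∂(liouville g o) = 0 := by
        refine integral_der_eq_zero_of_frameChart (C w₀ hw₀F) hβh (isClosed_tsupport (β w₀))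
          (hβC w₀ hw₀F) (fun w hw => ?_) c
        rw [image_eq_zero_of_notMem_tsupport hw.2, zero_smul, neg_zero]
      have h4 : ∫ w, der g o (frameField g c) (fun w' => h w' + -(β w₀ w' • h w')) w
          ∂(liouville g o) = ∫ w, (der g o (frameField g c) h w +
            der g o (frameField g c) (fun w' => -(β w₀ w' • h w')) w) ∂(liouville g o) := by
        refine integral_congr_ae ?_
        filter_upwards [ae_mem_FM g o] with w hw using der_add h1 hβh c hw
      rw [h4, integral_add (hint _ h1) (hint _ hβh), h3, add_zero, h2]
  rw [(key t htF).2]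
  have h0 : ∀ w' ∈ FM g o, (∏ w ∈ t, (1 - β w w')) • f w' = 0 := fun w' hw' => by
    obtain ⟨w, hw, hww⟩ := mem_iUnion₂.1 (ht hw')
    rw [Finset.prod_eq_zero hw (by rw [show β w w' = 1 from hww, sub_self]), zero_smul]
  refine integral_eq_zero_of_ae ?_
  filter_upwards [ae_mem_FM g o] with w hw
  exact der_eq_zero_of_eventuallyEq hw (Eventually.of_forall h0) _

end Compact

end Frames

/-! ### The constant $n-1$ and linearity of the curvature two-form. -/

theorem toEnd_omega_e_zero {n : ℕ} [NeZero n] (p : Pairs n) :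
    toEnd (omega p) (toEnd (omega p) (e 0)) = if p.1.1 = 0 then -e 0 else 0 := by
  have h2 : p.1.2 ≠ 0 := ((Fin.zero_le _).trans_lt p.2).ne'
  have h0 : toEnd (omega p) (e 0) = if p.1.1 = 0 then e p.1.2 else 0 := by
    rw [toEnd_omega]
    simp [e_apply, h2]
  rw [h0]
  split_ifs with h
  · rw [toEnd_omega]
    simp [e_apply, h, h2.symm]
  · simp

theorem card_pairs_zero (n : ℕ) [NeZero n] :
    (Finset.univ.filter fun p : Pairs n => p.1.1 = 0).card = n - 1 := by
  have h : (Finset.Ioi (0 : Fin n)).card = n - 1 := by simp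
  rw [← h]
  refine Finset.card_bij (fun p _ => p.1.2) (fun p hp => ?_) (fun p hp q hq h => ?_) fun j hj => ?_
  · rw [Finset.mem_Ioi]
    exact (Fin.zero_le _).trans_lt p.2
  · rw [Finset.mem_filter] at hp hq
    exact Subtype.ext (Prod.ext (hp.2.trans hq.2.symm) h)
  · exact ⟨⟨(0, j), Finset.mem_Ioi.1 hj⟩, by simp, rfl⟩

/-- The square of `ω_p` is minus the projection to the plane of `p`, so only the pairs `(0, j)` act
on `e 0`, and there are `n - 1` of them. This is the source of the coefficient of `‖𝐗u‖²`. -/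
theorem sum_toEnd_omega_toEnd_omega (n : ℕ) [NeZero n] :
    ∑ p : Pairs n, toEnd (omega p) (toEnd (omega p) (e 0)) = -((n : ℝ) - 1) • (e 0 : Eu n) := by
  simp_rw [toEnd_omega_e_zero]
  rw [← Finset.sum_filter, Finset.sum_const, card_pairs_zero, ← Nat.cast_smul_eq_nsmul ℝ,
    Nat.cast_sub (NeZero.one_le), Nat.cast_one, smul_neg, neg_smul]

theorem riemann_add {n : ℕ} {M : Type*} [TopologicalSpace M] [ChartedSpace (Eu n) M]
    [IsManifold (𝓡 n) ∞ M] (g : RMetric n M) (x : M) (a a' b c : Eu n) :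
    riemann g x (a + a') b c = riemann g x a b c + riemann g x a' b c := by
  simp only [riemann, PiLp.add_apply, mul_add, add_mul, add_smul, Finset.sum_add_distrib]
  rfl

theorem riemann_smul {n : ℕ} {M : Type*} [TopologicalSpace M] [ChartedSpace (Eu n) M]
    [IsManifold (𝓡 n) ∞ M] (g : RMetric n M) (x : M) (r : ℝ) (a b c : Eu n) :
    riemann g x (r • a) b c = r • riemann g x a b c := by
  have h : ∀ s t u v : ℝ, s * (r * t) * u * v = r * (s * t * u * v) := fun _ _ _ _ => by ring
  simp only [riemann, PiLp.smul_apply, smul_eq_mul, h, mul_smul, ← Finset.smul_sum]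
  rfl

theorem curvTwoForm_sum {n : ℕ} {M : Type*} [TopologicalSpace M] [ChartedSpace (Eu n) M]
    [IsManifold (𝓡 n) ∞ M] (g : RMetric n M) (w : HomBundle n M) (a b : Eu n) (q : Pairs n) :
    curvTwoForm g w a b q = ∑ k, a k * curvTwoForm g w (e k) b q := by
  set L : Eu n →ₗ[ℝ] ℝ :=
    { toFun := fun a => curvTwoForm g w a b q
      map_add' := fun a a' => by
        have h : ev w (a + a') = ev w a + ev w a' := map_add w.snd a a'
        have h2 := riemann_add g w.proj (ev w a) (ev w a') (ev w b) (ev w (e q.1.1))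
        change g.inner w.proj (riemann g w.proj (ev w (a + a')) (ev w b) (ev w (e q.1.1)))
          (ev w (e q.1.2)) = _
        rw [h]
        refine (congrArg (fun v => g.inner w.proj v (ev w (e q.1.2))) h2).trans ?_
        rw [map_add]
        rfl
      map_smul' := fun r a => by
        have h : ev w (r • a) = r • ev w a := map_smul w.snd r a
        have h2 := riemann_smul g w.proj r (ev w a) (ev w b) (ev w (e q.1.1))
        change g.inner w.proj (riemann g w.proj (ev w (r • a)) (ev w b) (ev w (e q.1.1)))
          (ev w (e q.1.2)) = _
        rw [h]
        refine (congrArg (fun v => g.inner w.proj v (ev w (e q.1.2))) h2).trans ?_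
        rw [map_smul]
        rfl }
  have h := map_sum L (fun k => a k • e k) Finset.univ
  rw [sum_smul_e] at h
  refine h.trans (Finset.sum_congr rfl fun k _ => ?_)
  rw [map_smul]
  rfl

/-! ### The $L^2$ pairing on $FM$ and the commutators. -/

section Frames

variable {n : ℕ} {M : Type*} [TopologicalSpace M] [ChartedSpace (Eu n) M]
  [IsManifold (𝓡 n) ∞ M] [T2Space M] [CompactSpace M] {g : RMetric n M} {o : OrientationForm n M}
  {𝕜 : Type*} [RCLike 𝕜]

/-- Smooth functions on `FM`. -/
def SmoothFM (g : RMetric n M) (o : OrientationForm n M) (f : HomBundle n M → 𝕜) : Prop :=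
  ContMDiffOn (IHom n) 𝓘(ℝ, 𝕜) ∞ f (FM g o)

/-- The `L²` inner product on `FM`, linear in the first variable. -/
def pair (g : RMetric n M) (o : OrientationForm n M) (f h : HomBundle n M → 𝕜) : 𝕜 :=
  ∫ w, f w * starRingEnd 𝕜 (h w) ∂(liouville g o)

/-- The product `(a, b) ↦ a * conj b`. -/
def mulConj (𝕜 : Type*) [RCLike 𝕜] : 𝕜 →L[ℝ] 𝕜 →L[ℝ] 𝕜 :=
  (ContinuousLinearMap.compL ℝ 𝕜 𝕜 𝕜).flip (RCLike.conjCLE (K := 𝕜)).toContinuousLinearMap ∘L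
    ContinuousLinearMap.mul ℝ 𝕜

namespace SmoothFM

variable {f h f' : HomBundle n M → 𝕜}

theorem der (hf : SmoothFM g o f) (c : FrameIdx n) : SmoothFM g o (der g o (frameField g c) f) :=
  contMDiffOn_der hf c

theorem mulConj (hf : SmoothFM g o f) (hh : SmoothFM g o h) :
    SmoothFM g o fun w => f w * starRingEnd 𝕜 (h w) := contMDiffOn_bilin (Pestov.mulConj 𝕜) hf hh

theorem memLp (hf : SmoothFM g o f) (p : ENNReal) : MemLp f p (liouville g o) :=
  memLp_of_continuousOn (ContMDiffOn.continuousOn hf) p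

theorem integrable (hf : SmoothFM g o f) : Integrable f (liouville g o) :=
  memLp_one_iff_integrable.1 (hf.memLp 1)

theorem pair_add_left (hf : SmoothFM g o f) (hf' : SmoothFM g o f') (hh : SmoothFM g o h) :
    pair g o (fun w => f w + f' w) h = pair g o f h + pair g o f' h := by
  rw [pair, pair, pair, ← integral_add (hf.mulConj hh).integrable (hf'.mulConj hh).integrable]
  simp_rw [add_mul]

theorem pair_add_right (hf : SmoothFM g o f) (hf' : SmoothFM g o f') (hh : SmoothFM g o h) :
    pair g o h (fun w => f w + f' w) = pair g o h f + pair g o h f' := by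
  rw [pair, pair, pair, ← integral_add (hh.mulConj hf).integrable (hh.mulConj hf').integrable]
  simp_rw [map_add, mul_add]

theorem sum_smul {ι : Type*} (s : Finset ι) (a : ι → ℝ) {f : ι → HomBundle n M → 𝕜}
    (hf : ∀ i, SmoothFM g o (f i)) : SmoothFM g o fun w => ∑ i ∈ s, a i • f i w :=
  contMDiffOn_sum_smul s a hf

/-- Integration by parts. -/
theorem pair_der (hf : SmoothFM g o f) (hh : SmoothFM g o h) (c : FrameIdx n) :
    pair g o (Pestov.der g o (frameField g c) f) h =
      -pair g o f (Pestov.der g o (frameField g c) h) := by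
  have h1 := integral_der_eq_zero (hf.mulConj hh) c
  have h2 : ∫ w, Pestov.der g o (frameField g c) (fun w => f w * starRingEnd 𝕜 (h w)) w
      ∂(liouville g o) = pair g o (Pestov.der g o (frameField g c) f) h +
        pair g o f (Pestov.der g o (frameField g c) h) := by
    rw [pair, pair, ← integral_add ((hf.der c).mulConj hh).integrable
      (hf.mulConj (hh.der c)).integrable]
    refine integral_congr_ae ?_
    filter_upwards [ae_mem_FM g o] with w hw
    exact der_bilin (Pestov.mulConj 𝕜) hf hh c hw
  rw [h2] at h1
  exact eq_neg_of_add_eq_zero_left h1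

end SmoothFM

theorem pair_congr {f f' h h' : HomBundle n M → 𝕜} (hf : ∀ w ∈ FM g o, f w = f' w)
    (hh : ∀ w ∈ FM g o, h w = h' w) : pair g o f h = pair g o f' h' := by
  refine integral_congr_ae ?_
  filter_upwards [ae_mem_FM g o] with w hw
  rw [hf w hw, hh w hw]

theorem pair_sum_smul_left {ι : Type*} (s : Finset ι) (a : ι → ℝ) {f : ι → HomBundle n M → 𝕜}
    {h : HomBundle n M → 𝕜} (hf : ∀ i, SmoothFM g o (f i)) (hh : SmoothFM g o h) :
    pair g o (fun w => ∑ i ∈ s, a i • f i w) h = ∑ i ∈ s, a i • pair g o (f i) h := by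
  simp_rw [pair, Finset.sum_mul, smul_mul_assoc]
  rw [integral_finsetSum (f := fun i w => a i • (f i w * starRingEnd 𝕜 (h w))) _
    fun i _ => ((hf i).mulConj hh).integrable.smul (a i)]
  simp_rw [integral_smul]

theorem pair_sum_smul_right {ι : Type*} (s : Finset ι) (a : ι → ℝ) {f : ι → HomBundle n M → 𝕜}
    {h : HomBundle n M → 𝕜} (hf : ∀ i, SmoothFM g o (f i)) (hh : SmoothFM g o h) :
    pair g o h (fun w => ∑ i ∈ s, a i • f i w) = ∑ i ∈ s, a i • pair g o h (f i) := by
  have h1 : ∀ w, h w * starRingEnd 𝕜 (∑ i ∈ s, a i • f i w) =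
      ∑ i ∈ s, a i • (h w * starRingEnd 𝕜 (f i w)) := fun w => by
    rw [map_sum, Finset.mul_sum]
    refine Finset.sum_congr rfl fun i _ => ?_
    rw [RCLike.real_smul_eq_coe_mul, map_mul, RCLike.conj_ofReal, RCLike.real_smul_eq_coe_mul]
    ring
  simp_rw [pair, h1]
  rw [integral_finsetSum (f := fun i w => a i • (h w * starRingEnd 𝕜 (f i w))) _
    fun i _ => (hh.mulConj (hf i)).integrable.smul (a i)]
  simp_rw [integral_smul]

local notation "Dh" => fun k => Pestov.der g o (frameField g (Sum.inl k))
local notation "Dv" => fun p => Pestov.der g o (frameField g (Sum.inr p))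

theorem der_comm_vertical_horizontal {f : HomBundle n M → 𝕜} (hf : SmoothFM g o f) (p : Pairs n)
    (i : Fin n) {w : HomBundle n M} (hw : w ∈ FM g o) :
    Dv p (Dh i f) w = Dh i (Dv p f) w + ∑ k, toEnd (omega p) (e i) k • Dh k f w := by
  have h := der_comm hf hw (Sum.inr p) (Sum.inl i)
  rw [Fintype.sum_sum_type] at h
  simp only [structCoeff, Sum.elim_inl, Sum.elim_inr, zero_smul, Finset.sum_const_zero,
    add_zero] at h
  rw [← h]; abel

theorem der_comm_horizontal {f : HomBundle n M → 𝕜} (hf : SmoothFM g o f) (i j : Fin n)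
    {w : HomBundle n M} (hw : w ∈ FM g o) :
    Dh i (Dh j f) w = Dh j (Dh i f) w +
      -∑ q, curvTwoForm g w (e i) (e j) q • Dv q f w := by
  have h := der_comm hf hw (Sum.inl i) (Sum.inl j)
  rw [Fintype.sum_sum_type] at h
  simp only [structCoeff, Sum.elim_inl, Sum.elim_inr, zero_smul, Finset.sum_const_zero,
    zero_add, neg_smul, Finset.sum_neg_distrib] at h
  rw [← h]; abel

end Frames

/-! ### The Pestov identity for the pairings, and the curvature term. -/

section Frames

variable {n : ℕ} {M : Type*} [TopologicalSpace M] [ChartedSpace (Eu n) M]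
  [IsManifold (𝓡 n) ∞ M] [T2Space M] [CompactSpace M] {g : RMetric n M} {o : OrientationForm n M}
  {𝕜 : Type*} [RCLike 𝕜]

local notation "Dh" => fun k => Pestov.der g o (frameField g (Sum.inl k))
local notation "Dv" => fun p => Pestov.der g o (frameField g (Sum.inr p))

/-- With `b` the derivative of `u` along the horizontal field of `ω_p e 0`, the commutator replaces
one factor at a time and leaves `⟨Y_p 𝐗u, b⟩ + ⟨b, 𝐗 Y_p u⟩`. Integration by parts, a second use of
the commutator on `Y_p b`, and a last integration by parts give the commutator term and the term
with the square of `ω_p`. The coefficients of `b` are constants, so no derivative falls on them. -/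
theorem pestov_component [NeZero n] {u : HomBundle n M → 𝕜} (hu : SmoothFM g o u) (p : Pairs n) :
    pair g o (Dv p (Dh 0 u)) (Dv p (Dh 0 u)) - pair g o (Dh 0 (Dv p u)) (Dh 0 (Dv p u)) =
      ∑ k, toEnd (omega p) (e 0) k •
        (pair g o (Dh k (Dh 0 u)) (Dv p u) - pair g o (Dh 0 (Dh k u)) (Dv p u)) -
      ∑ j, toEnd (omega p) (toEnd (omega p) (e 0)) j • pair g o (Dh 0 u) (Dh j u) := by
  have hh : ∀ k, SmoothFM g o (Dh k u) := fun k => hu.der _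
  have hv : ∀ p, SmoothFM g o (Dv p u) := fun p => hu.der _
  set b : HomBundle n M → 𝕜 := fun w => ∑ k, toEnd (omega p) (e 0) k • Dh k u w with hb
  have hbs : SmoothFM g o b := SmoothFM.sum_smul _ _ hh
  have hA : SmoothFM g o (Dv p (Dh 0 u)) := (hh 0).der _
  have hA' : SmoothFM g o (Dh 0 (Dv p u)) := (hv p).der _
  have hAb : ∀ w ∈ FM g o, Dv p (Dh 0 u) w = Dh 0 (Dv p u) w + b w := fun w hw =>
    der_comm_vertical_horizontal hu p 0 hw
  have e1 : pair g o (Dv p (Dh 0 u)) (Dv p (Dh 0 u)) =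
      pair g o (Dv p (Dh 0 u)) (Dh 0 (Dv p u)) + pair g o (Dv p (Dh 0 u)) b := by
    rw [← hA'.pair_add_right hbs hA]
    exact pair_congr (fun _ _ => rfl) hAb
  have e2 : pair g o (Dv p (Dh 0 u)) (Dh 0 (Dv p u)) =
      pair g o (Dh 0 (Dv p u)) (Dh 0 (Dv p u)) + pair g o b (Dh 0 (Dv p u)) := by
    rw [← hA'.pair_add_left hbs hA']
    exact pair_congr hAb (fun _ _ => rfl)
  have e3 : pair g o (Dv p (Dh 0 u)) b = -pair g o (Dh 0 u) (Dv p b) := (hh 0).pair_der hbs _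
  have e4 : pair g o b (Dh 0 (Dv p u)) = -pair g o (Dh 0 b) (Dv p u) := by
    rw [hbs.pair_der (hv p), neg_neg]
  have e5 : pair g o (Dh 0 b) (Dv p u) =
      ∑ k, toEnd (omega p) (e 0) k • pair g o (Dh 0 (Dh k u)) (Dv p u) := by
    rw [← pair_sum_smul_left _ _ (fun k => (hh k).der _) (hv p)]
    exact pair_congr (fun w hw => der_sum_smul _ _ hh _ hw) fun _ _ => rfl
  have e6 : ∀ w ∈ FM g o, Dv p b w = (∑ k, toEnd (omega p) (e 0) k • Dh k (Dv p u) w) +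
      ∑ j, toEnd (omega p) (toEnd (omega p) (e 0)) j • Dh j u w := fun w hw => by
    have h1 : Dv p b w = ∑ k, toEnd (omega p) (e 0) k • Dv p (Dh k u) w :=
      der_sum_smul _ _ hh _ hw
    have h2 : ∀ k, Dv p (Dh k u) w = Dh k (Dv p u) w + ∑ j, toEnd (omega p) (e k) j • Dh j u w :=
      fun k => der_comm_vertical_horizontal hu p k hw
    have h3 : ∀ j, toEnd (omega p) (toEnd (omega p) (e 0)) j =
        ∑ k, toEnd (omega p) (e 0) k * toEnd (omega p) (e k) j := fun j => by
      conv_lhs => rw [← sum_smul_e (toEnd (omega p) (e 0))]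
      simp
    simp_rw [h1, h2, h3, smul_add, Finset.sum_add_distrib, Finset.smul_sum, smul_smul,
      Finset.sum_smul]
    rw [Finset.sum_comm (s := Finset.univ) (t := Finset.univ)
      (f := fun k j => (toEnd (omega p) (e 0) k * toEnd (omega p) (e k) j) • Dh j u w)]
  have e7 : pair g o (Dh 0 u) (Dv p b) =
      (∑ k, toEnd (omega p) (e 0) k • pair g o (Dh 0 u) (Dh k (Dv p u))) +
      ∑ j, toEnd (omega p) (toEnd (omega p) (e 0)) j • pair g o (Dh 0 u) (Dh j u) := by
    rw [← pair_sum_smul_right _ _ (fun k => (hv p).der _) (hh 0),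
      ← pair_sum_smul_right _ _ hh (hh 0),
      ← SmoothFM.pair_add_right (SmoothFM.sum_smul _ _ fun k => (hv p).der _)
        (SmoothFM.sum_smul _ _ hh) (hh 0)]
    exact pair_congr (fun _ _ => rfl) e6
  have e8 : ∀ k, pair g o (Dh 0 u) (Dh k (Dv p u)) = -pair g o (Dh k (Dh 0 u)) (Dv p u) :=
    fun k => by rw [(hh 0).pair_der (hv p), neg_neg]
  rw [e1, e2, e3, e4, e5, e7]
  simp_rw [e8, smul_sub, smul_neg, Finset.sum_sub_distrib, Finset.sum_neg_distrib]
  ring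

theorem pestov_pair [NeZero n] {u : HomBundle n M → 𝕜} (hu : SmoothFM g o u) :
    ∑ p, pair g o (Dv p (Dh 0 u)) (Dv p (Dh 0 u)) -
      ∑ p, pair g o (Dh 0 (Dv p u)) (Dh 0 (Dv p u)) =
      ((n : ℝ) - 1) • pair g o (Dh 0 u) (Dh 0 u) +
      ∑ p, ∑ k, toEnd (omega p) (e 0) k •
        (pair g o (Dh k (Dh 0 u)) (Dv p u) - pair g o (Dh 0 (Dh k u)) (Dv p u)) := by
  rw [← Finset.sum_sub_distrib]
  simp_rw [pestov_component hu]
  rw [Finset.sum_sub_distrib, Finset.sum_comm (f := fun (p : Pairs n) j =>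
    toEnd (omega p) (toEnd (omega p) (e 0)) j • pair g o (Dh 0 u) (Dh j u))]
  have h : ∀ j, ∑ p : Pairs n, toEnd (omega p) (toEnd (omega p) (e 0)) j =
      if j = 0 then -((n : ℝ) - 1) else 0 := fun j => by
    have := congrArg (fun v : Eu n => v j) (sum_toEnd_omega_toEnd_omega n)
    simpa [e_apply] using this
  simp_rw [← Finset.sum_smul, h]
  simp only [ite_smul, zero_smul, Finset.sum_ite_eq', Finset.mem_univ, if_true]
  module

theorem integral_norm_sq_eq_pair (f : HomBundle n M → 𝕜) :
    ((∫ w, ‖f w‖ ^ 2 ∂(liouville g o) : ℝ) : 𝕜) = pair g o f f := by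
  rw [← integral_ofReal, pair]
  congr 1
  funext w
  rw [RCLike.mul_conj, RCLike.ofReal_pow]

theorem integral_norm_sq_eq_sum_pair {F : HomBundle n M → Lam2 𝕜 n}
    {f : Pairs n → HomBundle n M → 𝕜} (hf : ∀ p, SmoothFM g o (f p))
    (hF : ∀ w ∈ FM g o, ∀ p, F w p = f p w) :
    ((∫ w, ‖F w‖ ^ 2 ∂(liouville g o) : ℝ) : 𝕜) = ∑ p, pair g o (f p) (f p) := by
  simp_rw [← integral_norm_sq_eq_pair]
  rw [← RCLike.ofReal_sum, ← integral_finsetSum]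
  · congr 1
    refine integral_congr_ae ?_
    filter_upwards [ae_mem_FM g o] with w hw
    rw [EuclideanSpace.norm_sq_eq]
    exact Finset.sum_congr rfl fun p _ => by rw [hF w hw]
  · exact fun p _ => ((hf p).memLp 2).integrable_norm_pow (by simp)

theorem contMDiffOn_toLp {f : Pairs n → HomBundle n M → 𝕜} (hf : ∀ p, SmoothFM g o (f p)) :
    ContMDiffOn (IHom n) 𝓘(ℝ, Lam2 𝕜 n) ∞ (fun w => (WithLp.toLp 2 fun p => f p w : Lam2 𝕜 n))
      (FM g o) :=
  (PiLp.continuousLinearEquiv 2 ℝ fun _ : Pairs n => 𝕜).symm.contDiff.contMDiff.comp_contMDiffOn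
    (contMDiffOn_pi_space.2 hf)

theorem der_toLp_apply {f : Pairs n → HomBundle n M → 𝕜} (hf : ∀ p, SmoothFM g o (f p))
    (c : FrameIdx n) {w : HomBundle n M} (hw : w ∈ FM g o) (p : Pairs n) :
    der g o (frameField g c) (fun w => (WithLp.toLp 2 fun p => f p w : Lam2 𝕜 n)) w p =
      der g o (frameField g c) (f p) w :=
  (der_clm (PiLp.proj (𝕜 := ℝ) 2 (fun _ : Pairs n => 𝕜) p) (contMDiffOn_toLp hf) c hw).symm

/-- By the adjoint form of its definition, the component of `R_FM ∇_𝕍 u` along `ω_p` pairs the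
curvature two-form of `(ω_p e 0, e 0)` with the vertical gradient. The bracket of horizontal fields
identifies this with minus the commutator of `B_{ω_p e 0}` and `𝐗` applied to `u`. -/
theorem extendScalars_RFM_apply [NeZero n] {u : HomBundle n M → 𝕜} (hu : SmoothFM g o u)
    {w : HomBundle n M} (hw : w ∈ FM g o) (p : Pairs n) :
    extendScalars (RFM g w) (gradV g o u w) p =
      ∑ k, -toEnd (omega p) (e 0) k • (Dh k (Dh 0 u) w + (-1 : ℝ) • Dh 0 (Dh k u) w) := by
  have h1 : ∀ q, (RFM g w (omega q) p : ℝ) =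
      ∑ k, toEnd (omega p) (e 0) k * curvTwoForm g w (e k) (e 0) q := fun q => by
    rw [← curvTwoForm_sum]
    have : RFM g w (omega q) = ∑ p : Pairs n,
      inner ℝ (curvTwoForm g w (toEnd (omega p) (e 0)) (e 0)) (omega q) • omega p := by
      simp [RFM]
    rw [this, WithLp.ofLp_sum, Finset.sum_apply, Finset.sum_eq_single p]
    · simp [omega, EuclideanSpace.inner_single_right]
    · intro p' _ hp
      simp [omega_apply, Ne.symm hp]
    · simp
  have h2 : ∀ k, Dh k (Dh 0 u) w = Dh 0 (Dh k u) w + -∑ q, curvTwoForm g w (e k) (e 0) q • Dv q u w :=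
    fun k => der_comm_horizontal hu k 0 hw
  have h3 : extendScalars (RFM g w) (gradV g o u w) p =
      ∑ q, ((RFM g w (omega q) p : ℝ) : 𝕜) * Dv q u w := rfl
  rw [h3]
  simp_rw [h2, h1, ← RCLike.real_smul_eq_coe_mul, Finset.sum_smul]
  rw [Finset.sum_comm]
  refine Finset.sum_congr rfl fun k _ => ?_
  rw [show ∀ a b : 𝕜, a + -b + (-1 : ℝ) • a = -b from fun a b => by module, neg_smul_neg,
    Finset.smul_sum]
  simp_rw [smul_smul]

end Frames

end Pestov

end

/-! ### The universal Pestov identity. -/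

theorem theorem3p1 {𝕜 : Type*} [RCLike 𝕜] {n : ℕ} [NeZero n] (hn : 2 ≤ n)
    {M : Type*} [TopologicalSpace M] [T2Space M] [CompactSpace M]
    [ChartedSpace (Eu n) M] [IsManifold (𝓡 n) ∞ M]
    (g : RMetric n M) (o : OrientationForm n M)
    (u : HomBundle n M → 𝕜) (hu : ContMDiffOn (IHom n) 𝓘(ℝ, 𝕜) ∞ u (FM g o)) :
    MemLp (gradV g o (der g o (X g) u)) 2 (liouville g o) ∧
    MemLp (der g o (X g) (gradV g o u)) 2 (liouville g o) ∧
    MemLp (der g o (X g) u) 2 (liouville g o) ∧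
    MemLp (gradV g o u) 2 (liouville g o) ∧
    MemLp (fun w => extendScalars (RFM g w) (gradV g o u w)) 2 (liouville g o) ∧
    (((∫ w, ‖gradV g o (der g o (X g) u) w‖ ^ 2 ∂(liouville g o))
        - ∫ w, ‖der g o (X g) (gradV g o u) w‖ ^ 2 ∂(liouville g o) : ℝ) : 𝕜)
      = ((((n : ℝ) - 1) * ∫ w, ‖der g o (X g) u w‖ ^ 2 ∂(liouville g o) : ℝ) : 𝕜)
        - ∫ w, inner 𝕜 (gradV g o u w) (extendScalars (RFM g w) (gradV g o u w))
            ∂(liouville g o) := by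
  have hu' : SmoothFM g o u := hu
  set Dh : Fin n → (HomBundle n M → 𝕜) → HomBundle n M → 𝕜 :=
    fun k => der g o (frameField g (Sum.inl k)) with hDh
  set Dv : Pairs n → (HomBundle n M → 𝕜) → HomBundle n M → 𝕜 :=
    fun p => der g o (frameField g (Sum.inr p)) with hDv
  have hXu : SmoothFM g o (Dh 0 u) := hu'.der _
  have hv : ∀ p, SmoothFM g o (Dv p u) := fun p => hu'.der _
  have hvX : ∀ p, SmoothFM g o (Dv p (Dh 0 u)) := fun p => hXu.der _
  have hXv : ∀ p, SmoothFM g o (Dh 0 (Dv p u)) := fun p => (hv p).der _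
  -- The components of `R_FM ∇_𝕍 u` on `FM`, written through commutators. In this form smoothness
  -- and square integrability are immediate, without any regularity statement on the curvature.
  set E : Pairs n → HomBundle n M → 𝕜 := fun p w =>
    ∑ k, -toEnd (omega p) (e 0) k • (Dh k (Dh 0 u) w + (-1 : ℝ) • Dh 0 (Dh k u) w) with hE
  have hD : ∀ k, SmoothFM g o fun w => (-1 : ℝ) • Dh 0 (Dh k u) w := fun k =>
    contMDiffOn_clm_comp ((-1 : ℝ) • ContinuousLinearMap.id ℝ 𝕜) ((hu'.der (Sum.inl k)).der _)
  have hC : ∀ k, SmoothFM g o fun w => Dh k (Dh 0 u) w + (-1 : ℝ) • Dh 0 (Dh k u) w := fun k =>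
    contMDiffOn_add_fun (hXu.der _) (hD k)
  have hEs : ∀ p, SmoothFM g o (E p) := fun p => SmoothFM.sum_smul _ _ hC
  have hR : ∀ w ∈ FM g o, extendScalars (RFM g w) (gradV g o u w) = WithLp.toLp 2 fun p => E p w :=
    fun w hw => by
      ext p
      exact extendScalars_RFM_apply hu' hw p
  have hmem : ∀ {f : Pairs n → HomBundle n M → 𝕜}, (∀ p, SmoothFM g o (f p)) →
      MemLp (fun w => (WithLp.toLp 2 fun p => f p w : Lam2 𝕜 n)) 2 (liouville g o) := fun hf =>
    memLp_of_continuousOn (contMDiffOn_toLp hf).continuousOn 2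
  refine ⟨hmem hvX, ?_, hXu.memLp 2, hmem hv, ?_, ?_⟩
  · exact memLp_of_continuousOn (contMDiffOn_der (contMDiffOn_toLp hv) (Sum.inl 0)).continuousOn 2
  · refine (hmem hEs).ae_eq ?_
    filter_upwards [ae_mem_FM g o] with w hw using (hR w hw).symm
  · have h1 : ((∫ w, ‖gradV g o (der g o (X g) u) w‖ ^ 2 ∂(liouville g o) : ℝ) : 𝕜) =
        ∑ p, pair g o (Dv p (Dh 0 u)) (Dv p (Dh 0 u)) :=
      integral_norm_sq_eq_sum_pair hvX fun _ _ _ => rfl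
    have h2 : ((∫ w, ‖der g o (X g) (gradV g o u) w‖ ^ 2 ∂(liouville g o) : ℝ) : 𝕜) =
        ∑ p, pair g o (Dh 0 (Dv p u)) (Dh 0 (Dv p u)) :=
      integral_norm_sq_eq_sum_pair hXv fun _ hw p => der_toLp_apply hv (Sum.inl 0) hw p
    have h3 : ((∫ w, ‖der g o (X g) u w‖ ^ 2 ∂(liouville g o) : ℝ) : 𝕜) =
        pair g o (Dh 0 u) (Dh 0 u) := integral_norm_sq_eq_pair _
    have h4 : ∫ w, inner 𝕜 (gradV g o u w) (extendScalars (RFM g w) (gradV g o u w))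
        -- `inner 𝕜` is conjugate-linear in its first slot, whereas `pair` conjugates the second;
        -- hence the exchanged order.
        ∂(liouville g o) = ∑ p, pair g o (E p) (Dv p u) := by
      simp_rw [pair]
      rw [← integral_finsetSum _ fun p _ => ((hEs p).mulConj (hv p)).integrable]
      refine integral_congr_ae ?_
      filter_upwards [ae_mem_FM g o] with w hw
      rw [hR w hw, PiLp.inner_apply]
      exact Finset.sum_congr rfl fun p _ => RCLike.inner_apply _ _
    have h5 : ∀ p, pair g o (E p) (Dv p u) = -∑ k, toEnd (omega p) (e 0) k •
        (pair g o (Dh k (Dh 0 u)) (Dv p u) - pair g o (Dh 0 (Dh k u)) (Dv p u)) := fun p => by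
      have h6 : ∀ k, pair g o (fun w => Dh k (Dh 0 u) w + (-1 : ℝ) • Dh 0 (Dh k u) w) (Dv p u) =
          pair g o (Dh k (Dh 0 u)) (Dv p u) - pair g o (Dh 0 (Dh k u)) (Dv p u) := fun k => by
        rw [SmoothFM.pair_add_left (hXu.der _) (hD k) (hv p), sub_eq_add_neg]
        congr 1
        rw [pair, pair, ← integral_neg]
        congr 1
        funext w
        simp
      rw [pair_sum_smul_left _ _ hC (hv p), ← Finset.sum_neg_distrib]
      exact Finset.sum_congr rfl fun k _ => by rw [h6, neg_smul]
    rw [RCLike.ofReal_sub, h1, h2, RCLike.ofReal_mul, h3, h4, ← RCLike.real_smul_eq_coe_mul,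
      pestov_pair hu']
    simp_rw [h5]
    rw [Finset.sum_neg_distrib, sub_neg_eq_add]
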